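/- Let $T\in[0,\infty)$ and let $(\Omega,\mathcal F,(\mathcal F_t)_{0\le t\le T},\mathbb P)$ be a filtered probability space satisfying the usual conditions (the filtration is right-continuous and $\mathcal F_0$ contains all $\mathbb P$-null sets). A simple integrand is a process $$H_t=\sum_{j=1}^{n} f_j\,\mathbf 1_{]\!]\tau_{j-1},\tau_j]\!]}(t),\qquad 0\le t\le T,$$ where $n$ is finite, $0=\tau_0\le\tau_1\le\dots\le\tau_n=T$ are stopping times and $f_j\in L^\infty(\Omega,\mathcal F_{\tau_{j-1}},\mathbb P)$. Put $\|H\|_\infty=\sup_{0\le t\le T}\|H_t\|_{L^\infty(\mathbb P)}$ and, for a real-valued process $S$, $$(H\cdot S)_t=\sum_{j=1}^{n} f_j\,(S_{\tau_j\wedge t}-S_{\tau_{j-1}\wedge t}),\qquad 0\le t\le T.$$ **Theorem.** For a real-valued, càdlàg, adapted process $S=(S_t)_{0\le t\le T}$ the following are equivalent. 1. For every sequence $(H^n)_{n\ge1}$ of simple integrands with $\lim_n\|H^n\|_\infty=0$ and $\lim_n\sup_{0\le t\le T}\big((H^n\cdot S)_t\big)^-=0$ in probability, we have $\lim_n (H^n\cdot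 S)_T^+=0$ in probability. 2. $S$ is a semimartingale, i.e. $S=M+A$ (up to indistinguishability), where $M=(M_t)_{0\le t\le T}$ is a càdlàg local martingale and $A=(A_t)_{0\le t\le T}$ is a càdlàg adapted process whose paths are almost surely of finite variation on $[0,T]$. Here $M$ is a local martingale if it is adapted and there are stopping times $\sigma_k$ with values in $[0,T]\cup\{\infty\}$, almost surely nondecreasing in $k$ and almost surely equal to $\infty$ for all large $k$, such that $(M_{t\wedge\sigma_k}\mathbf 1_{\{\sigma_k>0\}})_{0\le t\le T}$ is a martingale for every $k$. -/

import Mathlib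

open MeasureTheory ProbabilityTheory Filter Topology
open scoped ENNReal

noncomputable section

namespace BichtelerDellacherie

/-- The usual conditions for a filtration indexed by `[0, T]`: right-continuity at every `t < T`,
and `𝓕 0` contains every null set (in particular `P` is complete). -/
structure UsualConditions {Ω : Type*} {mΩ : MeasurableSpace Ω} {T : ℝ} [Fact (0 ≤ T)]
    (𝓕 : Filtration (Set.Icc (0 : ℝ) T) mΩ) (P : Measure Ω) : Prop where
  rightContinuous : 𝓕.IsRightContinuous
  complete : ∀ s : Set Ω, P s = 0 → MeasurableSet[𝓕 ⊥] s

/-- A càdlàg function on `[0, T]`: right-continuous with finite left limits. -/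
def IsCadlag {T : ℝ} (x : Set.Icc (0 : ℝ) T → ℝ) : Prop :=
  ∀ t, ContinuousWithinAt x (Set.Ici t) t ∧ ∃ l : ℝ, Tendsto x (𝓝[<] t) (𝓝 l)

/-- A process whose paths are almost surely càdlàg. -/
def IsCadlagProcess {Ω : Type*} {mΩ : MeasurableSpace Ω} {T : ℝ}
    (X : Set.Icc (0 : ℝ) T → Ω → ℝ) (P : Measure Ω) : Prop :=
  ∀ᵐ ω ∂P, IsCadlag (fun t ↦ X t ω)

/-- A (representation of a) simple integrand
`H = ∑ j, f j * 𝟙_{⟧τ j, τ (j + 1)⟧}` with stopping times `0 = τ 0 ≤ τ 1 ≤ ⋯ ≤ τ n = T` and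
`f j ∈ L^∞(Ω, 𝓕_{τ j}, P)` for `j = 0, …, n - 1`. -/
structure SimpleIntegrand {Ω : Type*} {mΩ : MeasurableSpace Ω} {T : ℝ} [Fact (0 ≤ T)]
    (𝓕 : Filtration (Set.Icc (0 : ℝ) T) mΩ) (P : Measure Ω) where
  n : ℕ
  τ : Fin (n + 1) → Ω → Set.Icc (0 : ℝ) T
  isStoppingTime : ∀ j, IsStoppingTime 𝓕 (fun ω ↦ ((τ j ω : Set.Icc (0 : ℝ) T) : WithTop _))
  mono : ∀ ω, Monotone (fun j ↦ τ j ω)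
  τ_zero : ∀ ω, τ 0 ω = ⊥
  τ_last : ∀ ω, τ (Fin.last n) ω = ⊤
  f : Fin n → Ω → ℝ
  measurable_f : ∀ j : Fin n, Measurable[(isStoppingTime j.castSucc).measurableSpace] (f j)
  memLp_f : ∀ j, MemLp (f j) ∞ P

namespace SimpleIntegrand

variable {Ω : Type*} {mΩ : MeasurableSpace Ω} {T : ℝ} [Fact (0 ≤ T)]
  {𝓕 : Filtration (Set.Icc (0 : ℝ) T) mΩ} {P : Measure Ω}

/-- The value `H_t(ω)` of the simple integrand. -/
def val (H : SimpleIntegrand 𝓕 P) (t : Set.Icc (0 : ℝ) T) (ω : Ω) : ℝ :=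
  ∑ j : Fin H.n,
    (Set.Ioc (H.τ j.castSucc ω) (H.τ j.succ ω)).indicator (fun _ ↦ H.f j ω) t

/-- The norm `‖H‖ = sup_{0 ≤ t ≤ T} ‖H_t‖_{L^∞(P)}`. -/
def supNorm (H : SimpleIntegrand 𝓕 P) : ℝ≥0∞ :=
  ⨆ t : Set.Icc (0 : ℝ) T, eLpNorm (H.val t) ∞ P

/-- The integral process `(H · S)_t = ∑ j, f j * (S_{τ (j + 1) ∧ t} - S_{τ j ∧ t})`. -/
def integral (H : SimpleIntegrand 𝓕 P) (S : Set.Icc (0 : ℝ) T → Ω → ℝ)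
    (t : Set.Icc (0 : ℝ) T) (ω : Ω) : ℝ :=
  ∑ j : Fin H.n,
    H.f j ω * (S (min (H.τ j.succ ω) t) ω - S (min (H.τ j.castSucc ω) t) ω)

end SimpleIntegrand

/-- A càdlàg local martingale on `[0, T]`. As the index set has a greatest element, the localizing
stopping times, with values in `[0, T] ∪ {∞}`, are almost surely eventually equal to `∞`. -/
structure IsLocalMartingale {Ω : Type*} {mΩ : MeasurableSpace Ω} {T : ℝ} [Fact (0 ≤ T)]
    (M : Set.Icc (0 : ℝ) T → Ω → ℝ) (𝓕 : Filtration (Set.Icc (0 : ℝ) T) mΩ)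
    (P : Measure Ω) : Prop where
  adapted : StronglyAdapted 𝓕 M
  cadlag : IsCadlagProcess M P
  locally_martingale : Locally (fun X ↦ Martingale X 𝓕 P) 𝓕 M P

/-- A càdlàg adapted process with almost surely paths of finite variation on `[0, T]`. -/
structure IsFiniteVariationProcess {Ω : Type*} {mΩ : MeasurableSpace Ω} {T : ℝ}
    (A : Set.Icc (0 : ℝ) T → Ω → ℝ) (𝓕 : Filtration (Set.Icc (0 : ℝ) T) mΩ)
    (P : Measure Ω) : Prop where
  adapted : StronglyAdapted 𝓕 A
  cadlag : IsCadlagProcess A P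
  finiteVariation : ∀ᵐ ω ∂P, BoundedVariationOn (fun t ↦ A t ω) Set.univ

/-- `S` is a semimartingale: `S = M + A` (up to indistinguishability) with a local martingale `M`
and an adapted process `A` of finite variation. -/
def IsSemimartingale {Ω : Type*} {mΩ : MeasurableSpace Ω} {T : ℝ} [Fact (0 ≤ T)]
    (S : Set.Icc (0 : ℝ) T → Ω → ℝ) (𝓕 : Filtration (Set.Icc (0 : ℝ) T) mΩ)
    (P : Measure Ω) : Prop :=
  ∃ M A : Set.Icc (0 : ℝ) T → Ω → ℝ,
    IsLocalMartingale M 𝓕 P ∧ IsFiniteVariationProcess A 𝓕 P ∧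
      ∀ᵐ ω ∂P, ∀ t, S t ω = M t ω + A t ω

end BichtelerDellacherie

end

set_option linter.unusedSectionVars false

noncomputable section

namespace BichtelerDellacherie

/-! ### Functions of bounded variation. -/

section BoundedVariation

variable {α : Type*} [LinearOrder α] {f g : α → ℝ} {s : Set α}

/-! From condition 1 to semimartingales. By rescaling, uniformly bounded integrands whose losses are
bounded in probability have terminal gains bounded in probability (`NoFreeLunch.tight`). Two
integrands on dyadic grids exploit this. The integrand `-2S` yields, up to a boundary term, the sum
of the squared increments of `S`, so these sums are bounded in probability (`tight_quad`). Kill `S`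
once `|S|` or the sum becomes large: the martingale part of the discrete Doob decomposition is then
bounded in L². Integrating the sign of the drift yields the variation of the drift plus a martingale
controlled by Doob's maximal inequality, so this variation is bounded in probability as well
(`tight_drift`). After a second killing, `S` is along every grid, and outside an event of small
probability, an L²-bounded martingale plus a process of bounded variation, with bounds that do not
depend on the grid (`exists_discrete_decomposition`).

To let the mesh tend to zero, terminal values of martingales and survival indicators are replaced by
convex combinations of their tails, which converge almost surely. The limit `R` of the survival
indicators is no longer an indicator, but it is decreasing in time and stays above 1/2 outside a
small event. The limit argument decomposes the product of `S` with the regularization of `R`;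
dividing by that factor is harmless because a bounded finite variation process times an
L²-martingale decomposes again (`exists_decomposition_mul`). So `S` is a martingale plus a finite
variation process outside events of arbitrarily small probability, and Borel–Cantelli allows these
decompositions to be pasted into one (`isSemimartingale_of_approximate_decomposition`).

Conversely, the gain against the finite variation part is at most the norm of the integrand times
the variation. The local martingale part agrees with a true martingale outside a small event;
stopped when its losses or the martingale itself get large, the transform has mean zero, so a small
loss forces a small gain by Markov's inequality (`measure_gain_le`). -/

lemma boundedVariationOn_add (hf : BoundedVariationOn f s) (hg : BoundedVariationOn g s) :
    BoundedVariationOn (fun t ↦ f t + g t) s := by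
  refine ne_top_of_le_ne_top (ENNReal.add_ne_top.2 ⟨hf, hg⟩) (iSup_le ?_)
  rintro ⟨n, u, hu, us⟩
  refine le_trans ?_ (add_le_add (eVariationOn.sum_le (n := n) hu us)
    (eVariationOn.sum_le (n := n) hu us))
  rw [← Finset.sum_add_distrib]
  exact Finset.sum_le_sum fun i _ ↦ edist_add_add_le _ _ _ _

lemma boundedVariationOn_neg (hf : BoundedVariationOn f s) :
    BoundedVariationOn (fun t ↦ -f t) s :=
  (LipschitzWith.id.neg : LipschitzWith 1 fun x : ℝ ↦ -x).comp_boundedVariationOn hf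

lemma boundedVariationOn_sub (hf : BoundedVariationOn f s) (hg : BoundedVariationOn g s) :
    BoundedVariationOn (fun t ↦ f t - g t) s := by
  simp_rw [sub_eq_add_neg]
  exact boundedVariationOn_add hf (boundedVariationOn_neg hg)

lemma boundedVariationOn_const (c : ℝ) : BoundedVariationOn (fun _ ↦ c) s := by
  have : eVariationOn (fun _ : α ↦ c) s = 0 :=
    eVariationOn.constant_on (Set.subsingleton_singleton.anti (by rintro _ ⟨x, _, rfl⟩; rfl))
  simp [BoundedVariationOn, this]

lemma boundedVariationOn_sum {ι : Type*} (I : Finset ι) {F : ι → α → ℝ}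
    (hF : ∀ i ∈ I, BoundedVariationOn (F i) s) :
    BoundedVariationOn (fun t ↦ ∑ i ∈ I, F i t) s := by
  classical
  induction I using Finset.induction_on with
  | empty => simpa using boundedVariationOn_const 0
  | insert i I hi ih =>
    simp_rw [Finset.sum_insert hi]
    exact boundedVariationOn_add (hF i (Finset.mem_insert_self i I))
      (ih fun j hj ↦ hF j (Finset.mem_insert_of_mem hj))

lemma monotone_boundedVariationOn_univ [BoundedOrder α] (hf : Monotone f) :
    BoundedVariationOn f Set.univ := by
  refine MonotoneOn.boundedVariationOn (C := max |f ⊥| |f ⊤|) (hf.monotoneOn _) fun x _ ↦ ?_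
  exact abs_le_max_abs_abs (hf bot_le) (hf le_top)

end BoundedVariation

/-! ### Dyadic grids and regularization along them. -/

section Grid

variable {T : ℝ} [hT : Fact (0 ≤ T)]

/-- The dyadic grid `T * j / 2 ^ n` of `[0, T]`, constant equal to `T` for `j ≥ 2 ^ n`. -/
def grid (T : ℝ) [Fact (0 ≤ T)] (n j : ℕ) : Set.Icc (0 : ℝ) T :=
  Set.projIcc 0 T Fact.out (T * j / 2 ^ n)

/-- The smallest point of the `n`-th dyadic grid strictly larger than `t` (or `T`). -/
def next (n : ℕ) (t : Set.Icc (0 : ℝ) T) : Set.Icc (0 : ℝ) T :=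
  grid T n (⌊(t : ℝ) * 2 ^ n / T⌋₊ + 1)

/-- The variation of `a` along the `n`-th dyadic grid. -/
def gridVar (a : Set.Icc (0 : ℝ) T → ℝ) (n : ℕ) : ℝ :=
  ∑ j ∈ Finset.range (2 ^ n), |a (grid T n (j + 1)) - a (grid T n j)|

lemma T_nonneg : 0 ≤ T := hT.out

lemma coe_top : ((⊤ : Set.Icc (0 : ℝ) T) : ℝ) = T := rfl

lemma grid_mono (n : ℕ) : Monotone (grid T n) := by
  intro i j hij
  have := T_nonneg (T := T)
  refine Set.monotone_projIcc _ ?_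
  gcongr

lemma grid_zero (n : ℕ) : grid T n 0 = ⊥ := by
  apply Subtype.ext
  simp [grid]

lemma grid_top {n j : ℕ} (h : 2 ^ n ≤ j) : grid T n j = ⊤ := by
  have := T_nonneg (T := T)
  have h' : ((2 : ℝ) ^ n) ≤ j := by exact_mod_cast h
  apply Subtype.ext
  simp only [grid, Set.coe_projIcc, coe_top]
  have : T ≤ T * j / 2 ^ n := by
    rw [le_div_iff₀ (by positivity)]; gcongr
  rw [min_eq_left this, max_eq_right T_nonneg]

lemma coe_grid {n j : ℕ} (h : j ≤ 2 ^ n) : (grid T n j : ℝ) = T * j / 2 ^ n := by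
  have hT' := T_nonneg (T := T)
  have h' : (j : ℝ) ≤ ((2 : ℝ) ^ n) := by exact_mod_cast h
  simp only [grid, Set.coe_projIcc]
  have : T * j / 2 ^ n ≤ T := by
    rw [div_le_iff₀ (by positivity)]; gcongr
  rw [min_eq_right this, max_eq_right (by positivity)]

lemma grid_refine (n k j : ℕ) : grid T n j = grid T (n + k) (2 ^ k * j) := by
  unfold grid
  congr 1
  push_cast
  rw [pow_add]
  field_simp

lemma grid_refine_of_le {n m : ℕ} (h : n ≤ m) (j : ℕ) :
    grid T n j = grid T m (2 ^ (m - n) * j) := by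
  obtain ⟨k, rfl⟩ := Nat.exists_eq_add_of_le h
  rw [Nat.add_sub_cancel_left]
  exact grid_refine n k j

lemma next_top (n : ℕ) : next n (⊤ : Set.Icc (0 : ℝ) T) = ⊤ := by
  rcases (T_nonneg (T := T)).eq_or_lt with h | h
  · exact Subtype.ext (le_antisymm (next n ⊤).2.2 (h.symm.le.trans (next n ⊤).2.1))
  · refine grid_top ?_
    have : ((⊤ : Set.Icc (0 : ℝ) T) : ℝ) * 2 ^ n / T = ((2 ^ n : ℕ) : ℝ) := by
      rw [coe_top]; push_cast; field_simp
    rw [this, Nat.floor_natCast]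
    omega

lemma T_pos_of_lt {s t : Set.Icc (0 : ℝ) T} (h : s < t) : 0 < T :=
  lt_of_le_of_lt s.2.1 (lt_of_lt_of_le (show (s : ℝ) < t from h) t.2.2)

lemma floor_lt_of_lt_top {t : Set.Icc (0 : ℝ) T} (h : t < ⊤) (n : ℕ) :
    ⌊(t : ℝ) * 2 ^ n / T⌋₊ + 1 ≤ 2 ^ n := by
  have hT := T_pos_of_lt h
  have h' : (t : ℝ) < T := h
  rw [Nat.add_one_le_iff, Nat.floor_lt (by have := t.2.1; positivity), div_lt_iff₀ hT]
  push_cast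
  rw [mul_comm]
  gcongr

lemma coe_next {t : Set.Icc (0 : ℝ) T} (h : t < ⊤) (n : ℕ) :
    (next n t : ℝ) = T * (⌊(t : ℝ) * 2 ^ n / T⌋₊ + 1) / 2 ^ n := by
  rw [next, coe_grid (floor_lt_of_lt_top h n)]
  push_cast
  rfl

lemma lt_next {t : Set.Icc (0 : ℝ) T} (h : t < ⊤) (n : ℕ) : t < next n t := by
  have hT := T_pos_of_lt h
  change (t : ℝ) < next n t
  rw [coe_next h, lt_div_iff₀ (by positivity), mul_comm T, ← div_lt_iff₀ hT]
  exact Nat.lt_floor_add_one _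

lemma le_next (t : Set.Icc (0 : ℝ) T) (n : ℕ) : t ≤ next n t := by
  rcases lt_or_eq_of_le (le_top : t ≤ ⊤) with h | rfl
  · exact (lt_next h n).le
  · rw [next_top]

lemma next_le_add {t : Set.Icc (0 : ℝ) T} (h : t < ⊤) (n : ℕ) :
    (next n t : ℝ) ≤ t + T / 2 ^ n := by
  have hT := T_pos_of_lt h
  rw [coe_next h]
  have h1 := Nat.floor_le (show 0 ≤ (t : ℝ) * 2 ^ n / T by have := t.2.1; positivity)
  rw [le_div_iff₀ hT] at h1
  rw [div_le_iff₀ (by positivity), add_mul, div_mul_cancel₀ _ (by positivity)]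
  linarith

lemma tendsto_next_gt {t : Set.Icc (0 : ℝ) T} (h : t < ⊤) :
    Tendsto (fun n ↦ next n t) atTop (𝓝[>] t) := by
  refine tendsto_nhdsWithin_iff.2 ⟨?_, Eventually.of_forall fun n ↦ lt_next h n⟩
  rw [tendsto_subtype_rng]
  have h1 : Tendsto (fun n : ℕ ↦ (t : ℝ) + T / 2 ^ n) atTop (𝓝 ((t : ℝ) + 0)) := by
    refine tendsto_const_nhds.add ?_
    exact tendsto_const_nhds.div_atTop (tendsto_pow_atTop_atTop_of_one_lt one_lt_two)
  rw [add_zero] at h1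
  exact tendsto_of_tendsto_of_tendsto_of_le_of_le tendsto_const_nhds h1
    (fun n ↦ (lt_next h n).le) (fun n ↦ next_le_add h n)

lemma tendsto_next_ge (t : Set.Icc (0 : ℝ) T) :
    Tendsto (fun n ↦ next n t) atTop (𝓝[≥] t) := by
  rcases lt_or_eq_of_le (le_top : t ≤ ⊤) with h | rfl
  · exact (tendsto_next_gt h).mono_right (nhdsWithin_mono _ Set.Ioi_subset_Ici_self)
  · simp only [next_top]
    exact tendsto_const_nhdsWithin (Set.mem_Ici.2 le_rfl)

lemma exists_grid_mem_Ioo {s t : Set.Icc (0 : ℝ) T} (h : s < t) :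
    ∃ n j, s < grid T n j ∧ grid T n j < t := by
  have hs : s < ⊤ := h.trans_le le_top
  obtain ⟨n, h1, h2⟩ := ((tendsto_next_gt hs).eventually (Ioo_mem_nhdsGT h)).exists
  exact ⟨n, _, h1, h2⟩

lemma range_grid (n : ℕ) : Set.range (grid T n) = grid T n '' Set.Iic (2 ^ n) := by
  refine Set.Subset.antisymm ?_ (Set.image_subset_range _ _)
  rintro _ ⟨j, rfl⟩
  rcases le_total j (2 ^ n) with h | h
  · exact ⟨j, h, rfl⟩
  · exact ⟨2 ^ n, Set.mem_Iic.2 le_rfl, by rw [grid_top h, grid_top le_rfl]⟩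

lemma range_grid_mono {n m : ℕ} (h : n ≤ m) :
    Set.range (grid T n) ⊆ Set.range (grid T m) := by
  rintro _ ⟨j, rfl⟩
  exact ⟨_, (grid_refine_of_le h j).symm⟩

lemma gridVar_nonneg (a : Set.Icc (0 : ℝ) T → ℝ) (n : ℕ) : 0 ≤ gridVar a n :=
  Finset.sum_nonneg fun _ _ ↦ abs_nonneg _

lemma eVariationOn_range_grid (a : Set.Icc (0 : ℝ) T → ℝ) (n : ℕ) :
    eVariationOn a (Set.range (grid T n)) = ENNReal.ofReal (gridVar a n) := by
  rw [range_grid, eVariationOn.image_range_of_monotone _ (grid_mono n), gridVar,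
    ENNReal.ofReal_sum_of_nonneg fun _ _ ↦ abs_nonneg _]
  refine Finset.sum_congr rfl fun j _ ↦ ?_
  rw [edist_comm, edist_dist, Real.dist_eq]

lemma gridVar_mono (a : Set.Icc (0 : ℝ) T → ℝ) : Monotone (gridVar a) := by
  intro n m h
  rw [← ENNReal.ofReal_le_ofReal_iff (gridVar_nonneg a m), ← eVariationOn_range_grid,
    ← eVariationOn_range_grid]
  exact eVariationOn.mono _ (range_grid_mono h)

lemma eVariationOn_comp_le_gridVar (a : Set.Icc (0 : ℝ) T → ℝ) (n : ℕ)
    {φ : Set.Icc (0 : ℝ) T → ℕ} (hφ : Monotone φ) (s : Set (Set.Icc (0 : ℝ) T)) :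
    eVariationOn (fun t ↦ a (grid T n (φ t))) s ≤ ENNReal.ofReal (gridVar a n) := by
  rw [← eVariationOn_range_grid]
  exact eVariationOn.comp_le_of_monotoneOn a (fun t ↦ grid T n (φ t))
    (((grid_mono n).comp hφ).monotoneOn _) fun t _ ↦ ⟨_, rfl⟩

lemma floor_index_mono (n : ℕ) :
    Monotone (fun t : Set.Icc (0 : ℝ) T ↦ ⌊(t : ℝ) * 2 ^ n / T⌋₊) := by
  intro s t hst
  have := T_nonneg (T := T)
  have h : (s : ℝ) ≤ t := hst
  dsimp only
  gcongr

lemma eVariationOn_next_le (a : Set.Icc (0 : ℝ) T → ℝ) (n : ℕ) :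
    eVariationOn (fun t ↦ a (next n t)) Set.univ ≤ ENNReal.ofReal (gridVar a n) :=
  eVariationOn_comp_le_gridVar a n (fun _ _ h ↦ Nat.add_le_add_right (floor_index_mono n h) 1) _

/-- Variation is lower semicontinuous under pointwise convergence, and `a ∘ next n` only visits
points of the `n`-th grid in increasing order. -/
lemma eVariationOn_le_of_tendsto_next {a b : Set.Icc (0 : ℝ) T → ℝ} {Z : ℝ≥0∞}
    (h : ∀ t, Tendsto (fun n ↦ a (next n t)) atTop (𝓝 (b t)))
    (hZ : ∀ n, ENNReal.ofReal (gridVar a n) ≤ Z) : eVariationOn b Set.univ ≤ Z := by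
  by_contra! hlt
  obtain ⟨n, hn⟩ := (eVariationOn.lowerSemicontinuous_aux (fun x _ ↦ h x) hlt).exists
  exact absurd (hn.trans_le (eVariationOn_next_le a n)) (not_lt.2 (hZ n))

lemma grid_floor_grid (n k j : ℕ) :
    grid T (n + k) ⌊(grid T n j : ℝ) * 2 ^ (n + k) / T⌋₊ = grid T n j := by
  rcases (T_nonneg (T := T)).eq_or_lt with h | h
  · refine Subtype.ext (le_antisymm ?_ ?_)
    · exact (Subtype.prop (grid T (n + k) _)).2.trans (h.symm.le.trans (grid T n j).2.1)
    · exact (grid T n j).2.2.trans (h.symm.le.trans (Subtype.prop (grid T (n + k) _)).1)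
  · rcases le_total j (2 ^ n) with hj | hj
    · rw [coe_grid hj, grid_refine n k j]
      congr 1
      have : T * j / 2 ^ n * 2 ^ (n + k) / T = ((2 ^ k * j : ℕ) : ℝ) := by
        push_cast
        rw [pow_add]
        field_simp
      rw [this, Nat.floor_natCast]
    · rw [grid_top hj, coe_top]
      refine grid_top ?_
      have : T * 2 ^ (n + k) / T = ((2 ^ (n + k) : ℕ) : ℝ) := by
        push_cast
        field_simp
      rw [this, Nat.floor_natCast]

/-- The set of all dyadic points. -/
def dyadics (T : ℝ) [Fact (0 ≤ T)] : Set (Set.Icc (0 : ℝ) T) := {q | ∃ n j, q = grid T n j}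

lemma grid_mem_dyadics (n j : ℕ) : grid T n j ∈ dyadics T := ⟨n, j, rfl⟩

lemma next_mem_dyadics (n : ℕ) (t : Set.Icc (0 : ℝ) T) : next n t ∈ dyadics T := ⟨n, _, rfl⟩

lemma top_mem_dyadics : (⊤ : Set.Icc (0 : ℝ) T) ∈ dyadics T := by
  rw [← next_top 0]; exact next_mem_dyadics _ _

lemma bot_mem_dyadics : (⊥ : Set.Icc (0 : ℝ) T) ∈ dyadics T := by
  rw [← grid_zero 0]; exact grid_mem_dyadics _ _

lemma countable_dyadics : (dyadics T).Countable := by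
  have : dyadics T = Set.range (fun p : ℕ × ℕ ↦ grid T p.1 p.2) := by
    ext q
    constructor
    · rintro ⟨n, j, rfl⟩; exact ⟨(n, j), rfl⟩
    · rintro ⟨p, rfl⟩; exact ⟨p.1, p.2, rfl⟩
  rw [this]
  exact Set.countable_range _

/-- Rounding down to the `m`-th grid eventually fixes each dyadic point, so lower semicontinuity
applies on the dyadics without any continuity of `a`. -/
lemma eVariationOn_dyadics_le {a : Set.Icc (0 : ℝ) T → ℝ} {Z : ℝ≥0∞}
    (hZ : ∀ n, ENNReal.ofReal (gridVar a n) ≤ Z) : eVariationOn a (dyadics T) ≤ Z := by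
  by_contra! hlt
  have h : ∀ x ∈ dyadics T,
      Tendsto (fun m ↦ a (grid T m ⌊(x : ℝ) * 2 ^ m / T⌋₊)) atTop (𝓝 (a x)) := by
    rintro _ ⟨n, j, rfl⟩
    refine tendsto_const_nhds.congr' ?_
    filter_upwards [eventually_ge_atTop n] with m hm
    obtain ⟨k, rfl⟩ := Nat.exists_eq_add_of_le hm
    rw [grid_floor_grid]
  obtain ⟨n, hn⟩ := (eVariationOn.lowerSemicontinuous_aux h hlt).exists
  exact absurd (hn.trans_le (eVariationOn_comp_le_gridVar a n (floor_index_mono n) _))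
    (not_lt.2 (hZ n))

lemma gridVar_le_eVariationOn (a : Set.Icc (0 : ℝ) T → ℝ) (n : ℕ) :
    ENNReal.ofReal (gridVar a n) ≤ eVariationOn a Set.univ := by
  rw [← eVariationOn_range_grid]
  exact eVariationOn.mono _ (Set.subset_univ _)

/-- Jordan decomposition: each monotone part extends, being bounded by its values at the two
endpoints, which are dyadic. The extension gives access to one-sided limits on the whole interval.
-/
lemma exists_boundedVariationOn_extension {a : Set.Icc (0 : ℝ) T → ℝ}
    (ha : BoundedVariationOn a (dyadics T)) :
    ∃ b : Set.Icc (0 : ℝ) T → ℝ, BoundedVariationOn b Set.univ ∧ ∀ q ∈ dyadics T, b q = a q := by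
  obtain ⟨p, q, hp, hq, rfl⟩ :=
    ha.locallyBoundedVariationOn.exists_monotoneOn_sub_monotoneOn
  have key : ∀ p : Set.Icc (0 : ℝ) T → ℝ, MonotoneOn p (dyadics T) →
      ∃ g, BoundedVariationOn g Set.univ ∧ Set.EqOn p g (dyadics T) := by
    intro p hp
    obtain ⟨g, hg, hpg⟩ := hp.exists_monotone_extension
      ⟨p ⊥, by rintro _ ⟨x, hx, rfl⟩; exact hp bot_mem_dyadics hx bot_le⟩
      ⟨p ⊤, by rintro _ ⟨x, hx, rfl⟩; exact hp hx top_mem_dyadics le_top⟩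
    exact ⟨g, monotone_boundedVariationOn_univ hg, hpg⟩
  obtain ⟨g, hg, hpg⟩ := key p hp
  obtain ⟨g', hg', hpg'⟩ := key q hq
  exact ⟨g - g', boundedVariationOn_sub hg hg', fun x hx ↦ by simp [hpg hx, hpg' hx]⟩

/-- A function of bounded variation along the dyadic grids has a càdlàg regularization. -/
lemma exists_cadlag_regularization {a : Set.Icc (0 : ℝ) T → ℝ} {Z : ℝ}
    (hZ : ∀ n, gridVar a n ≤ Z) :
    ∃ b : Set.Icc (0 : ℝ) T → ℝ, IsCadlag b ∧ BoundedVariationOn b Set.univ ∧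
      ∀ t, Tendsto (fun n ↦ a (next n t)) atTop (𝓝 (b t)) := by
  have h1 : BoundedVariationOn a (dyadics T) :=
    ((eVariationOn_dyadics_le fun n ↦ ENNReal.ofReal_le_ofReal (hZ n)).trans_lt
      ENNReal.ofReal_lt_top).ne
  obtain ⟨g, hg, hag⟩ := exists_boundedVariationOn_extension h1
  refine ⟨g.rightLim, fun t ↦ ⟨hg.continuousWithinAt_rightLim, ?_⟩, hg.rightLim, fun t ↦ ?_⟩
  · exact ⟨_, hg.rightLim.tendsto_leftLim t⟩
  · simp_rw [← hag _ (next_mem_dyadics _ t)]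
    rcases lt_or_eq_of_le (le_top : t ≤ ⊤) with h | rfl
    · exact (hg.tendsto_rightLim t).comp (tendsto_next_gt h)
    · simp only [next_top]
      -- At the right endpoint the punctured right neighbourhood is empty, and `rightLim` defaults
      -- to the value.
      rw [rightLim_eq_of_eq_bot]
      · exact tendsto_const_nhds
      · rw [Set.Ioi_top, nhdsWithin_empty]

end Grid

/-! ### Càdlàg paths. -/

section Cadlag

variable {T : ℝ} [hT : Fact (0 ≤ T)] {x y : Set.Icc (0 : ℝ) T → ℝ}

lemma IsCadlag.comp {g : ℝ → ℝ} (hx : IsCadlag x) (hg : Continuous g) :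
    IsCadlag (fun t ↦ g (x t)) := fun t ↦ by
  obtain ⟨h1, l, hl⟩ := hx t
  exact ⟨hg.continuousAt.comp_continuousWithinAt h1, g l, (hg.tendsto l).comp hl⟩

lemma IsCadlag.comp₂ {g : ℝ → ℝ → ℝ} (hx : IsCadlag x) (hy : IsCadlag y)
    (hg : Continuous (Function.uncurry g)) : IsCadlag (fun t ↦ g (x t) (y t)) := fun t ↦ by
  obtain ⟨h1, l, hl⟩ := hx t
  obtain ⟨h2, l', hl'⟩ := hy t
  exact ⟨hg.continuousAt.comp_continuousWithinAt (h1.prodMk h2), g l l',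
    (hg.tendsto (l, l')).comp (hl.prodMk_nhds hl')⟩

lemma IsCadlag.add (hx : IsCadlag x) (hy : IsCadlag y) : IsCadlag (fun t ↦ x t + y t) :=
  hx.comp₂ hy (by fun_prop)

lemma IsCadlag.sub (hx : IsCadlag x) (hy : IsCadlag y) : IsCadlag (fun t ↦ x t - y t) :=
  hx.comp₂ hy (by fun_prop)

lemma IsCadlag.mul (hx : IsCadlag x) (hy : IsCadlag y) : IsCadlag (fun t ↦ x t * y t) :=
  hx.comp₂ hy (by fun_prop)

lemma isCadlag_const (c : ℝ) : IsCadlag (fun _ : Set.Icc (0 : ℝ) T ↦ c) := fun _ ↦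
  ⟨continuousWithinAt_const, c, tendsto_const_nhds⟩

lemma isCadlag_sum {ι : Type*} (I : Finset ι) {F : ι → Set.Icc (0 : ℝ) T → ℝ}
    (hF : ∀ i ∈ I, IsCadlag (F i)) : IsCadlag (fun t ↦ ∑ i ∈ I, F i t) := by
  classical
  induction I using Finset.induction_on with
  | empty => simpa using isCadlag_const 0
  | insert i I hi ih =>
    simp_rw [Finset.sum_insert hi]
    exact (hF i (Finset.mem_insert_self i I)).add
      (ih fun j hj ↦ hF j (Finset.mem_insert_of_mem hj))

lemma IsCadlag.tendsto_next (hx : IsCadlag x) (t : Set.Icc (0 : ℝ) T) :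
    Tendsto (fun n ↦ x (next n t)) atTop (𝓝 (x t)) :=
  Tendsto.comp (hx t).1 (tendsto_next_ge t)

/-- The left limit and right-continuity bound the path near each point; compactness does the rest.
-/
lemma IsCadlag.exists_bound (hx : IsCadlag x) : ∃ C, ∀ t, |x t| ≤ C := by
  have h : ∀ t ∈ (Set.univ : Set (Set.Icc (0 : ℝ) T)),
      ∃ s ∈ 𝓝[Set.univ] t, ∃ C, ∀ u ∈ s, |x u| ≤ C := by
    intro t _
    obtain ⟨h1, l, hl⟩ := hx t
    have e1 : ∀ᶠ u in 𝓝[≥] t, |x u| ≤ |x t| + 1 :=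
      (h1.abs.eventually (eventually_lt_nhds (lt_add_one |x t|))).mono fun _ h ↦ le_of_lt h
    have e2 : ∀ᶠ u in 𝓝[<] t, |x u| ≤ |l| + 1 :=
      (hl.abs.eventually (eventually_lt_nhds (lt_add_one |l|))).mono fun _ h ↦ le_of_lt h
    refine ⟨{u | |x u| ≤ max (|x t| + 1) (|l| + 1)}, ?_, _, fun u hu ↦ hu⟩
    rw [nhdsWithin_univ, ← nhdsLT_sup_nhdsGE]
    exact mem_sup.2 ⟨e2.mono fun u hu ↦ hu.trans (le_max_right _ _),
      e1.mono fun u hu ↦ hu.trans (le_max_left _ _)⟩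
  obtain ⟨C, hC⟩ := isCompact_univ.induction_on (p := fun s ↦ ∃ C, ∀ u ∈ s, |x u| ≤ C)
    ⟨0, by simp⟩ (fun s t hst ⟨C, hC⟩ ↦ ⟨C, fun u hu ↦ hC u (hst hu)⟩)
    (fun s t ⟨C, hC⟩ ⟨D, hD⟩ ↦ ⟨max C D, fun u hu ↦ hu.elim
      (fun h ↦ (hC u h).trans (le_max_left _ _)) (fun h ↦ (hD u h).trans (le_max_right _ _))⟩) h
  exact ⟨C, fun t ↦ hC t (Set.mem_univ t)⟩

lemma IsCadlag.abs_le_of_dyadics (hx : IsCadlag x) {C : ℝ} (h : ∀ q ∈ dyadics T, |x q| ≤ C)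
    (t : Set.Icc (0 : ℝ) T) : |x t| ≤ C :=
  le_of_tendsto (hx.tendsto_next t).abs
    (Eventually.of_forall fun n ↦ h _ (next_mem_dyadics n t))

end Cadlag

/-! ### Measurability under the usual conditions. -/

section Filtration

variable {Ω : Type*} {mΩ : MeasurableSpace Ω} {P : Measure Ω} {T : ℝ} [hT : Fact (0 ≤ T)]
  {𝓕 : Filtration (Set.Icc (0 : ℝ) T) mΩ}

lemma UsualConditions.measurableSet_of_null (h𝓕 : UsualConditions 𝓕 P) {s : Set Ω} (hs : P s = 0)
    (t : Set.Icc (0 : ℝ) T) : MeasurableSet[𝓕 t] s :=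
  𝓕.mono bot_le s (h𝓕.complete s hs)

lemma UsualConditions.stronglyMeasurable_congr (h𝓕 : UsualConditions 𝓕 P) {X Y : Ω → ℝ}
    {t : Set.Icc (0 : ℝ) T} (hX : StronglyMeasurable[𝓕 t] X) (hXY : X =ᵐ[P] Y) :
    StronglyMeasurable[𝓕 t] Y := by
  suffices h : Measurable[𝓕 t] Y from h.stronglyMeasurable
  intro B hB
  have h1 : MeasurableSet[𝓕 t] {ω | ¬ X ω = Y ω} := h𝓕.measurableSet_of_null hXY t
  have h2 : MeasurableSet[𝓕 t] (Y ⁻¹' B ∩ {ω | ¬ X ω = Y ω}) :=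
    h𝓕.measurableSet_of_null (measure_mono_null Set.inter_subset_right hXY) t
  have h3 : Y ⁻¹' B = (X ⁻¹' B ∩ {ω | ¬ X ω = Y ω}ᶜ) ∪ (Y ⁻¹' B ∩ {ω | ¬ X ω = Y ω}) := by
    ext ω
    by_cases h : X ω = Y ω <;> simp [h]
  rw [h3]
  exact ((hX.measurable hB).inter h1.compl).union h2

/-- By completeness the set of convergence lies in `𝓕 t`, being the complement of a null set, and
the values off it do not matter. -/
lemma UsualConditions.stronglyMeasurable_of_tendsto (h𝓕 : UsualConditions 𝓕 P)
    {X : ℕ → Ω → ℝ} {Y : Ω → ℝ} {t : Set.Icc (0 : ℝ) T}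
    (hX : ∀ n, StronglyMeasurable[𝓕 t] (X n))
    (hlim : ∀ᵐ ω ∂P, Tendsto (fun n ↦ X n ω) atTop (𝓝 (Y ω))) :
    StronglyMeasurable[𝓕 t] Y := by
  set C : Set Ω := {ω | Tendsto (fun n ↦ X n ω) atTop (𝓝 (Y ω))}
  have hC : MeasurableSet[𝓕 t] C := by
    have := (h𝓕.measurableSet_of_null (s := Cᶜ) hlim t).compl
    rwa [compl_compl] at this
  have h1 : StronglyMeasurable[𝓕 t] (C.indicator Y) := by
    refine _root_.stronglyMeasurable_of_tendsto atTop (f := fun n ↦ C.indicator (X n))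
      (fun n ↦ (hX n).indicator hC) ?_
    rw [tendsto_pi_nhds]
    intro ω
    by_cases hω : ω ∈ C
    · simp only [Set.indicator_of_mem hω]
      exact hω
    · simp [hω]
  refine h𝓕.stronglyMeasurable_congr h1 ?_
  filter_upwards [hlim] with ω hω
  exact Set.indicator_of_mem (s := C) hω Y

lemma UsualConditions.eq_iInf (h𝓕 : UsualConditions 𝓕 P) {t : Set.Icc (0 : ℝ) T} (ht : t < ⊤) :
    𝓕 t = ⨅ j > t, 𝓕 j := by
  have := h𝓕.rightContinuous
  conv_lhs => rw [← Filtration.IsRightContinuous.eq (𝓕 := 𝓕)]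
  exact 𝓕.rightCont_eq_of_not_isMax (not_isMax_iff.2 ⟨⊤, ht⟩)

lemma UsualConditions.measurableSet_of_forall_gt (h𝓕 : UsualConditions 𝓕 P)
    {t : Set.Icc (0 : ℝ) T} (ht : t < ⊤) {s : Set Ω} (hs : ∀ j > t, MeasurableSet[𝓕 j] s) :
    MeasurableSet[𝓕 t] s := by
  rw [h𝓕.eq_iInf ht]
  simp only [MeasurableSpace.measurableSet_iInf]
  exact hs

lemma UsualConditions.stronglyMeasurable_of_forall_gt (h𝓕 : UsualConditions 𝓕 P)
    {t : Set.Icc (0 : ℝ) T} (ht : t < ⊤) {Y : Ω → ℝ} (hY : ∀ j > t, StronglyMeasurable[𝓕 j] Y) :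
    StronglyMeasurable[𝓕 t] Y := by
  suffices h : Measurable[𝓕 t] Y from h.stronglyMeasurable
  exact fun _ hB ↦ h𝓕.measurableSet_of_forall_gt ht fun j hj ↦ (hY j hj).measurable hB

/-- The limit from the right is measurable at every later time, hence at `t` by right-continuity of
the filtration. Only values at dyadic times are used, where the approximating processes are
controlled. -/
lemma UsualConditions.stronglyMeasurable_of_tendsto_next (h𝓕 : UsualConditions 𝓕 P)
    {X : Set.Icc (0 : ℝ) T → Ω → ℝ} {Y : Ω → ℝ} {t : Set.Icc (0 : ℝ) T}
    (hX : ∀ q ∈ dyadics T, StronglyMeasurable[𝓕 q] (X q))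
    (hlim : ∀ᵐ ω ∂P, Tendsto (fun n ↦ X (next n t) ω) atTop (𝓝 (Y ω))) :
    StronglyMeasurable[𝓕 t] Y := by
  rcases lt_or_eq_of_le (le_top : t ≤ ⊤) with h | rfl
  · refine h𝓕.stronglyMeasurable_of_forall_gt h fun j hj ↦ ?_
    obtain ⟨N, hN⟩ := eventually_atTop.1
      ((tendsto_next_gt h).eventually (Ioo_mem_nhdsGT hj))
    -- Dropping the first `N` terms keeps all sampling times below `j`.
    refine h𝓕.stronglyMeasurable_of_tendsto (X := fun n ↦ X (next (n + N) t)) (fun n ↦ ?_) ?_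
    · exact (hX _ (next_mem_dyadics _ _)).mono (𝓕.mono (hN (n + N) (by omega)).2.le)
    · filter_upwards [hlim] with ω hω
      exact (tendsto_add_atTop_iff_nat N).2 hω
  · exact h𝓕.stronglyMeasurable_of_tendsto (X := fun n ↦ X (next n ⊤))
      (fun n ↦ by rw [next_top]; exact hX _ top_mem_dyadics) hlim

end Filtration

/-! ### Boundedness in probability. -/

section Tight

variable {Ω : Type*} {mΩ : MeasurableSpace Ω} {P : Measure Ω} {I : Type*}

/-- Boundedness from above in probability, uniformly over a family of functions. -/
def Tight (P : Measure Ω) (f : I → Ω → ℝ) : Prop :=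
  ∀ ε : ℝ≥0∞, 0 < ε → ∃ C : ℝ, 0 ≤ C ∧ ∀ i, P {ω | C < f i ω} ≤ ε

lemma Tight.comp {J : Type*} {f : I → Ω → ℝ} (hf : Tight P f) (φ : J → I) :
    Tight P (fun j ↦ f (φ j)) := fun ε hε ↦
  let ⟨C, h0, hC⟩ := hf ε hε
  ⟨C, h0, fun j ↦ hC (φ j)⟩

lemma Tight.of_ae_le {f g : I → Ω → ℝ} (hg : Tight P g) (hfg : ∀ i, ∀ᵐ ω ∂P, f i ω ≤ g i ω) :
    Tight P f := fun ε hε ↦ by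
  obtain ⟨C, h0, hC⟩ := hg ε hε
  refine ⟨C, h0, fun i ↦ (measure_mono_ae ?_).trans (hC i)⟩
  filter_upwards [hfg i] with ω h1 h2
  exact lt_of_lt_of_le (show C < f i ω from h2) h1

lemma Tight.add {f g : I → Ω → ℝ} (hf : Tight P f) (hg : Tight P g) :
    Tight P (fun i ω ↦ f i ω + g i ω) := fun ε hε ↦ by
  obtain ⟨C, h0, hC⟩ := hf (ε / 2) (ENNReal.half_pos hε.ne')
  obtain ⟨D, h0', hD⟩ := hg (ε / 2) (ENNReal.half_pos hε.ne')
  refine ⟨C + D, by positivity, fun i ↦ ?_⟩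
  calc P {ω | C + D < f i ω + g i ω} ≤ P ({ω | C < f i ω} ∪ {ω | D < g i ω}) := by
        refine measure_mono fun ω hω ↦ ?_
        by_contra! h
        simp only [Set.mem_union, Set.mem_ofPred_eq, not_or, not_lt] at h hω
        linarith [h.1, h.2]
    _ ≤ ε / 2 + ε / 2 := (measure_union_le _ _).trans (add_le_add (hC i) (hD i))
    _ = ε := ENNReal.add_halves ε

lemma Tight.const_mul {f : I → Ω → ℝ} (hf : Tight P f) {c : ℝ} (hc : 0 ≤ c) :
    Tight P (fun i ω ↦ c * f i ω) := fun ε hε ↦ by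
  obtain ⟨C, h0, hC⟩ := hf ε hε
  refine ⟨c * C, by positivity, fun i ↦ (measure_mono fun ω hω ↦ ?_).trans (hC i)⟩
  exact lt_of_mul_lt_mul_left (show c * C < c * f i ω from hω) hc

lemma tight_of_measurable [IsFiniteMeasure P] {Z : Ω → ℝ} (hZ : AEMeasurable Z P) :
    Tight P (fun _ : I ↦ Z) := fun ε hε ↦ by
  have h1 : Tendsto (fun n : ℕ ↦ P {ω | (n : ℝ) < Z ω}) atTop
      (𝓝 (P (⋂ n : ℕ, {ω | (n : ℝ) < Z ω}))) := by
    refine tendsto_measure_iInter_atTop (fun n ↦ nullMeasurableSet_lt aemeasurable_const hZ) ?_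
      ⟨0, measure_ne_top _ _⟩
    intro n m hnm ω hω
    exact lt_of_le_of_lt (by exact_mod_cast hnm) (show (m : ℝ) < Z ω from hω)
  have h2 : (⋂ n : ℕ, {ω | (n : ℝ) < Z ω}) = ∅ := by
    ext ω
    simp only [Set.mem_iInter, Set.mem_ofPred_eq, Set.mem_empty_iff_false, iff_false, not_forall,
      not_lt]
    exact exists_nat_ge (Z ω)
  rw [h2, measure_empty] at h1
  obtain ⟨n, hn⟩ := (h1.eventually (eventually_lt_nhds hε)).exists
  exact ⟨n, by positivity, fun _ ↦ hn.le⟩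

lemma tendstoInMeasure_zero_iff {f : ℕ → Ω → ℝ} :
    TendstoInMeasure P f atTop (fun _ ↦ 0) ↔
      ∀ ε : ℝ, 0 < ε → Tendsto (fun n ↦ P {ω | ε ≤ |f n ω|}) atTop (𝓝 0) := by
  rw [tendstoInMeasure_iff_norm]
  simp

lemma Tight.tendstoInMeasure {L f : ℕ → Ω → ℝ} {c : ℕ → ℝ} (hL : Tight P L) (hc0 : ∀ n, 0 ≤ c n)
    (hc : Tendsto c atTop (𝓝 0)) (hf : ∀ n, ∀ᵐ ω ∂P, |f n ω| ≤ c n * L n ω) :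
    TendstoInMeasure P f atTop (fun _ ↦ 0) := by
  rw [tendstoInMeasure_zero_iff]
  intro η hη
  rw [ENNReal.tendsto_nhds_zero]
  intro ε hε
  obtain ⟨C, h0, hC⟩ := hL ε hε
  have h1 : Tendsto (fun n ↦ c n * C) atTop (𝓝 0) := by simpa using hc.mul_const C
  filter_upwards [h1.eventually (eventually_lt_nhds hη)] with n hn
  refine (measure_mono_ae ?_).trans (hC n)
  filter_upwards [hf n] with ω h2 h3
  by_contra h4
  have h5 : L n ω ≤ C := not_lt.1 h4
  have h6 : η ≤ |f n ω| := h3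
  linarith [mul_le_mul_of_nonneg_left h5 (hc0 n)]

end Tight

/-! ### Measurable bounds for paths and their variation. -/

section Bounds

variable {Ω : Type*} {mΩ : MeasurableSpace Ω} {P : Measure Ω} {T : ℝ} [hT : Fact (0 ≤ T)]

/-- The supremum over the countable dyadics is measurable and, on càdlàg paths, finite and equally
good as a bound for all times. Passing through `ℝ≥0∞` gives the value `0` where it is infinite. -/
lemma exists_measurable_bound {X : Set.Icc (0 : ℝ) T → Ω → ℝ} (hX : ∀ t, Measurable (X t))
    (hc : IsCadlagProcess X P) :
    ∃ Z : Ω → ℝ, Measurable Z ∧ (∀ ω, 0 ≤ Z ω) ∧ ∀ᵐ ω ∂P, ∀ t, |X t ω| ≤ Z ω := by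
  have := (countable_dyadics (T := T)).to_subtype
  refine ⟨fun ω ↦ (⨆ q : ↥(dyadics T), ENNReal.ofReal |X q ω|).toReal, ?_,
    fun ω ↦ ENNReal.toReal_nonneg, ?_⟩
  · exact (Measurable.iSup fun q : ↥(dyadics T) ↦ ((hX q.1).abs).ennreal_ofReal).ennreal_toReal
  · filter_upwards [hc] with ω hω
    obtain ⟨C, hC⟩ := hω.exists_bound
    refine hω.abs_le_of_dyadics fun q hq ↦ ?_
    have h1 : (⨆ q : ↥(dyadics T), ENNReal.ofReal |X q ω|) ≠ ∞ :=
      ((iSup_le fun q : ↥(dyadics T) ↦ ENNReal.ofReal_le_ofReal (hC q.1)).trans_lt ENNReal.ofReal_lt_top).ne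
    rw [← ENNReal.ofReal_le_iff_le_toReal h1]
    exact le_iSup (fun q : ↥(dyadics T) ↦ ENNReal.ofReal |X q ω|) ⟨q, hq⟩

lemma measurable_gridVar {X : Set.Icc (0 : ℝ) T → Ω → ℝ} (hX : ∀ t, Measurable (X t)) (n : ℕ) :
    Measurable (fun ω ↦ gridVar (fun t ↦ X t ω) n) :=
  Finset.measurable_fun_sum _ fun _ _ ↦ ((hX _).sub (hX _)).abs

lemma exists_measurable_variation_bound {X : Set.Icc (0 : ℝ) T → Ω → ℝ}
    (hX : ∀ t, Measurable (X t)) (hc : IsCadlagProcess X P)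
    (hv : ∀ᵐ ω ∂P, BoundedVariationOn (fun t ↦ X t ω) Set.univ) :
    ∃ Z : Ω → ℝ, Measurable Z ∧ (∀ ω, 0 ≤ Z ω) ∧
      ∀ᵐ ω ∂P, eVariationOn (fun t ↦ X t ω) Set.univ ≤ ENNReal.ofReal (Z ω) := by
  refine ⟨fun ω ↦ (⨆ n, ENNReal.ofReal (gridVar (fun t ↦ X t ω) n)).toReal, ?_,
    fun ω ↦ ENNReal.toReal_nonneg, ?_⟩
  · exact (Measurable.iSup fun n ↦ (measurable_gridVar hX n).ennreal_ofReal).ennreal_toReal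
  · filter_upwards [hc, hv] with ω hω hvω
    have h1 : (⨆ n, ENNReal.ofReal (gridVar (fun t ↦ X t ω) n)) ≠ ∞ :=
      ((iSup_le fun n ↦ gridVar_le_eVariationOn _ n).trans_lt hvω.lt_top).ne
    rw [ENNReal.ofReal_toReal h1]
    exact eVariationOn_le_of_tendsto_next hω.tendsto_next
      fun n ↦ le_iSup (fun n ↦ ENNReal.ofReal (gridVar (fun t ↦ X t ω) n)) n

end Bounds

/-! ### Simple integrands and the boundedness principle. -/

section SimpleIntegrand

variable {Ω : Type*} {mΩ : MeasurableSpace Ω} {P : Measure Ω} {T : ℝ} [hT : Fact (0 ≤ T)]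
  {𝓕 : Filtration (Set.Icc (0 : ℝ) T) mΩ}

namespace SimpleIntegrand

lemma val_eq (H : SimpleIntegrand 𝓕 P) {j : Fin H.n} {t : Set.Icc (0 : ℝ) T} {ω : Ω}
    (h1 : H.τ j.castSucc ω < t) (h2 : t ≤ H.τ j.succ ω) : H.val t ω = H.f j ω := by
  rw [val, Finset.sum_eq_single j]
  · exact Set.indicator_of_mem (s := Set.Ioc (H.τ j.castSucc ω) (H.τ j.succ ω)) ⟨h1, h2⟩ _
  · intro i _ hij
    refine Set.indicator_of_notMem (fun hmem ↦ ?_) _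
    rcases lt_or_gt_of_ne hij with h | h
    · have : H.τ i.succ ω ≤ H.τ j.castSucc ω := H.mono ω (by
        rw [Fin.le_def]; simpa using Nat.succ_le_of_lt h)
      exact absurd (hmem.2.trans this) (not_le.2 h1)
    · have : H.τ j.succ ω ≤ H.τ i.castSucc ω := H.mono ω (by
        rw [Fin.le_def]; simpa using Nat.succ_le_of_lt h)
      exact absurd (h2.trans this) (not_le.2 hmem.1)
  · simp

lemma abs_val_le (H : SimpleIntegrand 𝓕 P) {c : ℝ} (hc : 0 ≤ c) {ω : Ω}
    (h : ∀ j, |H.f j ω| ≤ c) (t : Set.Icc (0 : ℝ) T) : |H.val t ω| ≤ c := by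
  by_cases hj : ∃ j : Fin H.n, H.τ j.castSucc ω < t ∧ t ≤ H.τ j.succ ω
  · obtain ⟨j, h1, h2⟩ := hj
    rw [H.val_eq h1 h2]
    exact h j
  · rw [val, Finset.sum_eq_zero, abs_zero]
    · exact hc
    · intro j _
      exact Set.indicator_of_notMem (s := Set.Ioc (H.τ j.castSucc ω) (H.τ j.succ ω))
        (fun hmem ↦ hj ⟨j, hmem.1, hmem.2⟩) _

lemma supNorm_le (H : SimpleIntegrand 𝓕 P) {c : ℝ} (hc : 0 ≤ c)
    (h : ∀ j ω, |H.f j ω| ≤ c) : H.supNorm ≤ ENNReal.ofReal c := by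
  refine iSup_le fun t ↦ ?_
  rw [eLpNorm_exponent_top]
  refine eLpNormEssSup_le_of_ae_bound (ae_of_all _ fun ω ↦ ?_)
  exact H.abs_val_le hc (fun j ↦ h j ω) t

/-- The norm controls each `H.val t` only up to a null set depending on `t`, so it is used at the
countably many dyadics: a nonempty interval between consecutive stopping times contains one, where
the value is `f j`. On an empty interval `f j` is invisible to the norm. -/
lemma ae_abs_f_le (H : SimpleIntegrand 𝓕 P) (hH : H.supNorm ≠ ∞) :
    ∀ᵐ ω ∂P, ∀ j : Fin H.n, H.τ j.castSucc ω < H.τ j.succ ω → |H.f j ω| ≤ H.supNorm.toReal := by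
  have h1 : ∀ᵐ ω ∂P, ∀ q ∈ dyadics T, ‖H.val q ω‖ₑ ≤ H.supNorm := by
    rw [ae_ball_iff countable_dyadics]
    intro q _
    filter_upwards [ae_le_eLpNormEssSup (f := H.val q) (μ := P)] with ω hω
    refine hω.trans ?_
    rw [← eLpNorm_exponent_top]
    exact le_iSup (fun t ↦ eLpNorm (H.val t) ∞ P) q
  filter_upwards [h1] with ω hω j hj
  obtain ⟨n, k, h2, h3⟩ := exists_grid_mem_Ioo hj
  have h4 := hω _ (grid_mem_dyadics n k)
  rw [H.val_eq h2 h3.le] at h4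
  rw [← Real.norm_eq_abs, ← toReal_enorm]
  exact ENNReal.toReal_mono hH h4

/-- Multiplication of a simple integrand by a constant. -/
def smul (c : ℝ) (H : SimpleIntegrand 𝓕 P) : SimpleIntegrand 𝓕 P where
  n := H.n
  τ := H.τ
  isStoppingTime := H.isStoppingTime
  mono := H.mono
  τ_zero := H.τ_zero
  τ_last := H.τ_last
  f j ω := c * H.f j ω
  measurable_f j := (H.measurable_f j).const_mul c
  memLp_f j := (H.memLp_f j).const_mul c

lemma integral_smul (c : ℝ) (H : SimpleIntegrand 𝓕 P) (S : Set.Icc (0 : ℝ) T → Ω → ℝ)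
    (t : Set.Icc (0 : ℝ) T) (ω : Ω) : (H.smul c).integral S t ω = c * H.integral S t ω := by
  simp only [integral, smul, Finset.mul_sum]
  exact Finset.sum_congr rfl fun j _ ↦ by ring

lemma integral_bot (H : SimpleIntegrand 𝓕 P) (S : Set.Icc (0 : ℝ) T → Ω → ℝ) (ω : Ω) :
    H.integral S ⊥ ω = 0 := by
  simp [integral]

/-- The simple integrand on the `n`-th dyadic grid with values `h j`. -/
def ofGrid (n : ℕ) (h : ℕ → Ω → ℝ) (hm : ∀ j, StronglyMeasurable[𝓕 (grid T n j)] (h j)) (c : ℝ)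
    (hc : ∀ j ω, |h j ω| ≤ c) : SimpleIntegrand 𝓕 P where
  n := 2 ^ n
  τ j _ := grid T n j
  isStoppingTime j := isStoppingTime_const 𝓕 (grid T n j)
  mono _ i j hij := grid_mono n (by exact_mod_cast hij)
  τ_zero _ := by simpa using grid_zero n
  τ_last _ := by simpa using grid_top le_rfl
  f j := h j
  measurable_f j := by
    have := (hm j).measurable
    rw [IsStoppingTime.measurableSpace_const]
    exact this
  memLp_f j := memLp_top_of_bound ((hm j).mono (𝓕.le _)).aestronglyMeasurable c
    (ae_of_all _ fun ω ↦ hc j ω)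

end SimpleIntegrand

/-- The pathwise integral of a step function on the `n`-th dyadic grid. -/
def gridIntegral (n : ℕ) (h : ℕ → ℝ) (x : Set.Icc (0 : ℝ) T → ℝ) (t : Set.Icc (0 : ℝ) T) : ℝ :=
  ∑ j ∈ Finset.range (2 ^ n), h j * (x (min (grid T n (j + 1)) t) - x (min (grid T n j) t))

lemma SimpleIntegrand.integral_ofGrid {n : ℕ} {h : ℕ → Ω → ℝ}
    (hm : ∀ j, StronglyMeasurable[𝓕 (grid T n j)] (h j)) {c : ℝ} (hc : ∀ j ω, |h j ω| ≤ c)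
    (S : Set.Icc (0 : ℝ) T → Ω → ℝ) (t : Set.Icc (0 : ℝ) T) (ω : Ω) :
    (ofGrid (P := P) n h hm c hc).integral S t ω
      = gridIntegral n (fun j ↦ h j ω) (fun s ↦ S s ω) t := by
  rw [gridIntegral, Finset.sum_range]
  rfl

lemma exists_grid_bracket (n : ℕ) (t : Set.Icc (0 : ℝ) T) :
    ∃ k < 2 ^ n, grid T n k ≤ t ∧ t ≤ grid T n (k + 1) := by
  have h : ∀ m, t ≤ grid T n (m + 1) → ∃ k ≤ m, grid T n k ≤ t ∧ t ≤ grid T n (k + 1) := by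
    intro m
    induction m with
    | zero => exact fun h ↦ ⟨0, le_rfl, by rw [grid_zero]; exact bot_le, h⟩
    | succ m ih =>
      intro h
      rcases le_total (grid T n (m + 1)) t with h1 | h1
      · exact ⟨m + 1, le_rfl, h1, h⟩
      · obtain ⟨k, hk, h2⟩ := ih h1
        exact ⟨k, hk.trans (Nat.le_succ m), h2⟩
  have hpos : 0 < 2 ^ n := by positivity
  obtain ⟨k, hk, h1⟩ := h (2 ^ n - 1) (by
    rw [Nat.sub_add_cancel hpos, grid_top le_rfl]; exact le_top)
  exact ⟨k, by omega, h1⟩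

lemma gridIntegral_eq {n k : ℕ} (h : ℕ → ℝ) (x : Set.Icc (0 : ℝ) T → ℝ) {t : Set.Icc (0 : ℝ) T}
    (hk : k < 2 ^ n) (h1 : grid T n k ≤ t) (h2 : t ≤ grid T n (k + 1)) :
    gridIntegral n h x t =
      ∑ j ∈ Finset.range k, h j * (x (grid T n (j + 1)) - x (grid T n j))
        + h k * (x t - x (grid T n k)) := by
  rw [gridIntegral, ← Finset.sum_subset (Finset.range_subset_range.2 (Nat.succ_le_of_lt hk)),
    Finset.sum_range_succ]
  · congr 1
    · refine Finset.sum_congr rfl fun j hj ↦ ?_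
      have hj' := Finset.mem_range.1 hj
      rw [min_eq_left ((grid_mono n (by omega)).trans h1),
        min_eq_left ((grid_mono n (by omega)).trans h1)]
    · rw [min_eq_right h2, min_eq_left h1]
  · intro j _ hj
    have hj' : k + 1 ≤ j := by simpa using hj
    rw [min_eq_right (h2.trans (grid_mono n (by omega))),
      min_eq_right (h2.trans (grid_mono n hj')), sub_self, mul_zero]

lemma gridIntegral_top (n : ℕ) (h : ℕ → ℝ) (x : Set.Icc (0 : ℝ) T → ℝ) :
    gridIntegral n h x ⊤ =
      ∑ j ∈ Finset.range (2 ^ n), h j * (x (grid T n (j + 1)) - x (grid T n j)) := by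
  simp [gridIntegral]

/-- No free lunch with vanishing risk and little investment. -/
def NoFreeLunch (𝓕 : Filtration (Set.Icc (0 : ℝ) T) mΩ) (P : Measure Ω)
    (S : Set.Icc (0 : ℝ) T → Ω → ℝ) : Prop :=
  ∀ H : ℕ → SimpleIntegrand 𝓕 P,
    Tendsto (fun n ↦ (H n).supNorm) atTop (𝓝 0) →
    TendstoInMeasure P (fun n ω ↦ ⨆ t, ((H n).integral S t ω)⁻) atTop (fun _ ↦ 0) →
    TendstoInMeasure P (fun n ω ↦ ((H n).integral S ⊤ ω)⁺) atTop (fun _ ↦ 0)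

/-- Otherwise some integrands gain more than `m + 1` with probability above a fixed `ε`. Divided by
`m + 1`, they have vanishing norms and vanishing losses, yet gain at least 1 with probability above
`ε`. This is the form in which condition 1 is used. -/
lemma NoFreeLunch.tight {S : Set.Icc (0 : ℝ) T → Ω → ℝ} (hS : NoFreeLunch 𝓕 P S) {I : Type*}
    (H : I → SimpleIntegrand 𝓕 P) {c : ℝ} (hc : 0 ≤ c) (hH : ∀ i j ω, |(H i).f j ω| ≤ c)
    {L : I → Ω → ℝ} (hL : Tight P L)
    (hloss : ∀ i, ∀ᵐ ω ∂P, ∀ t, -L i ω ≤ (H i).integral S t ω) :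
    Tight P (fun i ↦ (H i).integral S ⊤) := by
  by_contra hcon
  simp only [Tight, not_forall, not_exists, not_and, not_le] at hcon
  obtain ⟨ε, hε, hcon⟩ := hcon
  choose i hi using fun m : ℕ ↦ hcon (m + 1) (by positivity)
  have hlim : Tendsto (fun m : ℕ ↦ 1 / ((m : ℝ) + 1)) atTop (𝓝 0) :=
    tendsto_one_div_add_atTop_nhds_zero_nat
  have key := hS (fun m ↦ (H (i m)).smul (1 / ((m : ℝ) + 1))) ?_ ?_
  · rw [tendstoInMeasure_zero_iff] at key
    obtain ⟨m, hm⟩ := ((key 1 one_pos).eventually (eventually_lt_nhds hε)).exists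
    refine absurd ((hi m).trans_le (measure_mono fun ω hω ↦ ?_)) (not_lt.2 hm.le)
    have h1 : (m : ℝ) + 1 < (H (i m)).integral S ⊤ ω := hω
    change 1 ≤ |(((H (i m)).smul (1 / ((m : ℝ) + 1))).integral S ⊤ ω)⁺|
    rw [abs_of_nonneg (posPart_nonneg _), SimpleIntegrand.integral_smul]
    refine le_trans ?_ (le_posPart _)
    rw [one_div, ← div_eq_inv_mul, le_div_iff₀ (by positivity)]
    linarith
  · refine tendsto_of_tendsto_of_tendsto_of_le_of_le tendsto_const_nhds
      (h := fun m : ℕ ↦ ENNReal.ofReal (1 / ((m : ℝ) + 1) * c)) ?_ (fun _ ↦ zero_le) fun m ↦ ?_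
    · have := ENNReal.tendsto_ofReal (hlim.mul_const c)
      simpa using this
    · refine SimpleIntegrand.supNorm_le _ (by positivity) fun j ω ↦ ?_
      change |1 / ((m : ℝ) + 1) * (H (i m)).f j ω| ≤ _
      rw [abs_mul, abs_of_nonneg (by positivity : (0 : ℝ) ≤ 1 / ((m : ℝ) + 1))]
      exact mul_le_mul_of_nonneg_left (hH _ j ω) (by positivity)
  · refine (hL.comp i).tendstoInMeasure (fun m ↦ by positivity) hlim fun m ↦ ?_
    filter_upwards [hloss (i m)] with ω hω
    rw [abs_of_nonneg (Real.iSup_nonneg fun t ↦ negPart_nonneg _)]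
    have h0 : 0 ≤ L (i m) ω := by
      have := hω ⊥
      rw [SimpleIntegrand.integral_bot] at this
      linarith
    refine ciSup_le fun t ↦ ?_
    rw [SimpleIntegrand.integral_smul, negPart_def, sup_le_iff]
    refine ⟨?_, mul_nonneg (by positivity) h0⟩
    rw [← mul_neg]
    exact mul_le_mul_of_nonneg_left (by linarith [hω t]) (by positivity)

end SimpleIntegrand

/-! ### Discrete square integrable martingales. -/

section MartingaleDifference

variable {Ω : Type*} {mΩ : MeasurableSpace Ω} {P : Measure Ω} [IsProbabilityMeasure P]

/-- Square integrable martingale differences; `D i` is the increment from time `i` to `i + 1`. -/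
structure IsMartingaleDiff (G : Filtration ℕ mΩ) (P : Measure Ω) (D : ℕ → Ω → ℝ) : Prop where
  stronglyMeasurable : ∀ i, StronglyMeasurable[G (i + 1)] (D i)
  memLp : ∀ i, MemLp (D i) 2 P
  condExp_eq_zero : ∀ i, P[D i | G i] =ᵐ[P] 0

variable {G : Filtration ℕ mΩ} {D : ℕ → Ω → ℝ}

lemma IsMartingaleDiff.integrable (hD : IsMartingaleDiff G P D) (i : ℕ) : Integrable (D i) P :=
  (hD.memLp i).integrable one_le_two

lemma memLp_mul_of_bound {h X : Ω → ℝ} {c : ℝ} (hh : AEStronglyMeasurable h P)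
    (hb : ∀ ω, |h ω| ≤ c) (hX : MemLp X 2 P) : MemLp (fun ω ↦ h ω * X ω) 2 P := by
  refine (hX.const_mul c).mono (hh.mul hX.1) (ae_of_all _ fun ω ↦ ?_)
  have hc : 0 ≤ c := (abs_nonneg _).trans (hb ω)
  simp only [norm_mul, Real.norm_eq_abs, abs_of_nonneg hc]
  exact mul_le_mul_of_nonneg_right (hb ω) (abs_nonneg _)

lemma IsMartingaleDiff.mul (hD : IsMartingaleDiff G P D) {h : ℕ → Ω → ℝ} {c : ℝ}
    (hh : ∀ i, StronglyMeasurable[G i] (h i)) (hb : ∀ i ω, |h i ω| ≤ c) :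
    IsMartingaleDiff G P (fun i ω ↦ h i ω * D i ω) where
  stronglyMeasurable i := ((hh i).mono (G.mono (Nat.le_succ i))).mul (hD.stronglyMeasurable i)
  memLp i := memLp_mul_of_bound ((hh i).mono (G.le i)).aestronglyMeasurable (hb i) (hD.memLp i)
  condExp_eq_zero i := by
    have h1 : Integrable (h i * D i) P :=
      (memLp_mul_of_bound ((hh i).mono (G.le i)).aestronglyMeasurable (hb i)
        (hD.memLp i)).integrable one_le_two
    filter_upwards [condExp_mul_of_stronglyMeasurable_left (hh i) h1 (hD.integrable i),
      hD.condExp_eq_zero i] with ω h2 h3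
    change P[h i * D i | G i] ω = 0
    rw [h2, Pi.mul_apply, h3, Pi.zero_apply, mul_zero]

/-- The process of partial sums. -/
def partialSum (D : ℕ → Ω → ℝ) (n : ℕ) (ω : Ω) : ℝ := ∑ i ∈ Finset.range n, D i ω

lemma partialSum_succ (D : ℕ → Ω → ℝ) (n : ℕ) (ω : Ω) :
    partialSum D (n + 1) ω = partialSum D n ω + D n ω := Finset.sum_range_succ _ _

lemma IsMartingaleDiff.memLp_partialSum (hD : IsMartingaleDiff G P D) (n : ℕ) :
    MemLp (partialSum D n) 2 P :=
  memLp_finsetSum _ fun i _ ↦ hD.memLp i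

lemma IsMartingaleDiff.stronglyMeasurable_partialSum (hD : IsMartingaleDiff G P D) (n : ℕ) :
    StronglyMeasurable[G n] (partialSum D n) :=
  Finset.stronglyMeasurable_fun_sum _ fun i hi ↦
    (hD.stronglyMeasurable i).mono (G.mono (Nat.succ_le_of_lt (Finset.mem_range.1 hi)))

lemma IsMartingaleDiff.martingale (hD : IsMartingaleDiff G P D) :
    Martingale (partialSum D) G P := by
  refine martingale_of_condExp_sub_eq_zero_nat hD.stronglyMeasurable_partialSum
    (fun n ↦ (hD.memLp_partialSum n).integrable one_le_two) fun i ↦ ?_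
  have : partialSum D (i + 1) - partialSum D i = D i := by
    ext ω
    simp [partialSum_succ]
  rw [this]
  exact hD.condExp_eq_zero i

lemma integral_mul_eq_zero_of_condExp_eq_zero {m : MeasurableSpace Ω} (hm : m ≤ mΩ)
    {X Y : Ω → ℝ} (hX : StronglyMeasurable[m] X) (hX2 : MemLp X 2 P) (hY2 : MemLp Y 2 P)
    (hY : P[Y | m] =ᵐ[P] 0) : ∫ ω, X ω * Y ω ∂P = 0 := by
  have h1 : Integrable (X * Y) P := hX2.integrable_mul hY2
  have h2 := condExp_mul_of_stronglyMeasurable_left hX h1 (hY2.integrable one_le_two)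
  change ∫ ω, (X * Y) ω ∂P = 0
  rw [← integral_condExp hm (f := X * Y), integral_congr_ae (g := fun _ ↦ (0 : ℝ)), integral_zero]
  filter_upwards [h2, hY] with ω h3 h4
  rw [h3, Pi.mul_apply, h4, Pi.zero_apply, mul_zero]

lemma IsMartingaleDiff.integral_sq_partialSum (hD : IsMartingaleDiff G P D) (n : ℕ) :
    ∫ ω, partialSum D n ω ^ 2 ∂P = ∑ i ∈ Finset.range n, ∫ ω, D i ω ^ 2 ∂P := by
  induction n with
  | zero => simp [partialSum]
  | succ n ih =>
    rw [Finset.sum_range_succ, ← ih]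
    have h1 := (hD.memLp_partialSum n).integrable_sq
    have h2 := (hD.memLp n).integrable_sq
    have h3 : Integrable (fun ω ↦ partialSum D n ω * D n ω) P :=
      (hD.memLp_partialSum n).integrable_mul (hD.memLp n)
    have h4 := integral_mul_eq_zero_of_condExp_eq_zero (G.le n)
      (hD.stronglyMeasurable_partialSum n) (hD.memLp_partialSum n) (hD.memLp n)
      (hD.condExp_eq_zero n)
    calc ∫ ω, partialSum D (n + 1) ω ^ 2 ∂P
        = ∫ ω, (partialSum D n ω ^ 2 + D n ω ^ 2) + 2 * (partialSum D n ω * D n ω) ∂P := by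
          congr 1 with ω
          rw [partialSum_succ]; ring
      _ = _ := by
          have h12 : Integrable (fun ω ↦ partialSum D n ω ^ 2 + D n ω ^ 2) P := h1.add h2
          rw [integral_add h12 (h3.const_mul 2), integral_add h1 h2, integral_const_mul,
            h4, mul_zero, add_zero]

/-- Martingale increments are orthogonal, so the bound on the integrand may be applied increment by
increment. -/
lemma IsMartingaleDiff.integral_sq_partialSum_mul_le (hD : IsMartingaleDiff G P D)
    {h : ℕ → Ω → ℝ} {c : ℝ} (hh : ∀ i, StronglyMeasurable[G i] (h i))
    (hb : ∀ i ω, |h i ω| ≤ c) (n : ℕ) :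
    ∫ ω, partialSum (fun i ω ↦ h i ω * D i ω) n ω ^ 2 ∂P
      ≤ c ^ 2 * ∫ ω, partialSum D n ω ^ 2 ∂P := by
  rw [(hD.mul hh hb).integral_sq_partialSum, hD.integral_sq_partialSum, Finset.mul_sum]
  refine Finset.sum_le_sum fun i _ ↦ ?_
  rw [← integral_const_mul]
  refine integral_mono ((hD.mul hh hb).memLp i).integrable_sq
    ((hD.memLp i).integrable_sq.const_mul _) fun ω ↦ ?_
  dsimp only
  rw [mul_pow]
  exact mul_le_mul_of_nonneg_right (sq_le_sq' (by linarith [abs_le.1 (hb i ω)])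
    (abs_le.1 (hb i ω)).2) (sq_nonneg _)

lemma isMartingaleDiff_sub_condExp {Y : ℕ → Ω → ℝ}
    (hY : ∀ i, StronglyMeasurable[G (i + 1)] (Y i)) (hY2 : ∀ i, MemLp (Y i) 2 P) :
    IsMartingaleDiff G P (fun i ω ↦ Y i ω - P[Y i | G i] ω) where
  stronglyMeasurable i :=
    (hY i).sub (stronglyMeasurable_condExp.mono (G.mono (Nat.le_succ i)))
  memLp i := (hY2 i).sub ((hY2 i).condExp one_le_two)
  condExp_eq_zero i := by
    have hi : Integrable (Y i) P := (hY2 i).integrable one_le_two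
    have h1 := condExp_sub hi (integrable_condExp (m := G i) (μ := P) (f := Y i)) (G i)
    have h2 : P[P[Y i | G i] | G i] = P[Y i | G i] :=
      condExp_of_stronglyMeasurable (G.le i) stronglyMeasurable_condExp integrable_condExp
    filter_upwards [h1] with ω h3
    change P[Y i - P[Y i | G i] | G i] ω = 0
    rw [h3, Pi.sub_apply, h2, sub_self]

/-- Conditional expectation is an orthogonal projection in L², and the residual is no longer than
the vector. -/
lemma integral_sq_sub_condExp_le {m : MeasurableSpace Ω} (hm : m ≤ mΩ) {Y : Ω → ℝ}
    (hY : MemLp Y 2 P) : ∫ ω, (Y ω - P[Y | m] ω) ^ 2 ∂P ≤ ∫ ω, Y ω ^ 2 ∂P := by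
  have hc : MemLp (P[Y | m]) 2 P := hY.condExp one_le_two
  have hi : Integrable Y P := hY.integrable one_le_two
  have h0 : P[Y - P[Y | m] | m] =ᵐ[P] 0 := by
    have h1 := condExp_sub hi (integrable_condExp (m := m) (μ := P) (f := Y)) m
    have h2 : P[P[Y | m] | m] = P[Y | m] :=
      condExp_of_stronglyMeasurable hm stronglyMeasurable_condExp integrable_condExp
    filter_upwards [h1] with ω h3
    rw [h3, Pi.sub_apply, h2, sub_self, Pi.zero_apply]
  have h4 := integral_mul_eq_zero_of_condExp_eq_zero hm stronglyMeasurable_condExp hc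
    (hY.sub hc) h0
  have h5 : Integrable (fun ω ↦ P[Y | m] ω * (Y - P[Y | m]) ω) P := hc.integrable_mul (hY.sub hc)
  calc ∫ ω, (Y ω - P[Y | m] ω) ^ 2 ∂P
      ≤ ∫ ω, (Y ω - P[Y | m] ω) ^ 2 + P[Y | m] ω ^ 2 ∂P :=
        integral_mono (hY.sub hc).integrable_sq
          ((hY.sub hc).integrable_sq.add hc.integrable_sq)
          fun ω ↦ le_add_of_nonneg_right (sq_nonneg _)
    _ = ∫ ω, Y ω ^ 2 - 2 * (P[Y | m] ω * (Y - P[Y | m]) ω) ∂P := by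
        congr 1 with ω
        simp only [Pi.sub_apply]
        ring
    _ = ∫ ω, Y ω ^ 2 ∂P := by
        rw [integral_sub hY.integrable_sq (h5.const_mul 2), integral_const_mul, h4]
        ring

/-- Doob's maximal inequality for the submartingales `|U i|`; their L¹ norms are bounded through
`|x| ≤ 1 + x²`. The filtration may depend on `i`, as each grid has its own. -/
lemma tight_sup_abs_martingale {I : Type*} {G : I → Filtration ℕ mΩ} {U : I → ℕ → Ω → ℝ}
    {n : I → ℕ} {C : ℝ} (hU : ∀ i, Martingale (U i) (G i) P) (hU2 : ∀ i, MemLp (U i (n i)) 2 P)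
    (hC : ∀ i, ∫ ω, U i (n i) ω ^ 2 ∂P ≤ C) :
    Tight P (fun i ω ↦
      (Finset.range (n i + 1)).sup' Finset.nonempty_range_add_one fun k ↦ |U i k ω|) := by
  intro ε hε
  rcases eq_or_ne ε ∞ with rfl | hε'
  · exact ⟨0, le_rfl, fun _ ↦ le_top⟩
  have hε0 : 0 < ε.toReal := ENNReal.toReal_pos hε.ne' hε'
  -- The level `B` satisfies `B ε = 1 + |C|`, the bound for the L¹ norms.
  set B : NNReal := Real.toNNReal ((1 + |C|) / ε.toReal)
  have hB : (B : ℝ) = (1 + |C|) / ε.toReal := Real.coe_toNNReal _ (by positivity)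
  have hB0 : (0 : ℝ) < B := by rw [hB]; positivity
  refine ⟨B, B.2, fun i ↦ ?_⟩
  have hsub : Submartingale (fun k ω ↦ |U i k ω|) (G i) P :=
    (hU i).submartingale.sup (hU i).neg.submartingale
  have h1 := maximal_ineq hsub (fun k ω ↦ abs_nonneg _) (ε := B) (n i)
  set s := {ω | (B : ℝ) ≤ (Finset.range (n i + 1)).sup' Finset.nonempty_range_add_one
    fun k ↦ |U i k ω|}
  have h2 : ∫ ω in s, |U i (n i) ω| ∂P ≤ 1 + |C| := by
    calc ∫ ω in s, |U i (n i) ω| ∂P ≤ ∫ ω, |U i (n i) ω| ∂P :=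
          setIntegral_le_integral ((hU i).integrable _).abs (ae_of_all _ fun ω ↦ abs_nonneg _)
      _ ≤ ∫ ω, 1 + U i (n i) ω ^ 2 ∂P := by
          refine integral_mono ((hU i).integrable _).abs
            ((integrable_const 1).add (hU2 i).integrable_sq) fun ω ↦ ?_
          dsimp only
          rw [← sq_abs (U i (n i) ω)]
          nlinarith [sq_nonneg (|U i (n i) ω| - 1), abs_nonneg (U i (n i) ω)]
      _ = 1 + ∫ ω, U i (n i) ω ^ 2 ∂P := by
          rw [integral_add (integrable_const 1) (hU2 i).integrable_sq]; simp
      _ ≤ 1 + |C| := by linarith [hC i, le_abs_self C]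
  have h3 : (B : ℝ≥0∞) * P s ≤ ENNReal.ofReal (1 + |C|) :=
    h1.trans (ENNReal.ofReal_le_ofReal h2)
  have h4 : ENNReal.ofReal (1 + |C|) = B * ε := by
    rw [← ENNReal.ofReal_coe_nnreal (p := B), hB, ← ENNReal.ofReal_toReal hε',
      ← ENNReal.ofReal_mul (by positivity), ENNReal.toReal_ofReal hε0.le,
      div_mul_cancel₀ _ hε0.ne']
  rw [h4] at h3
  have h5 : P s ≤ ε := by
    refine (ENNReal.mul_le_mul_iff_right ?_ ENNReal.coe_ne_top).1 h3
    exact_mod_cast hB0.ne'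
  exact (measure_mono fun ω hω ↦ le_of_lt (show (B : ℝ) < _ from hω)).trans h5

end MartingaleDifference

/-! ### Pathwise identities for killed sequences. -/

section Pathwise

open scoped Classical in
lemma exists_telescope (y : ℕ → ℝ) {E : ℕ → Prop} (hE : ∀ i j, i ≤ j → E j → E i) (m : ℕ) :
    ∃ i ≤ m, (y 0 + ∑ j ∈ Finset.range m, (if E j then y (j + 1) - y j else 0) = y i) ∧
      ((∀ j < m, E j) → i = m) := by
  induction m with
  | zero => exact ⟨0, le_rfl, by simp, fun _ ↦ rfl⟩
  | succ m ih =>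
    obtain ⟨i, hi, h1, h2⟩ := ih
    by_cases h : E m
    · refine ⟨m + 1, le_rfl, ?_, fun _ ↦ rfl⟩
      have := h2 fun j hj ↦ hE j m hj.le h
      subst this
      rw [Finset.sum_range_succ, if_pos h, ← add_assoc, h1]
      ring
    · refine ⟨i, by omega, ?_, fun h' ↦ absurd (h' m (Nat.lt_succ_self m)) h⟩
      rw [Finset.sum_range_succ, if_neg h, add_zero, h1]

-- Since `x (j + 1) ^ 2 - x j ^ 2 = 2 * x j * Δ + Δ ^ 2`, the difference is a telescoping sum up to
-- the exit from `E`, equal to minus the difference of two squares, each at most `z ^ 2`.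
open scoped Classical in
lemma sum_quadratic_eq (x : ℕ → ℝ) {E : ℕ → Prop} (hE : ∀ i j, i ≤ j → E j → E i) (m : ℕ)
    {z : ℝ} (hz : ∀ j ≤ m, |x j| ≤ z) :
    |∑ j ∈ Finset.range m, (if E j then -2 * x j else 0) * (x (j + 1) - x j)
      - ∑ j ∈ Finset.range m, (if E j then (x (j + 1) - x j) ^ 2 else 0)| ≤ z ^ 2 := by
  obtain ⟨i, hi, h1, -⟩ := exists_telescope (fun j ↦ x j ^ 2) hE m
  have h2 : ∑ j ∈ Finset.range m, (if E j then -2 * x j else 0) * (x (j + 1) - x j)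
      - ∑ j ∈ Finset.range m, (if E j then (x (j + 1) - x j) ^ 2 else 0)
      = -∑ j ∈ Finset.range m, (if E j then x (j + 1) ^ 2 - x j ^ 2 else 0) := by
    rw [← Finset.sum_sub_distrib, ← Finset.sum_neg_distrib]
    refine Finset.sum_congr rfl fun j _ ↦ ?_
    split_ifs <;> ring
  have h3 : x i ^ 2 ≤ z ^ 2 := sq_le_sq' (by linarith [abs_le.1 (hz i hi)]) (abs_le.1 (hz i hi)).2
  have h4 : x 0 ^ 2 ≤ z ^ 2 :=
    sq_le_sq' (by linarith [abs_le.1 (hz 0 (Nat.zero_le m))]) (abs_le.1 (hz 0 (Nat.zero_le m))).2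
  rw [h2, abs_le]
  constructor <;> nlinarith [sq_nonneg (x i), sq_nonneg (x 0)]

-- Before killing, the squares add up to at most `q`. The killing replaces the next increment, which
-- could be large, by a jump from `x` to `0`, contributing at most `K ^ 2`.
open scoped Classical in
lemma sum_sq_killed_le (x q : ℕ → ℝ) {E : ℕ → Prop} (hE : ∀ i j, i ≤ j → E j → E i)
    {K C : ℝ} (hC : 0 ≤ C) (hq0 : 0 ≤ q 0)
    (hq : ∀ j, E j → q (j + 1) = q j + (x (j + 1) - x j) ^ 2)
    (hK : ∀ j, E j → |x j| ≤ K) (hqC : ∀ j, E j → q j ≤ C) (m : ℕ) :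
    ∑ j ∈ Finset.range m,
      ((if E (j + 1) then x (j + 1) else 0) - (if E j then x j else 0)) ^ 2 ≤ C + K ^ 2 := by
  have key : ∀ m, ∑ j ∈ Finset.range m,
      ((if E (j + 1) then x (j + 1) else 0) - (if E j then x j else 0)) ^ 2
        ≤ if E m then q m else C + K ^ 2 := by
    intro m
    induction m with
    | zero => simp only [Finset.range_zero, Finset.sum_empty]; split_ifs <;> positivity
    | succ m ih =>
      rw [Finset.sum_range_succ]
      by_cases h1 : E (m + 1)
      · have h0 : E m := hE m (m + 1) (Nat.le_succ m) h1
        rw [if_pos h0] at ih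
        rw [if_pos h1, if_pos h0, if_pos h1, hq m h0]
        linarith
      · by_cases h0 : E m
        · rw [if_pos h0] at ih
          rw [if_neg h1, if_pos h0, if_neg h1]
          have h2 : x m ^ 2 ≤ K ^ 2 :=
            sq_le_sq' (by linarith [abs_le.1 (hK m h0)]) (abs_le.1 (hK m h0)).2
          have := hqC m h0
          nlinarith
        · rw [if_neg h0] at ih
          rw [if_neg h1, if_neg h0, if_neg h1]
          linarith
  refine (key m).trans ?_
  split_ifs with h
  · linarith [hqC m h, sq_nonneg K]
  · exact le_rfl

-- Switching off the integrand and killing the integrator agree except in the step of the killing,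
-- where they differ by `g k * x (k + 1)`.
open scoped Classical in
lemma abs_sum_killed_sub_le (x g : ℕ → ℝ) {E : ℕ → Prop} (hE : ∀ i j, i ≤ j → E j → E i)
    {z : ℝ} (hg : ∀ j, |g j| ≤ 1) {m : ℕ} (hz : ∀ j ≤ m, |x j| ≤ z) :
    |∑ j ∈ Finset.range m, (if E j then g j else 0) * (x (j + 1) - x j)
      - ∑ j ∈ Finset.range m,
        g j * ((if E (j + 1) then x (j + 1) else 0) - (if E j then x j else 0))| ≤ z := by
  have hz0 : 0 ≤ z := (abs_nonneg _).trans (hz 0 (Nat.zero_le m))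
  rw [← Finset.sum_sub_distrib]
  have key : ∀ k ≤ m, |∑ j ∈ Finset.range k, ((if E j then g j else 0) * (x (j + 1) - x j)
      - g j * ((if E (j + 1) then x (j + 1) else 0) - (if E j then x j else 0)))|
        ≤ if E k then 0 else z := by
    intro k
    induction k with
    | zero => intro _; simp only [Finset.range_zero, Finset.sum_empty, abs_zero]; split_ifs <;> simp [hz0]
    | succ k ih =>
      intro hk
      have ih := ih (by omega)
      rw [Finset.sum_range_succ]
      by_cases h1 : E (k + 1)
      · have h0 : E k := hE k (k + 1) (Nat.le_succ k) h1
        rw [if_pos h0] at ih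
        simp only [if_pos h0, if_pos h1, sub_self, add_zero]
        exact ih
      · by_cases h0 : E k
        · rw [if_pos h0] at ih
          have h3 := abs_nonpos_iff.1 ih
          simp only [if_pos h0, if_neg h1]
          rw [h3, zero_add, show g k * (x (k + 1) - x k) - g k * (0 - x k) = g k * x (k + 1) by ring,
            abs_mul]
          calc |g k| * |x (k + 1)| ≤ 1 * z :=
                mul_le_mul (hg k) (hz _ hk) (abs_nonneg _) zero_le_one
            _ = z := one_mul z
        · rw [if_neg h0] at ih
          simp only [if_neg h0, if_neg h1, sub_self, zero_mul, mul_zero, add_zero]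
          exact ih
  refine (key m le_rfl).trans ?_
  split_ifs <;> simp [hz0]

-- As long as `F` holds, what remains after removing `d` is `a`. In the exit step it is `a k - X (k
-- + 1)`, and `|a k|` is still covered because `F k` controls the sum through index `k`; this is
-- possible for the drift, which is predictable.
open scoped Classical in
lemma sum_killed_variation_le (X a d : ℕ → ℝ) {F : ℕ → Prop} (hF : ∀ i j, i ≤ j → F j → F i)
    (had : ∀ j, X (j + 1) - X j = a j + d j) {K C : ℝ} (hC : 0 ≤ C) (hX : ∀ j, |X j| ≤ K) (m : ℕ)
    (hFC : ∀ j < m, F j → ∑ i ∈ Finset.range (j + 1), |a i| ≤ C) :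
    ∑ j ∈ Finset.range m, |(if F (j + 1) then X (j + 1) else 0) - (if F j then X j else 0)
      - (if F j then d j else 0)| ≤ C + K := by
  have hK : 0 ≤ K := (abs_nonneg _).trans (hX 0)
  have key : ∀ k ≤ m, ∑ j ∈ Finset.range k,
      |(if F (j + 1) then X (j + 1) else 0) - (if F j then X j else 0) - (if F j then d j else 0)|
        ≤ if F k then ∑ i ∈ Finset.range k, |a i| else C + K := by
    intro k
    induction k with
    | zero =>
      intro _
      simp only [Finset.range_zero, Finset.sum_empty]
      split_ifs
      · exact le_rfl
      · positivity
    | succ k ih =>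
      intro hk
      have ih := ih (by omega)
      rw [Finset.sum_range_succ]
      by_cases h1 : F (k + 1)
      · have h0 : F k := hF k (k + 1) (Nat.le_succ k) h1
        rw [if_pos h0] at ih
        rw [if_pos h1, if_pos h0, if_pos h0, if_pos h1, Finset.sum_range_succ]
        have : X (k + 1) - X k - d k = a k := by linarith [had k]
        rw [this]
        linarith
      · by_cases h0 : F k
        · rw [if_pos h0] at ih
          rw [if_neg h1, if_pos h0, if_pos h0, if_neg h1]
          have h2 : 0 - X k - d k = a k - X (k + 1) := by linarith [had k]
          have h3 := hFC k (by omega) h0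
          rw [Finset.sum_range_succ] at h3
          rw [h2]
          linarith [abs_sub (a k) (X (k + 1)), hX (k + 1)]
        · rw [if_neg h0] at ih
          rw [if_neg h1, if_neg h0, if_neg h0, if_neg h1]
          simpa using ih
  refine (key m le_rfl).trans ?_
  split_ifs with h
  · rcases Nat.eq_zero_or_pos m with rfl | hm
    · simp; positivity
    · have := hFC (m - 1) (by omega) (hF _ _ (by omega) h)
      rw [Nat.sub_add_cancel hm] at this
      linarith
  · exact le_rfl

end Pathwise

/-! ### Bounds for the quadratic variation and the drift along the grids. -/

section DiscreteDecomposition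

variable {Ω : Type*} {mΩ : MeasurableSpace Ω} {P : Measure Ω} [IsProbabilityMeasure P]
  {T : ℝ} [hT : Fact (0 ≤ T)]

/-- The filtration sampled along the `n`-th dyadic grid. -/
def gridFiltration (𝓕 : Filtration (Set.Icc (0 : ℝ) T) mΩ) (n : ℕ) : Filtration ℕ mΩ where
  seq j := 𝓕 (grid T n j)
  mono' _ _ h := 𝓕.mono (grid_mono n h)
  le' _ := 𝓕.le _

variable {𝓕 : Filtration (Set.Icc (0 : ℝ) T) mΩ} {S : Set.Icc (0 : ℝ) T → Ω → ℝ}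

/-- The event that `|S|` has not exceeded `K` along the grid up to index `j`. -/
def bddSet (S : Set.Icc (0 : ℝ) T → Ω → ℝ) (K : ℝ) (n j : ℕ) : Set Ω :=
  {ω | ∀ i ≤ j, |S (grid T n i) ω| ≤ K}

open scoped Classical in
/-- The quadratic variation of `S` along the grid before `|S|` exceeds `K`. -/
def quad (S : Set.Icc (0 : ℝ) T → Ω → ℝ) (K : ℝ) (n j : ℕ) (ω : Ω) : ℝ :=
  ∑ i ∈ Finset.range j, if ω ∈ bddSet S K n i then (S (grid T n (i + 1)) ω - S (grid T n i) ω) ^ 2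
    else 0

/-- The event that `|S|` and its quadratic variation have not exceeded `K` and `C`. -/
def quadSet (S : Set.Icc (0 : ℝ) T → Ω → ℝ) (K C : ℝ) (n j : ℕ) : Set Ω :=
  bddSet S K n j ∩ {ω | quad S K n j ω ≤ C}

open scoped Classical in
/-- The process `S` on the grid, killed when leaving `quadSet`. -/
def killed (S : Set.Icc (0 : ℝ) T → Ω → ℝ) (K C : ℝ) (n j : ℕ) (ω : Ω) : ℝ :=
  if ω ∈ quadSet S K C n j then S (grid T n j) ω else 0

/-- The increments of the killed process. -/
def killedIncr (S : Set.Icc (0 : ℝ) T → Ω → ℝ) (K C : ℝ) (n j : ℕ) (ω : Ω) : ℝ :=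
  killed S K C n (j + 1) ω - killed S K C n j ω

/-- The drift of the killed process. -/
def drift (𝓕 : Filtration (Set.Icc (0 : ℝ) T) mΩ) (P : Measure Ω)
    (S : Set.Icc (0 : ℝ) T → Ω → ℝ) (K C : ℝ) (n j : ℕ) : Ω → ℝ :=
  P[killedIncr S K C n j | gridFiltration 𝓕 n j]

/-- The martingale increments of the killed process. -/
def martIncr (𝓕 : Filtration (Set.Icc (0 : ℝ) T) mΩ) (P : Measure Ω)
    (S : Set.Icc (0 : ℝ) T → Ω → ℝ) (K C : ℝ) (n j : ℕ) (ω : Ω) : ℝ :=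
  killedIncr S K C n j ω - drift 𝓕 P S K C n j ω

variable {K C : ℝ}

lemma bddSet_antitone (n : ℕ) {i j : ℕ} (hij : i ≤ j) : bddSet S K n j ⊆ bddSet S K n i :=
  fun _ hω k hk ↦ hω k (hk.trans hij)

lemma quad_mono (n : ℕ) (ω : Ω) : Monotone (fun j ↦ quad S K n j ω) := by
  refine monotone_nat_of_le_succ fun j ↦ ?_
  simp only [quad, Finset.sum_range_succ]
  refine le_add_of_nonneg_right ?_
  split_ifs <;> positivity

lemma quadSet_antitone (n : ℕ) {i j : ℕ} (hij : i ≤ j) : quadSet S K C n j ⊆ quadSet S K C n i :=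
  fun ω hω ↦ ⟨bddSet_antitone n hij hω.1, (quad_mono n ω hij).trans hω.2⟩

lemma measurableSet_bddSet (hS : StronglyAdapted 𝓕 S) (n j : ℕ) :
    MeasurableSet[gridFiltration 𝓕 n j] (bddSet S K n j) := by
  have : bddSet S K n j = ⋂ i, ⋂ (_ : i ≤ j), {ω | |S (grid T n i) ω| ≤ K} := by
    ext ω; simp [bddSet]
  rw [this]
  refine MeasurableSet.iInter fun i ↦ MeasurableSet.iInter fun hi ↦ ?_
  have h1 : StronglyMeasurable[gridFiltration 𝓕 n j] (S (grid T n i)) :=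
    (hS (grid T n i)).mono (𝓕.mono (grid_mono n hi))
  exact h1.norm.measurable measurableSet_Iic

open scoped Classical in
lemma stronglyMeasurable_quad (hS : StronglyAdapted 𝓕 S) (n j : ℕ) :
    StronglyMeasurable[gridFiltration 𝓕 n j] (quad S K n j) := by
  refine Finset.stronglyMeasurable_fun_sum _ fun i hi ↦ ?_
  have hi' := Finset.mem_range.1 hi
  have h1 : StronglyMeasurable[gridFiltration 𝓕 n j]
      (fun ω ↦ (S (grid T n (i + 1)) ω - S (grid T n i) ω) ^ 2) := by
    have h2 : StronglyMeasurable[gridFiltration 𝓕 n j]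
        (fun ω ↦ S (grid T n (i + 1)) ω - S (grid T n i) ω) := by
      have ha : StronglyMeasurable[gridFiltration 𝓕 n j] (S (grid T n (i + 1))) :=
        (hS _).mono (𝓕.mono (grid_mono n (Nat.succ_le_of_lt hi')))
      have hb : StronglyMeasurable[gridFiltration 𝓕 n j] (S (grid T n i)) :=
        (hS _).mono (𝓕.mono (grid_mono n hi'.le))
      exact ha.sub hb
    simp_rw [sq]
    exact h2.mul h2
  exact StronglyMeasurable.ite ((gridFiltration 𝓕 n).mono hi'.le _ (measurableSet_bddSet hS n i))
    h1 stronglyMeasurable_const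

lemma measurableSet_quadSet (hS : StronglyAdapted 𝓕 S) (n j : ℕ) :
    MeasurableSet[gridFiltration 𝓕 n j] (quadSet S K C n j) :=
  (measurableSet_bddSet hS n j).inter ((stronglyMeasurable_quad hS n j).measurable
    measurableSet_Iic)

lemma stronglyMeasurable_killed (hS : StronglyAdapted 𝓕 S) (n j : ℕ) :
    StronglyMeasurable[gridFiltration 𝓕 n j] (killed S K C n j) := by
  classical
  exact StronglyMeasurable.ite (measurableSet_quadSet hS n j) (hS _) stronglyMeasurable_const

lemma abs_killed_le (hK : 0 ≤ K) (n j : ℕ) (ω : Ω) : |killed S K C n j ω| ≤ K := by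
  unfold killed
  split_ifs with h
  · exact h.1 j le_rfl
  · simpa using hK

lemma memLp_killed (hS : StronglyAdapted 𝓕 S) (hK : 0 ≤ K) (n j : ℕ) (p : ℝ≥0∞) :
    MemLp (killed S K C n j) p P :=
  (memLp_top_of_bound ((stronglyMeasurable_killed hS n j).mono
    ((gridFiltration 𝓕 n).le j)).aestronglyMeasurable K
      (ae_of_all _ fun ω ↦ abs_killed_le hK n j ω)).mono_exponent le_top

lemma memLp_killedIncr (hS : StronglyAdapted 𝓕 S) (hK : 0 ≤ K) (n j : ℕ) :
    MemLp (killedIncr S K C n j) 2 P :=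
  (memLp_killed hS hK n (j + 1) 2).sub (memLp_killed hS hK n j 2)

lemma isMartingaleDiff_martIncr (hS : StronglyAdapted 𝓕 S) (hK : 0 ≤ K) (n : ℕ) :
    IsMartingaleDiff (gridFiltration 𝓕 n) P (martIncr 𝓕 P S K C n) :=
  isMartingaleDiff_sub_condExp
    (fun i ↦ (stronglyMeasurable_killed hS n (i + 1)).sub
      ((stronglyMeasurable_killed hS n i).mono ((gridFiltration 𝓕 n).mono (Nat.le_succ i))))
    (memLp_killedIncr hS hK n)

/-- By orthogonality and projection, the second moment is at most the expected sum of squared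
increments of the killed process, which is bounded pathwise. -/
lemma integral_sq_martIncr_le (hS : StronglyAdapted 𝓕 S) (hK : 0 ≤ K) (hC : 0 ≤ C) (n m : ℕ) :
    ∫ ω, partialSum (martIncr 𝓕 P S K C n) m ω ^ 2 ∂P ≤ C + K ^ 2 := by
  classical
  rw [(isMartingaleDiff_martIncr hS hK n).integral_sq_partialSum]
  calc ∑ i ∈ Finset.range m, ∫ ω, martIncr 𝓕 P S K C n i ω ^ 2 ∂P
      ≤ ∑ i ∈ Finset.range m, ∫ ω, killedIncr S K C n i ω ^ 2 ∂P :=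
        Finset.sum_le_sum fun i _ ↦
          integral_sq_sub_condExp_le ((gridFiltration 𝓕 n).le i) (memLp_killedIncr hS hK n i)
    _ = ∫ ω, ∑ i ∈ Finset.range m, killedIncr S K C n i ω ^ 2 ∂P :=
        (integral_finsetSum _ fun i _ ↦ (memLp_killedIncr hS hK n i).integrable_sq).symm
    _ ≤ ∫ _, C + K ^ 2 ∂P := by
        refine integral_mono (integrable_finsetSum _ fun i _ ↦
          (memLp_killedIncr hS hK n i).integrable_sq) (integrable_const _) fun ω ↦ ?_
        refine sum_sq_killed_le (fun j ↦ S (grid T n j) ω) (fun j ↦ quad S K n j ω)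
          (E := fun j ↦ ω ∈ quadSet S K C n j) (fun i j hij h ↦ quadSet_antitone n hij h) hC
          (by simp [quad]) (fun j hj ↦ ?_) (fun j hj ↦ hj.1 j le_rfl) (fun j hj ↦ hj.2) m
        simp only [quad, Finset.sum_range_succ]
        rw [if_pos hj.1]
    _ = C + K ^ 2 := by simp

open scoped Classical in
/-- The integrand producing the quadratic variation. -/
def quadIntegrand (hS : StronglyAdapted 𝓕 S) (hK : 0 ≤ K) (P : Measure Ω) (n : ℕ) :
    SimpleIntegrand 𝓕 P :=
  SimpleIntegrand.ofGrid n (fun j ω ↦ if ω ∈ bddSet S K n j then -2 * S (grid T n j) ω else 0)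
    (fun j ↦ StronglyMeasurable.ite (measurableSet_bddSet hS n j) ((hS _).const_mul (-2))
      stronglyMeasurable_const) (2 * K) (fun j ω ↦ by
        split_ifs with h
        · rw [abs_mul, abs_neg, abs_two]
          exact mul_le_mul_of_nonneg_left (h j le_rfl) zero_le_two
        · simpa using hK)

/-- At every time the integral of `-2S` differs by at most `Z²` from a sum of squares. That sum is
nonnegative, so the losses are at most `Z²`, and the terminal gains control the quadratic variation.
-/
lemma tight_quad (hS : StronglyAdapted 𝓕 S) (hc : IsCadlagProcess S P)
    (hN : NoFreeLunch 𝓕 P S) (hK : 0 ≤ K) :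
    Tight P (fun n ↦ quad S K n (2 ^ n)) := by
  classical
  obtain ⟨Z, hZm, hZ0, hZ⟩ :=
    exists_measurable_bound (fun t ↦ ((hS t).mono (𝓕.le t)).measurable) hc
  have hsq : Tight P (fun (_ : ℕ) ω ↦ Z ω ^ 2) := tight_of_measurable (hZm.pow_const 2).aemeasurable
  have key : ∀ n, ∀ᵐ ω ∂P, ∀ t,
      |(quadIntegrand hS hK P n).integral S t ω - ∑ j ∈ Finset.range (2 ^ n),
        (if ω ∈ bddSet S K n j then
          (S (min (grid T n (j + 1)) t) ω - S (min (grid T n j) t) ω) ^ 2 else 0)| ≤ Z ω ^ 2 := by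
    intro n
    filter_upwards [hZ] with ω hω t
    rw [quadIntegrand, SimpleIntegrand.integral_ofGrid]
    have := sum_quadratic_eq (fun j ↦ S (min (grid T n j) t) ω)
      (E := fun j ↦ ω ∈ bddSet S K n j) (fun i j hij h ↦ bddSet_antitone n hij h) (2 ^ n)
      (z := Z ω) (fun j _ ↦ hω _)
    convert this using 4
    refine Finset.sum_congr rfl fun j _ ↦ ?_
    -- Past time `t` the stopped increments vanish, so freezing the integrand at `t` as well changes
    -- nothing.
    rcases le_total (grid T n j) t with h | h
    · rw [min_eq_left h]
    · have h' : t ≤ grid T n (j + 1) := h.trans (grid_mono n (Nat.le_succ j))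
      rw [min_eq_right h, min_eq_right h', sub_self, mul_zero, mul_zero]
  have h1 := hN.tight (quadIntegrand hS hK P) (c := 2 * K) (by positivity) (fun n j ω ↦ ?_) hsq
    (fun n ↦ ?_)
  · refine (h1.add hsq).of_ae_le fun n ↦ ?_
    filter_upwards [key n] with ω hω
    have h2 := (abs_le.1 (hω ⊤)).1
    simp only [min_eq_left (le_top : _ ≤ (⊤ : Set.Icc (0 : ℝ) T))] at h2
    unfold quad
    linarith
  · simp only [quadIntegrand, SimpleIntegrand.ofGrid]
    split_ifs with h
    · rw [abs_mul, abs_neg, abs_two]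
      exact mul_le_mul_of_nonneg_left (h j le_rfl) zero_le_two
    · simpa using hK
  · filter_upwards [key n] with ω hω t
    have h2 := (abs_le.1 (hω t)).1
    have h3 : 0 ≤ ∑ j ∈ Finset.range (2 ^ n), (if ω ∈ bddSet S K n j then
        (S (min (grid T n (j + 1)) t) ω - S (min (grid T n j) t) ω) ^ 2 else 0) :=
      Finset.sum_nonneg fun j _ ↦ by split_ifs <;> positivity
    linarith

/-- The sign of the drift. -/
def driftSign (𝓕 : Filtration (Set.Icc (0 : ℝ) T) mΩ) (P : Measure Ω)
    (S : Set.Icc (0 : ℝ) T → Ω → ℝ) (K C : ℝ) (n j : ℕ) (ω : Ω) : ℝ :=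
  SignType.sign (drift 𝓕 P S K C n j ω)

lemma abs_driftSign_le (n j : ℕ) (ω : Ω) : |driftSign 𝓕 P S K C n j ω| ≤ 1 := by
  unfold driftSign
  rcases lt_trichotomy (drift 𝓕 P S K C n j ω) 0 with h | h | h <;> simp [h]

lemma driftSign_mul_drift (n j : ℕ) (ω : Ω) :
    driftSign 𝓕 P S K C n j ω * drift 𝓕 P S K C n j ω = |drift 𝓕 P S K C n j ω| :=
  sign_mul_self _

lemma stronglyMeasurable_drift (n j : ℕ) :
    StronglyMeasurable[gridFiltration 𝓕 n j] (drift 𝓕 P S K C n j) :=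
  stronglyMeasurable_condExp

lemma stronglyMeasurable_driftSign (n j : ℕ) :
    StronglyMeasurable[gridFiltration 𝓕 n j] (driftSign 𝓕 P S K C n j) := by
  classical
  have h : driftSign 𝓕 P S K C n j = fun ω ↦ if 0 < drift 𝓕 P S K C n j ω then 1 else
      if drift 𝓕 P S K C n j ω < 0 then -1 else 0 := by
    ext ω
    unfold driftSign
    rw [sign_apply]
    split_ifs <;> simp
  rw [h]
  have hm := (stronglyMeasurable_drift (𝓕 := 𝓕) (P := P) (S := S) (K := K) (C := C) n j).measurable
  exact StronglyMeasurable.ite (hm measurableSet_Ioi) stronglyMeasurable_const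
    (StronglyMeasurable.ite (hm measurableSet_Iio) stronglyMeasurable_const
      stronglyMeasurable_const)

open scoped Classical in
/-- The integrand producing the variation of the drift. -/
def driftIntegrand (hS : StronglyAdapted 𝓕 S) (K C : ℝ) (P : Measure Ω)
    [IsProbabilityMeasure P] (n : ℕ) : SimpleIntegrand 𝓕 P :=
  SimpleIntegrand.ofGrid n
    (fun j ω ↦ if ω ∈ quadSet S K C n j then driftSign 𝓕 P S K C n j ω else 0)
    (fun j ↦ StronglyMeasurable.ite (measurableSet_quadSet hS n j)
      (stronglyMeasurable_driftSign n j) stronglyMeasurable_const) 1 (fun j ω ↦ by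
        split_ifs with h
        · exact abs_driftSign_le n j ω
        · simp)

/-- The integral of the sign of the drift is the variation of the drift plus a martingale transform
`W`, up to an error of `3Z`. Hence only `W` and the error can produce losses, and both are bounded
in probability. -/
lemma tight_drift (hS : StronglyAdapted 𝓕 S) (hc : IsCadlagProcess S P)
    (hN : NoFreeLunch 𝓕 P S) (hK : 0 ≤ K) (hC : 0 ≤ C) :
    Tight P (fun n ω ↦ ∑ j ∈ Finset.range (2 ^ n), |drift 𝓕 P S K C n j ω|) := by
  classical
  obtain ⟨Z, hZm, hZ0, hZ⟩ :=
    exists_measurable_bound (fun t ↦ ((hS t).mono (𝓕.le t)).measurable) hc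
  set W : ℕ → ℕ → Ω → ℝ := fun n ↦
    partialSum (fun j ω ↦ driftSign 𝓕 P S K C n j ω * martIncr 𝓕 P S K C n j ω) with hW
  have hWd : ∀ n, IsMartingaleDiff (gridFiltration 𝓕 n) P
      (fun j ω ↦ driftSign 𝓕 P S K C n j ω * martIncr 𝓕 P S K C n j ω) := fun n ↦
    (isMartingaleDiff_martIncr hS hK n).mul (stronglyMeasurable_driftSign n)
      (abs_driftSign_le n)
  have hWsup : Tight P (fun n ω ↦ (Finset.range (2 ^ n + 1)).sup' Finset.nonempty_range_add_one
      fun k ↦ |W n k ω|) := by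
    refine tight_sup_abs_martingale (C := 1 ^ 2 * (C + K ^ 2)) (fun n ↦ (hWd n).martingale)
      (fun n ↦ (hWd n).memLp_partialSum _) fun n ↦ ?_
    refine ((isMartingaleDiff_martIncr hS hK n).integral_sq_partialSum_mul_le
      (stronglyMeasurable_driftSign n) (abs_driftSign_le n) (2 ^ n)).trans ?_
    gcongr
    exact integral_sq_martIncr_le hS hK hC n _
  -- One `Z` pays for the killing step and two for the position of `t` inside a grid interval.
  have hL := hWsup.add
    ((tight_of_measurable (I := ℕ) hZm.aemeasurable).const_mul (c := 3) (by norm_num))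
  -- At the terminal time the index must be the last one, so that the gain sees the entire variation
  -- of the drift; at other times any bracketing index suffices to bound the loss.
  have key : ∀ n, ∀ᵐ ω ∂P, ∀ t, ∃ k ≤ 2 ^ n, (t = ⊤ → k = 2 ^ n) ∧
      |(driftIntegrand hS K C P n).integral S t ω
        - ∑ j ∈ Finset.range k, |drift 𝓕 P S K C n j ω| - W n k ω| ≤ 3 * Z ω := by
    intro n
    filter_upwards [hZ] with ω hω t
    rw [driftIntegrand, SimpleIntegrand.integral_ofGrid]
    set h : ℕ → ℝ := fun j ↦ if ω ∈ quadSet S K C n j then driftSign 𝓕 P S K C n j ω else 0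
    have hh : ∀ j, |h j| ≤ 1 := fun j ↦ by
      simp only [h]
      split_ifs
      · exact abs_driftSign_le n j ω
      · simp
    have hmain : ∀ k, |∑ j ∈ Finset.range k, h j * (S (grid T n (j + 1)) ω - S (grid T n j) ω)
        - ∑ j ∈ Finset.range k, |drift 𝓕 P S K C n j ω| - W n k ω| ≤ Z ω := by
      intro k
      have h1 := abs_sum_killed_sub_le (fun j ↦ S (grid T n j) ω)
        (fun j ↦ driftSign 𝓕 P S K C n j ω) (E := fun j ↦ ω ∈ quadSet S K C n j)
        (fun i j hij h ↦ quadSet_antitone n hij h) (z := Z ω)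
        (fun j ↦ abs_driftSign_le n j ω) (m := k) (fun j _ ↦ hω _)
      have h2 : ∑ j ∈ Finset.range k, driftSign 𝓕 P S K C n j ω * killedIncr S K C n j ω =
          ∑ j ∈ Finset.range k, |drift 𝓕 P S K C n j ω| + W n k ω := by
        simp only [hW, partialSum]
        rw [← Finset.sum_add_distrib]
        refine Finset.sum_congr rfl fun j _ ↦ ?_
        rw [← driftSign_mul_drift, martIncr]
        ring
      rw [sub_sub, ← h2]
      exact h1
    rcases eq_or_ne t ⊤ with rfl | ht
    · refine ⟨2 ^ n, le_rfl, fun _ ↦ rfl, ?_⟩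
      rw [gridIntegral_top]
      exact (hmain _).trans (by linarith [hZ0 ω])
    · obtain ⟨k, hk, hk1, hk2⟩ := exists_grid_bracket n t
      refine ⟨k, hk.le, fun h ↦ absurd h ht, ?_⟩
      rw [gridIntegral_eq _ _ hk hk1 hk2]
      have h3 : |h k * (S t ω - S (grid T n k) ω)| ≤ 2 * Z ω := by
        rw [abs_mul]
        calc |h k| * |S t ω - S (grid T n k) ω| ≤ 1 * |S t ω - S (grid T n k) ω| :=
              mul_le_mul_of_nonneg_right (hh k) (abs_nonneg _)
          _ ≤ 2 * Z ω := by
              linarith [abs_sub (S t ω) (S (grid T n k) ω), hω t, hω (grid T n k)]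
      have h4 := hmain k
      rw [abs_le] at h3 h4 ⊢
      constructor <;> linarith [h3.1, h3.2, h4.1, h4.2]
  have h1 := hN.tight (driftIntegrand hS K C P) (c := 1) zero_le_one (fun n j ω ↦ ?_) hL
    (fun n ↦ ?_)
  · refine (h1.add hL).of_ae_le fun n ↦ ?_
    filter_upwards [key n] with ω hω
    obtain ⟨k, hk, hk1, hk2⟩ := hω ⊤
    obtain rfl := hk1 rfl
    have h2 : |W n (2 ^ n) ω| ≤ (Finset.range (2 ^ n + 1)).sup' Finset.nonempty_range_add_one
      fun k ↦ |W n k ω| := Finset.le_sup' (fun k ↦ |W n k ω|) (by simp)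
    have h3 := neg_abs_le (W n (2 ^ n) ω)
    have h4 := (abs_le.1 hk2).1
    linarith
  · simp only [driftIntegrand, SimpleIntegrand.ofGrid]
    split_ifs with h
    · exact abs_driftSign_le n j ω
    · simp
  · filter_upwards [key n] with ω hω t
    obtain ⟨k, hk, -, hk2⟩ := hω t
    have h2 : |W n k ω| ≤ (Finset.range (2 ^ n + 1)).sup' Finset.nonempty_range_add_one
      fun k ↦ |W n k ω| :=
        Finset.le_sup' (fun k ↦ |W n k ω|) (Finset.mem_range.2 (Nat.lt_succ_of_le hk))
    have h3 := neg_abs_le (W n k ω)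
    have h4 := (abs_le.1 hk2).1
    have h5 : 0 ≤ ∑ j ∈ Finset.range k, |drift 𝓕 P S K C n j ω| :=
      Finset.sum_nonneg fun _ _ ↦ abs_nonneg _
    linarith

end DiscreteDecomposition

/-! ### The decomposition along one grid. -/

section DiscreteDecomposition

variable {Ω : Type*} {mΩ : MeasurableSpace Ω} {P : Measure Ω} [IsProbabilityMeasure P]
  {T : ℝ} [hT : Fact (0 ≤ T)] {𝓕 : Filtration (Set.Icc (0 : ℝ) T) mΩ}
  {S : Set.Icc (0 : ℝ) T → Ω → ℝ}

/-- The index of the largest point of the `n`-th dyadic grid below `t`. -/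
def gridIndex (n : ℕ) (t : Set.Icc (0 : ℝ) T) : ℕ := ⌊(t : ℝ) * 2 ^ n / T⌋₊

lemma gridIndex_mono (n : ℕ) : Monotone (gridIndex (T := T) n) := floor_index_mono n

lemma gridIndex_grid (hpos : 0 < T) {n j : ℕ} (hj : j ≤ 2 ^ n) : gridIndex n (grid T n j) = j := by
  rw [gridIndex, coe_grid hj]
  have : T * j / 2 ^ n * 2 ^ n / T = j := by field_simp
  rw [this, Nat.floor_natCast]

lemma grid_gridIndex_le (n : ℕ) (t : Set.Icc (0 : ℝ) T) : grid T n (gridIndex n t) ≤ t := by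
  rcases (T_nonneg (T := T)).eq_or_lt with h | h
  · exact (grid T n _).2.2.trans (h.symm.le.trans t.2.1)
  · rcases lt_or_eq_of_le (le_top : t ≤ ⊤) with h1 | rfl
    · change (grid T n (gridIndex n t) : ℝ) ≤ t
      rw [gridIndex, coe_grid ((Nat.le_succ _).trans (floor_lt_of_lt_top h1 n)), div_le_iff₀ (by positivity),
        mul_comm, ← le_div_iff₀ h]
      exact Nat.floor_le (by have := t.2.1; positivity)
    · exact le_top

/-- The event on which the killed process is still alive and its drift has variation at most
`D`. -/
def aliveSet (𝓕 : Filtration (Set.Icc (0 : ℝ) T) mΩ) (P : Measure Ω)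
    (S : Set.Icc (0 : ℝ) T → Ω → ℝ) (D K C : ℝ) (n j : ℕ) : Set Ω :=
  {ω | ∑ i ∈ Finset.range (min (j + 1) (2 ^ n)), |drift 𝓕 P S K C n i ω| ≤ D}

lemma aliveSet_antitone {D K C : ℝ} (n : ℕ) {i j : ℕ} (hij : i ≤ j) :
    aliveSet 𝓕 P S D K C n j ⊆ aliveSet 𝓕 P S D K C n i := by
  intro ω hω
  have h : min (i + 1) (2 ^ n) ≤ min (j + 1) (2 ^ n) := by gcongr
  exact (Finset.sum_le_sum_of_subset_of_nonneg (Finset.range_subset_range.2 h)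
    fun _ _ _ ↦ abs_nonneg _).trans (show _ ≤ D from hω)

lemma measurableSet_aliveSet {D K C : ℝ} (n j : ℕ) :
    MeasurableSet[gridFiltration 𝓕 n j] (aliveSet 𝓕 P S D K C n j) := by
  have h : StronglyMeasurable[gridFiltration 𝓕 n j]
      (fun ω ↦ ∑ i ∈ Finset.range (min (j + 1) (2 ^ n)), |drift 𝓕 P S K C n i ω|) := by
    refine Finset.stronglyMeasurable_fun_sum _ fun i hi ↦ ?_
    have hi' : i ≤ j := by
      have := Finset.mem_range.1 hi
      omega
    have h1 : StronglyMeasurable[gridFiltration 𝓕 n j] (drift 𝓕 P S K C n i) :=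
      (stronglyMeasurable_drift n i).mono ((gridFiltration 𝓕 n).mono hi')
    exact h1.norm
  exact h.measurable measurableSet_Iic

lemma sq_add_le (a b : ℝ) : (a + b) ^ 2 ≤ 2 * a ^ 2 + 2 * b ^ 2 := by nlinarith [sq_nonneg (a - b)]

/-- The discrete decomposition: for every `n`, the process `S`, killed at a grid time which is
finite with probability at most `ε`, is the sum of a discrete martingale bounded in `L²` and a
process of bounded variation along the grid, with bounds independent of `n`. -/
theorem exists_discrete_decomposition (hpos : 0 < T) (hS : StronglyAdapted 𝓕 S)
    (hc : IsCadlagProcess S P) (hN : NoFreeLunch 𝓕 P S) {ε : ℝ≥0∞} (hε : 0 < ε) :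
    ∃ C : ℝ, ∀ n, ∃ (r : Set.Icc (0 : ℝ) T → Set Ω) (N : Ω → ℝ),
      (∀ t, MeasurableSet[𝓕 t] (r t)) ∧ Antitone r ∧ P (r ⊤)ᶜ ≤ ε ∧ MemLp N 2 P ∧
      ∫ ω, N ω ^ 2 ∂P ≤ C ∧
      ∀ᵐ ω ∂P, gridVar (fun t ↦ (r t).indicator (S t) ω - P[N | 𝓕 t] ω) n ≤ C := by
  classical
  have hε3 : 0 < ε / 3 := ENNReal.div_pos hε.ne' (by simp)
  obtain ⟨Z, hZm, hZ0, hZ⟩ :=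
    exists_measurable_bound (fun t ↦ ((hS t).mono (𝓕.le t)).measurable) hc
  obtain ⟨K, hK, hKP⟩ := tight_of_measurable (P := P) (I := Unit) hZm.aemeasurable (ε / 3) hε3
  obtain ⟨C, hC, hCP⟩ := tight_quad hS hc hN hK (ε / 3) hε3
  obtain ⟨D, hD, hDP⟩ := tight_drift hS hc hN hK hC (ε / 3) hε3
  -- The first entry bounds the second moment of initial value plus stopped martingale, the second
  -- the variation of the stopped drift together with the jump at its killing.
  refine ⟨max (2 * K ^ 2 + 2 * (1 ^ 2 * (C + K ^ 2))) (D + K), fun n ↦ ?_⟩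
  set F : ℕ → Set Ω := fun j ↦ aliveSet 𝓕 P S D K C n j with hF
  set h : ℕ → Ω → ℝ := fun j ω ↦ if ω ∈ F j then 1 else 0 with hh
  have hhm : ∀ j, StronglyMeasurable[gridFiltration 𝓕 n j] (h j) := fun j ↦
    StronglyMeasurable.ite (measurableSet_aliveSet n j) stronglyMeasurable_const
      stronglyMeasurable_const
  have hhb : ∀ j ω, |h j ω| ≤ 1 := fun j ω ↦ by
    simp only [hh]; split_ifs <;> simp
  have hd := isMartingaleDiff_martIncr (P := P) (C := C) hS hK n
  have hhd := hd.mul hhm hhb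
  set U : ℕ → Ω → ℝ := partialSum (fun i ω ↦ h i ω * martIncr 𝓕 P S K C n i ω) with hU
  have hk0 : MemLp (killed S K C n 0) 2 P := memLp_killed hS hK n 0 2
  -- The terminal value encodes the whole discrete martingale, recovered on the grid by
  -- conditioning. A single random variable is easier to take to the limit.
  set N : Ω → ℝ := fun ω ↦ killed S K C n 0 ω + U (2 ^ n) ω with hNdef
  have hk0m : StronglyMeasurable[gridFiltration 𝓕 n 0] (killed S K C n 0) :=
    stronglyMeasurable_killed hS n 0
  have hcond : ∀ j ≤ 2 ^ n, P[N | 𝓕 (grid T n j)] =ᵐ[P]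
      fun ω ↦ killed S K C n 0 ω + U j ω := by
    intro j hj
    have h1 : P[N | 𝓕 (grid T n j)] =ᵐ[P]
        P[killed S K C n 0 | 𝓕 (grid T n j)] + P[U (2 ^ n) | 𝓕 (grid T n j)] :=
      condExp_add (hk0.integrable one_le_two) (hhd.martingale.integrable _) _
    have h2 : P[killed S K C n 0 | 𝓕 (grid T n j)] = killed S K C n 0 :=
      condExp_of_stronglyMeasurable (𝓕.le _)
        (hk0m.mono ((gridFiltration 𝓕 n).mono (Nat.zero_le j))) (hk0.integrable one_le_two)
    have h3 : P[U (2 ^ n) | 𝓕 (grid T n j)] =ᵐ[P] U j := hhd.martingale.condExp_ae_eq hj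
    filter_upwards [h1, h3] with ω h4 h5
    rw [h4, Pi.add_apply, h2, h5]
  -- Off the grid, survival is read at the preceding grid point, which keeps the events adapted and
  -- decreasing.
  refine ⟨fun t ↦ quadSet S K C n (gridIndex n t) ∩ F (gridIndex n t), N, fun t ↦ ?_, ?_, ?_,
    hk0.add (hhd.memLp_partialSum _), ?_, ?_⟩
  · exact 𝓕.mono (grid_gridIndex_le n t) _
      ((measurableSet_quadSet hS n _).inter (measurableSet_aliveSet n _))
  · intro s t hst
    exact Set.inter_subset_inter (quadSet_antitone n (gridIndex_mono n hst))
      (aliveSet_antitone n (gridIndex_mono n hst))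
  · have htop : gridIndex n (⊤ : Set.Icc (0 : ℝ) T) = 2 ^ n := by
      rw [← grid_top (T := T) (le_refl (2 ^ n)), gridIndex_grid hpos le_rfl]
    have hsub : P (quadSet S K C n (2 ^ n) ∩ F (2 ^ n))ᶜ ≤
        P (({ω | K < Z ω} ∪ {ω | C < quad S K n (2 ^ n) ω}) ∪
          {ω | D < ∑ j ∈ Finset.range (2 ^ n), |drift 𝓕 P S K C n j ω|}) := by
      refine measure_mono_ae ?_
      filter_upwards [hZ] with ω hω hmem
      by_contra hcon
      have hcon' : ¬ ((K < Z ω ∨ C < quad S K n (2 ^ n) ω) ∨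
        D < ∑ j ∈ Finset.range (2 ^ n), |drift 𝓕 P S K C n j ω|) := hcon
      push Not at hcon'
      refine hmem ⟨⟨fun i _ ↦ (hω _).trans hcon'.1.1, hcon'.1.2⟩, ?_⟩
      -- At the last grid point no step follows; the cap in `aliveSet` leaves exactly the sum
      -- bounded by `tight_drift`.
      change ∑ i ∈ Finset.range (min (2 ^ n + 1) (2 ^ n)), |drift 𝓕 P S K C n i ω| ≤ D
      rw [min_eq_right (Nat.le_succ _)]
      exact hcon'.2
    simp only [htop]
    calc P (quadSet S K C n (2 ^ n) ∩ F (2 ^ n))ᶜ ≤ ε / 3 + ε / 3 + ε / 3 :=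
          hsub.trans ((measure_union_le _ _).trans (add_le_add
            ((measure_union_le _ _).trans (add_le_add (hKP ()) (hCP n))) (hDP n)))
      _ = ε := ENNReal.add_thirds ε
  · refine le_trans ?_ (le_max_left _ _)
    have hUi := (hhd.memLp_partialSum (2 ^ n)).integrable_sq
    calc ∫ ω, N ω ^ 2 ∂P
        ≤ ∫ ω, 2 * killed S K C n 0 ω ^ 2 + 2 * U (2 ^ n) ω ^ 2 ∂P :=
          integral_mono (hk0.add (hhd.memLp_partialSum _)).integrable_sq
            ((hk0.integrable_sq.const_mul 2).add (hUi.const_mul 2)) fun ω ↦ sq_add_le _ _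
      _ = 2 * ∫ ω, killed S K C n 0 ω ^ 2 ∂P + 2 * ∫ ω, U (2 ^ n) ω ^ 2 ∂P := by
          rw [integral_add (hk0.integrable_sq.const_mul 2) (hUi.const_mul 2), integral_const_mul,
            integral_const_mul]
      _ ≤ 2 * K ^ 2 + 2 * (1 ^ 2 * (C + K ^ 2)) := by
          have h1 : ∫ ω, killed S K C n 0 ω ^ 2 ∂P ≤ ∫ _, K ^ 2 ∂P := by
            refine integral_mono hk0.integrable_sq (integrable_const _) fun ω ↦ ?_
            have := abs_le.1 (abs_killed_le (S := S) (C := C) hK n 0 ω)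
            exact sq_le_sq' this.1 this.2
          rw [integral_const, probReal_univ, one_smul] at h1
          have h2 := (hd.integral_sq_partialSum_mul_le hhm hhb (2 ^ n)).trans
            (mul_le_mul_of_nonneg_left (integral_sq_martIncr_le hS hK hC n (2 ^ n))
              (by norm_num : (0 : ℝ) ≤ 1 ^ 2))
          linarith
  · have hcond' : ∀ᵐ ω ∂P, ∀ j ≤ 2 ^ n,
        P[N | 𝓕 (grid T n j)] ω = killed S K C n 0 ω + U j ω :=
      (ae_ball_iff (Set.to_countable {j | j ≤ 2 ^ n})).2 hcond
    filter_upwards [hcond'] with ω hω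
    refine le_trans (le_of_eq ?_) ((sum_killed_variation_le (fun j ↦ killed S K C n j ω)
      (fun j ↦ drift 𝓕 P S K C n j ω) (fun j ↦ martIncr 𝓕 P S K C n j ω)
      (F := fun j ↦ ω ∈ F j) (fun i j hij hj ↦ aliveSet_antitone n hij hj) (fun j ↦ ?_) hD
      (fun j ↦ abs_killed_le hK n j ω) (2 ^ n) fun j hj hFj ↦ ?_).trans (le_max_right _ _))
    · refine Finset.sum_congr rfl fun j hj ↦ ?_
      have hj' := Finset.mem_range.1 hj
      have hr : ∀ j ≤ 2 ^ n, (quadSet S K C n (gridIndex n (grid T n j)) ∩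
          F (gridIndex n (grid T n j))).indicator (S (grid T n j)) ω =
          if ω ∈ F j then killed S K C n j ω else 0 := by
        intro j hj
        rw [gridIndex_grid hpos hj, Set.indicator_apply, killed]
        by_cases h1 : ω ∈ F j <;> by_cases h2 : ω ∈ quadSet S K C n j <;> simp [h1, h2]
      dsimp only
      rw [hr j hj'.le, hr (j + 1) hj', hω j hj'.le, hω (j + 1) hj', hU, partialSum_succ]
      simp only [hh]
      congr 1
      split_ifs <;> ring
    · simp only [martIncr, killedIncr]; ring
    · have h1 : ∑ i ∈ Finset.range (min (j + 1) (2 ^ n)), |drift 𝓕 P S K C n i ω| ≤ D := hFj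
      rwa [min_eq_left (Nat.succ_le_of_lt hj)] at h1

end DiscreteDecomposition

/-! ### Convex combinations of tails. -/

section ConvexCombinations

/-- A sequence of finitely supported convex weights, the `n`-th one supported on `[n, ∞)`. -/
structure IsTailWeights (w : ℕ → ℕ →₀ ℝ) : Prop where
  nonneg : ∀ n k, 0 ≤ w n k
  sum_one : ∀ n, ∑ k ∈ (w n).support, w n k = 1
  le : ∀ n, ∀ k ∈ (w n).support, n ≤ k

variable {w : ℕ → ℕ →₀ ℝ}

lemma IsTailWeights.comp (hw : IsTailWeights w) {φ : ℕ → ℕ} (hφ : ∀ n, n ≤ φ n) :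
    IsTailWeights (fun n ↦ w (φ n)) where
  nonneg n := hw.nonneg (φ n)
  sum_one n := hw.sum_one (φ n)
  le n k hk := (hφ n).trans (hw.le (φ n) k hk)

lemma IsTailWeights.sum_mem (hw : IsTailWeights w) {s : Set ℝ} (hs : Convex ℝ s) {a : ℕ → ℝ}
    {n : ℕ} (ha : ∀ k ≥ n, a k ∈ s) : ∑ k ∈ (w n).support, w n k * a k ∈ s :=
  hs.sum_mem (fun k _ ↦ hw.nonneg n k) (hw.sum_one n) fun k hk ↦ ha k (hw.le n k hk)

lemma IsTailWeights.tendsto (hw : IsTailWeights w) {a : ℕ → ℝ} {l : ℝ}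
    (ha : Tendsto a atTop (𝓝 l)) :
    Tendsto (fun n ↦ ∑ k ∈ (w n).support, w n k * a k) atTop (𝓝 l) := by
  refine Metric.tendsto_atTop.2 fun ε hε ↦ ?_
  obtain ⟨N, hN⟩ := Metric.tendsto_atTop.1 ha ε hε
  exact ⟨N, fun n hn ↦ hw.sum_mem (convex_ball l ε) fun k hk ↦ hN k (hn.trans hk)⟩

lemma IsTailWeights.sq_sum_le (hw : IsTailWeights w) (a : ℕ → ℝ) (n : ℕ) :
    (∑ k ∈ (w n).support, w n k * a k) ^ 2 ≤ ∑ k ∈ (w n).support, w n k * a k ^ 2 :=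
  (even_two.convexOn_pow (𝕜 := ℝ)).map_sum_le (fun k _ ↦ hw.nonneg n k) (hw.sum_one n)
    fun _ _ ↦ Set.mem_univ _

lemma IsTailWeights.gridVar_sum_le (hw : IsTailWeights w) {T : ℝ} [Fact (0 ≤ T)]
    {a : ℕ → Set.Icc (0 : ℝ) T → ℝ} {m n : ℕ} {Z : ℝ} (ha : ∀ k ≥ n, gridVar (a k) m ≤ Z) :
    gridVar (fun t ↦ ∑ k ∈ (w n).support, w n k * a k t) m ≤ Z := by
  calc gridVar (fun t ↦ ∑ k ∈ (w n).support, w n k * a k t) m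
      ≤ ∑ j ∈ Finset.range (2 ^ m), ∑ k ∈ (w n).support,
          w n k * |a k (grid T m (j + 1)) - a k (grid T m j)| := by
        refine Finset.sum_le_sum fun j _ ↦ ?_
        rw [← Finset.sum_sub_distrib]
        refine (Finset.abs_sum_le_sum_abs _ _).trans (Finset.sum_le_sum fun k _ ↦ ?_)
        rw [← mul_sub, abs_mul, abs_of_nonneg (hw.nonneg n k)]
    _ = ∑ k ∈ (w n).support, w n k * gridVar (a k) m := by
        rw [Finset.sum_comm]
        simp only [gridVar, Finset.mul_sum]
    _ ≤ Z := hw.sum_mem (convex_Iic Z) ha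

/-- In a Hilbert space every bounded sequence has convergent convex combinations of its tails. -/
theorem exists_isTailWeights_tendsto {E : Type*} [NormedAddCommGroup E] [InnerProductSpace ℝ E]
    [CompleteSpace E] {x : ℕ → E} {C : ℝ} (hx : ∀ n, ‖x n‖ ≤ C) :
    ∃ (w : ℕ → ℕ →₀ ℝ) (y : E), IsTailWeights w ∧
      Tendsto (fun n ↦ ∑ k ∈ (w n).support, w n k • x k) atTop (𝓝 y) := by
  let W : ℕ → Set (ℕ →₀ ℝ) := fun n ↦
    {f | (∀ k, 0 ≤ f k) ∧ Finsupp.linearCombination ℝ (fun _ : ℕ ↦ (1 : ℝ)) f = 1 ∧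
      ∀ k < n, f k = 0}
  let L := Finsupp.linearCombination ℝ x
  have hWm : ∀ {m n}, m ≤ n → W n ⊆ W m := fun hmn f hf ↦
    ⟨hf.1, hf.2.1, fun k hk ↦ hf.2.2 k (hk.trans_le hmn)⟩
  have hsingle : ∀ n, Finsupp.single n 1 ∈ W n := fun n ↦
    ⟨fun k ↦ by rw [Finsupp.single_apply]; split_ifs <;> simp, by simp,
      fun k hk ↦ Finsupp.single_eq_of_ne hk.ne⟩
  -- The distance from the origin to the convex hull of the `n`-th tail. It increases to a limit
  -- `D`, and almost minimal elements form a Cauchy sequence.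
  let d : ℕ → ℝ := fun n ↦ ⨅ f : W n, ‖L f‖
  have hbdd : ∀ n, BddBelow (Set.range fun f : W n ↦ ‖L f‖) := fun n ↦
    ⟨0, by rintro _ ⟨f, rfl⟩; exact norm_nonneg _⟩
  have hd : ∀ n, ∀ f ∈ W n, d n ≤ ‖L f‖ := fun n f hf ↦ ciInf_le (hbdd n) ⟨f, hf⟩
  have hdC : ∀ n, d n ≤ C := fun n ↦ (hd n _ (hsingle n)).trans (by simpa [L] using hx n)
  have hne : ∀ n, Nonempty (W n) := fun n ↦ ⟨⟨_, hsingle n⟩⟩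
  have hdm : Monotone d := fun m n hmn ↦
    have := hne n
    le_ciInf fun f ↦ hd m f (hWm hmn f.2)
  have hd0 : ∀ n, 0 ≤ d n := fun n ↦
    have := hne n
    le_ciInf fun f ↦ norm_nonneg _
  obtain ⟨D, hD⟩ : ∃ D, Tendsto d atTop (𝓝 D) :=
    ⟨_, tendsto_atTop_ciSup hdm ⟨C, by rintro _ ⟨n, rfl⟩; exact hdC n⟩⟩
  have hdD : ∀ n, d n ≤ D := fun n ↦ hdm.ge_of_tendsto hD n
  have hex : ∀ n : ℕ, ∃ f ∈ W n, ‖L f‖ < d n + 1 / ((n : ℝ) + 1) := fun n ↦ by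
    have := hne n
    obtain ⟨f, hf⟩ := exists_lt_of_ciInf_lt
      (show (⨅ f : W n, ‖L f‖) < d n + 1 / ((n : ℝ) + 1) from
        lt_add_of_pos_right _ Nat.one_div_pos_of_nat)
    exact ⟨f, f.2, hf⟩
  choose w hw hwd using hex
  have hw' : IsTailWeights w :=
    ⟨fun n ↦ (hw n).1, fun n ↦ by
      have := (hw n).2.1
      rw [Finsupp.linearCombination_apply, Finsupp.sum] at this
      simpa using this, fun n k hk ↦ by
      by_contra! h
      exact Finsupp.mem_support_iff.1 hk ((hw n).2.2 k h)⟩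
  -- By the parallelogram law `‖u - v‖² = 2‖u‖² + 2‖v‖² - 4‖(u + v)/2‖²`, and the midpoint belongs
  -- to the same hull, so its norm is at least `d N`.
  let b : ℕ → ℝ := fun N ↦ √(4 * (D + 1 / ((N : ℝ) + 1)) ^ 2 - 4 * d N ^ 2)
  have hb : Tendsto b atTop (𝓝 0) := by
    have h : Tendsto b atTop (𝓝 √(4 * (D + 0) ^ 2 - 4 * D ^ 2)) :=
      (Real.continuous_sqrt.tendsto _).comp
        ((((tendsto_const_nhds.add tendsto_one_div_add_atTop_nhds_zero_nat).pow 2).const_mul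
          4).sub ((hD.pow 2).const_mul 4))
    simpa using h
  have hcau : CauchySeq (fun n ↦ L (w n)) := by
    refine cauchySeq_of_le_tendsto_0 b (fun n m N hn hm ↦ ?_) hb
    have hmid : (1 / 2 : ℝ) • (w n + w m) ∈ W N := by
      refine ⟨fun k ↦ ?_, ?_, fun k hk ↦ ?_⟩
      · have := (hw n).1 k
        have := (hw m).1 k
        simp only [Finsupp.smul_apply, Finsupp.add_apply, smul_eq_mul]
        positivity
      · rw [map_smul, map_add, (hw n).2.1, (hw m).2.1]
        norm_num
      · simp [(hWm hn (hw n)).2.2 k hk, (hWm hm (hw m)).2.2 k hk]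
    have h1 := hd N _ hmid
    rw [map_smul, map_add, norm_smul, Real.norm_of_nonneg (by norm_num)] at h1
    have h2 : ∀ i ≥ N, ‖L (w i)‖ ≤ D + 1 / ((N : ℝ) + 1) := fun i hi ↦ by
      refine (hwd i).le.trans (add_le_add (hdD i) ?_)
      exact Nat.one_div_le_one_div hi
    have h3 := parallelogram_law_with_norm ℝ (L (w n)) (L (w m))
    have h4 := mul_self_le_mul_self (norm_nonneg _) (h2 n hn)
    have h5 := mul_self_le_mul_self (norm_nonneg _) (h2 m hm)
    have h6 := mul_self_le_mul_self (hd0 N) h1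
    rw [dist_eq_norm]
    refine Real.le_sqrt_of_sq_le ?_
    nlinarith
  obtain ⟨y, hy⟩ := cauchySeq_tendsto_of_complete hcau
  exact ⟨w, y, hw', hy⟩

end ConvexCombinations

/-! ### Almost sure convergence of convex combinations. -/

section Komlos

variable {α : Type*} {mα : MeasurableSpace α} {μ : Measure α}

lemma ae_tendsto_zero_of_eLpNorm_one_le {f : ℕ → α → ℝ} (hf : ∀ n, AEStronglyMeasurable (f n) μ)
    (h : ∀ n, eLpNorm (f n) 1 μ ≤ (2 : ℝ≥0∞)⁻¹ ^ n) :
    ∀ᵐ a ∂μ, Tendsto (fun n ↦ f n a) atTop (𝓝 0) := by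
  have h1 : ∫⁻ a, ∑' n, ‖f n a‖ₑ ∂μ ≠ ∞ := by
    rw [lintegral_tsum fun n ↦ (hf n).enorm]
    refine ne_top_of_le_ne_top ?_ (ENNReal.tsum_le_tsum fun n ↦
      (eLpNorm_one_eq_lintegral_enorm (f := f n) (μ := μ)).symm.le.trans (h n))
    rw [ENNReal.tsum_geometric]
    simp
  have h2 := ae_lt_top' (AEMeasurable.tsum fun n ↦ (hf n).enorm) h1
  filter_upwards [h2] with a ha
  have := ENNReal.tendsto_atTop_zero_of_tsum_ne_top ha.ne
  exact tendsto_zero_iff_enorm_tendsto_zero.2 this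

/-- A Komlós type lemma for sequences bounded in `L²`. -/
theorem exists_isTailWeights_eLpNorm_le [IsProbabilityMeasure μ] {f : ℕ → α → ℝ} {C : ℝ}
    (hf : ∀ n, MemLp (f n) 2 μ) (hC : ∀ n, ∫ a, f n a ^ 2 ∂μ ≤ C) :
    ∃ (w : ℕ → ℕ →₀ ℝ) (g : α → ℝ), IsTailWeights w ∧ MemLp g 2 μ ∧
      ∀ n, eLpNorm (fun a ↦ ∑ k ∈ (w n).support, w n k * f k a - g a) 1 μ ≤ (2 : ℝ≥0∞)⁻¹ ^ n := by
  have hnorm : ∀ n, ‖(hf n).toLp (f n)‖ ≤ √C := fun n ↦ by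
    refine Real.le_sqrt_of_sq_le ((le_of_eq ?_).trans (hC n))
    rw [← real_inner_self_eq_norm_sq, L2.inner_def]
    refine integral_congr_ae ?_
    filter_upwards [(hf n).coeFn_toLp] with a ha
    rw [ha]
    simp [sq]
  obtain ⟨w, y, hw, hy⟩ := exists_isTailWeights_tendsto hnorm
  have hlim : Tendsto (fun n ↦ eLpNorm
      (fun a ↦ ∑ k ∈ (w n).support, w n k * f k a - y a) 1 μ) atTop (𝓝 0) := by
    have h1 := (Lp.tendsto_Lp_iff_tendsto_eLpNorm' _ _).1 hy
    refine tendsto_of_tendsto_of_tendsto_of_le_of_le tendsto_const_nhds h1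
      (fun _ ↦ zero_le) fun n ↦ ?_
    have hm : AEStronglyMeasurable (fun a ↦ ∑ k ∈ (w n).support, w n k * f k a - y a) μ :=
      (Finset.aestronglyMeasurable_fun_sum _ fun k _ ↦
        ((hf k).1.const_mul (w n k))).sub (Lp.aestronglyMeasurable y)
    refine (eLpNorm_le_eLpNorm_of_exponent_le one_le_two hm).trans (le_of_eq ?_)
    refine eLpNorm_congr_ae ?_
    have h2 : ∀ᵐ a ∂μ, ∀ k, (hf k).toLp (f k) a = f k a :=
      ae_all_iff.2 fun k ↦ (hf k).coeFn_toLp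
    have h3 : ∀ᵐ a ∂μ, ∀ k, (w n k • (hf k).toLp (f k) : Lp ℝ 2 μ) a =
        w n k • (hf k).toLp (f k) a := ae_all_iff.2 fun k ↦ Lp.coeFn_smul _ _
    filter_upwards [h2, h3, Lp.coeFn_finsetSum (w n).support
      (fun k ↦ w n k • (hf k).toLp (f k))] with a h2 h3 h4
    rw [Pi.sub_apply, h4, Finset.sum_apply]
    simp only [h3, h2, smul_eq_mul]
  -- A subsequence makes the errors summable in L¹. This rate is recorded instead of almost sure
  -- convergence because it survives conditional expectations.
  have hφ : ∀ n, ∃ m ≥ n, eLpNorm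
      (fun a ↦ ∑ k ∈ (w m).support, w m k * f k a - y a) 1 μ ≤ (2 : ℝ≥0∞)⁻¹ ^ n := fun n ↦ by
    have h1 := (hlim.eventually (eventually_le_nhds
      (show (0 : ℝ≥0∞) < 2⁻¹ ^ n from ENNReal.pow_pos (by simp) n))).and (eventually_ge_atTop n)
    obtain ⟨m, h2, h3⟩ := h1.exists
    exact ⟨m, h3, h2⟩
  choose φ hφ hφ' using hφ
  exact ⟨fun n ↦ w (φ n), y, hw.comp hφ, Lp.memLp y, hφ'⟩

end Komlos

/-! ### Limits of conditional expectations. -/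

section CondExpLimits

variable {Ω : Type*} {m0 : MeasurableSpace Ω} {P : Measure Ω} [IsProbabilityMeasure P]

/-- Conditional expectations of one integrable variable are uniformly integrable, so the almost sure
limit is an L¹ limit and integrals over sets of `m` pass to it. Since `X` is assumed `m`-measurable,
the `G n` need neither be monotone nor intersect to `m`. -/
lemma ae_eq_condExp_of_tendsto {m : MeasurableSpace Ω} (hm : m ≤ m0) {G : ℕ → MeasurableSpace Ω}
    (hG : ∀ n, G n ≤ m0) (hmG : ∀ n, m ≤ G n) {N X : Ω → ℝ} (hN : Integrable N P)
    (hX : StronglyMeasurable[m] X)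
    (hlim : ∀ᵐ ω ∂P, Tendsto (fun n ↦ P[N | G n] ω) atTop (𝓝 (X ω))) :
    Integrable X P ∧ X =ᵐ[P] P[N | m] := by
  have hui := hN.uniformIntegrable_condExp hG
  have hXi : MemLp X 1 P := hui.memLp_of_ae_tendsto hlim
  have hXi' := memLp_one_iff_integrable.1 hXi
  have h1 := tendsto_Lp_finite_of_tendsto_ae le_rfl ENNReal.one_ne_top
    (fun n ↦ hui.1 n) hXi hui.2.1 hlim
  refine ⟨hXi', ae_eq_condExp_of_forall_setIntegral_eq hm hN (fun s _ _ ↦ hXi'.integrableOn)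
    (fun s hs _ ↦ ?_) hX.aestronglyMeasurable⟩
  have h2 := tendsto_setIntegral_of_L1' X hXi'.1
    (Eventually.of_forall fun n ↦ integrable_condExp) h1 s
  refine tendsto_nhds_unique h2 (tendsto_const_nhds.congr fun n ↦ ?_)
  rw [setIntegral_condExp (hG n) hN (hmG n s hs)]

end CondExpLimits

/-! ### Passing decompositions to the limit. -/

section LimitDecomposition

variable {Ω : Type*} {mΩ : MeasurableSpace Ω} {P : Measure Ω} [IsProbabilityMeasure P]
  {T : ℝ} [hT : Fact (0 ≤ T)] {𝓕 : Filtration (Set.Icc (0 : ℝ) T) mΩ}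

lemma condExp_weighted_sum {w : ℕ → ℕ →₀ ℝ} {N : ℕ → Ω → ℝ} (hN : ∀ n, Integrable (N n) P)
    (m : MeasurableSpace Ω) (n : ℕ) :
    P[fun ω ↦ ∑ k ∈ (w n).support, w n k * N k ω | m] =ᵐ[P]
      fun ω ↦ ∑ k ∈ (w n).support, w n k * P[N k | m] ω := by
  have h1 : (fun ω ↦ ∑ k ∈ (w n).support, w n k * N k ω) =
      ∑ k ∈ (w n).support, w n k • N k := by
    ext ω; simp [Finset.sum_apply]
  rw [h1]
  have h2 := condExp_finsetSum (μ := P) (s := (w n).support) (f := fun k ↦ w n k • N k)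
    (fun k _ ↦ (hN k).smul (w n k)) m
  have h3 : ∀ᵐ ω ∂P, ∀ k, P[w n k • N k | m] ω = (w n k • P[N k | m]) ω :=
    ae_all_iff.2 fun k ↦ condExp_smul (w n k) (N k) m
  filter_upwards [h2, h3] with ω h2 h3
  rw [h2, Finset.sum_apply]
  refine Finset.sum_congr rfl fun k _ ↦ ?_
  rw [h3 k]; rfl

lemma memLp_weighted_sum {w : ℕ → ℕ →₀ ℝ} {N : ℕ → Ω → ℝ} (hN : ∀ n, MemLp (N n) 2 P) (n : ℕ) :
    MemLp (fun ω ↦ ∑ k ∈ (w n).support, w n k * N k ω) 2 P :=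
  memLp_finsetSum _ fun k _ ↦ (hN k).const_mul _

lemma IsTailWeights.integral_sq_sum_le {w : ℕ → ℕ →₀ ℝ} (hw : IsTailWeights w)
    {N : ℕ → Ω → ℝ} {C : ℝ} (hN : ∀ n, MemLp (N n) 2 P) (hC : ∀ n, ∫ ω, N n ω ^ 2 ∂P ≤ C) (n : ℕ) :
    ∫ ω, (∑ k ∈ (w n).support, w n k * N k ω) ^ 2 ∂P ≤ C := by
  calc ∫ ω, (∑ k ∈ (w n).support, w n k * N k ω) ^ 2 ∂P
      ≤ ∫ ω, ∑ k ∈ (w n).support, w n k * N k ω ^ 2 ∂P :=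
        integral_mono (memLp_weighted_sum hN n).integrable_sq
          (integrable_finsetSum _ fun k _ ↦ (hN k).integrable_sq.const_mul _)
          fun ω ↦ hw.sq_sum_le _ n
    _ = ∑ k ∈ (w n).support, w n k * ∫ ω, N k ω ^ 2 ∂P := by
        rw [integral_finsetSum _ fun k _ ↦ (hN k).integrable_sq.const_mul _]
        simp only [integral_const_mul]
    _ ≤ C := hw.sum_mem (convex_Iic C) fun k _ ↦ hC k

lemma tendsto_gridVar {a : ℕ → Set.Icc (0 : ℝ) T → ℝ} {b : Set.Icc (0 : ℝ) T → ℝ}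
    (h : ∀ q ∈ dyadics T, Tendsto (fun n ↦ a n q) atTop (𝓝 (b q))) (m : ℕ) :
    Tendsto (fun n ↦ gridVar (a n) m) atTop (𝓝 (gridVar b m)) :=
  tendsto_finsetSum _ fun _ _ ↦
    ((h _ (grid_mem_dyadics _ _)).sub (h _ (grid_mem_dyadics _ _))).abs

lemma gridVar_congr {a b : Set.Icc (0 : ℝ) T → ℝ} (h : ∀ q ∈ dyadics T, a q = b q) (m : ℕ) :
    gridVar a m = gridVar b m :=
  Finset.sum_congr rfl fun _ _ ↦ by rw [h _ (grid_mem_dyadics _ _), h _ (grid_mem_dyadics _ _)]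

/-- A process of bounded variation along the dyadic grids has a càdlàg adapted regularization. -/
theorem exists_finiteVariation_regularization (h𝓕 : UsualConditions 𝓕 P)
    {a : Set.Icc (0 : ℝ) T → Ω → ℝ} (ha : ∀ q ∈ dyadics T, StronglyMeasurable[𝓕 q] (a q))
    (hvar : ∀ᵐ ω ∂P, ∃ Z, ∀ n, gridVar (fun t ↦ a t ω) n ≤ Z) :
    ∃ A : Set.Icc (0 : ℝ) T → Ω → ℝ, IsFiniteVariationProcess A 𝓕 P ∧
      ∀ᵐ ω ∂P, ∀ t, Tendsto (fun n ↦ a (next n t) ω) atTop (𝓝 (A t ω)) := by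
  classical
  let A : Set.Icc (0 : ℝ) T → Ω → ℝ := fun t ω ↦
    if h : ∃ b : Set.Icc (0 : ℝ) T → ℝ, IsCadlag b ∧ BoundedVariationOn b Set.univ ∧
      ∀ t, Tendsto (fun n ↦ a (next n t) ω) atTop (𝓝 (b t)) then h.choose t else 0
  have hA : ∀ᵐ ω ∂P, IsCadlag (fun t ↦ A t ω) ∧ BoundedVariationOn (fun t ↦ A t ω) Set.univ ∧
      ∀ t, Tendsto (fun n ↦ a (next n t) ω) atTop (𝓝 (A t ω)) := by
    filter_upwards [hvar] with ω ⟨Z, hZ⟩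
    have h := exists_cadlag_regularization (a := fun t ↦ a t ω) hZ
    simp only [A, dif_pos h]
    exact h.choose_spec
  exact ⟨A, ⟨fun t ↦ h𝓕.stronglyMeasurable_of_tendsto_next ha (hA.mono fun ω h ↦ h.2.2 t),
    hA.mono fun ω h ↦ h.1, hA.mono fun ω h ↦ h.2.1⟩, hA.mono fun ω h ↦ h.2.2⟩

/-- If a process is the limit of processes which, along finer and finer grids, are sums of
martingales bounded in `L²` and processes of bounded variation, then it is itself such a sum. -/
theorem exists_decomposition_of_tendsto (h𝓕 : UsualConditions 𝓕 P)
    {Y : ℕ → Set.Icc (0 : ℝ) T → Ω → ℝ} {Y' X : Set.Icc (0 : ℝ) T → Ω → ℝ} {N : ℕ → Ω → ℝ} {C : ℝ}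
    (hX : StronglyAdapted 𝓕 X) (hXc : IsCadlagProcess X P)
    (hY' : ∀ q ∈ dyadics T, StronglyMeasurable[𝓕 q] (Y' q))
    (hN : ∀ n, MemLp (N n) 2 P) (hC : ∀ n, ∫ ω, N n ω ^ 2 ∂P ≤ C)
    (hlim : ∀ᵐ ω ∂P, ∀ q ∈ dyadics T, Tendsto (fun n ↦ Y n q ω) atTop (𝓝 (Y' q ω)))
    (hnext : ∀ᵐ ω ∂P, ∀ t, Tendsto (fun n ↦ Y' (next n t) ω) atTop (𝓝 (X t ω)))
    (hvar : ∀ᵐ ω ∂P, ∃ Z, ∀ n, gridVar (fun t ↦ Y n t ω - P[N n | 𝓕 t] ω) n ≤ Z) :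
    ∃ M A : Set.Icc (0 : ℝ) T → Ω → ℝ, Martingale M 𝓕 P ∧ (∀ t, MemLp (M t) 2 P) ∧
      IsCadlagProcess M P ∧ IsFiniteVariationProcess A 𝓕 P ∧ ∀ t ω, X t ω = M t ω + A t ω := by
  classical
  obtain ⟨w, N', hw, hN', hNN'⟩ := exists_isTailWeights_eLpNorm_le hN hC
  have hNi : ∀ n, Integrable (N n) P := fun n ↦ (hN n).integrable one_le_two
  have hN'i : Integrable N' P := hN'.integrable one_le_two
  -- Conditioning contracts L¹, so the summable rate gives almost sure convergence of the
  -- martingales at every dyadic time.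
  have hcond : ∀ᵐ ω ∂P, ∀ q ∈ dyadics T, Tendsto
      (fun n ↦ ∑ k ∈ (w n).support, w n k * P[N k | 𝓕 q] ω) atTop (𝓝 (P[N' | 𝓕 q] ω)) := by
    refine (ae_ball_iff countable_dyadics).2 fun q _ ↦ ?_
    have hWi : ∀ n, Integrable (fun ω ↦ ∑ k ∈ (w n).support, w n k * N k ω) P := fun n ↦
      (memLp_weighted_sum hN n).integrable one_le_two
    have h1 : ∀ n, eLpNorm (P[(fun ω ↦ ∑ k ∈ (w n).support, w n k * N k ω) - N' | 𝓕 q]) 1 P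
        ≤ (2 : ℝ≥0∞)⁻¹ ^ n := fun n ↦
      (eLpNorm_condExp_le_eLpNorm _ le_rfl).trans (hNN' n)
    have h2 : ∀ᵐ ω ∂P, ∀ n, P[(fun ω ↦ ∑ k ∈ (w n).support, w n k * N k ω) - N' | 𝓕 q] ω =
        ∑ k ∈ (w n).support, w n k * P[N k | 𝓕 q] ω - P[N' | 𝓕 q] ω := by
      refine ae_all_iff.2 fun n ↦ ?_
      filter_upwards [condExp_sub (hWi n) hN'i (𝓕 q), condExp_weighted_sum (w := w) hNi (𝓕 q) n]
        with ω h3 h4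
      rw [h3, Pi.sub_apply, h4]
    filter_upwards [h2, ae_tendsto_zero_of_eLpNorm_one_le
      (fun n ↦ integrable_condExp.aestronglyMeasurable) h1] with ω h3 h4
    have h5 := h4.add_const (P[N' | 𝓕 q] ω)
    rw [zero_add] at h5
    refine h5.congr fun n ↦ ?_
    rw [h3 n, sub_add_cancel]
  set a : Set.Icc (0 : ℝ) T → Ω → ℝ := fun t ω ↦ Y' t ω - P[N' | 𝓕 t] ω with ha
  obtain ⟨A, hA, hAlim⟩ := exists_finiteVariation_regularization h𝓕 (a := a)
    (fun q hq ↦ (hY' q hq).sub stronglyMeasurable_condExp) <| by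
    filter_upwards [hcond, hlim, hvar] with ω h1 h2 ⟨Z, hZ⟩
    refine ⟨Z, fun m ↦ ?_⟩
    have h3 : ∀ q ∈ dyadics T, Tendsto (fun n ↦ ∑ k ∈ (w n).support, w n k *
        (Y k q ω - P[N k | 𝓕 q] ω)) atTop (𝓝 (a q ω)) := fun q hq ↦ by
      refine ((hw.tendsto (h2 q hq)).sub (h1 q hq)).congr fun n ↦ ?_
      rw [← Finset.sum_sub_distrib]
      simp only [mul_sub]
    -- For `n ≥ m` the weights only involve indices `k ≥ m`, whose grids refine the `m`-th; the
    -- bound along the `k`-th grid therefore applies.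
    refine le_of_tendsto (tendsto_gridVar h3 m) (eventually_atTop.2 ⟨m, fun n hn ↦ ?_⟩)
    exact hw.gridVar_sum_le fun k hk ↦ (gridVar_mono _ (hn.trans hk)).trans (hZ k)
  have hMad : StronglyAdapted 𝓕 (fun t ω ↦ X t ω - A t ω) := fun t ↦ (hX t).sub (hA.adapted t)
  -- `X - A` is the limit of `Y' - a`, that is of `P[N' | 𝓕 (next n t)]`. This yields the martingale
  -- together with a càdlàg version of it.
  have hMeq : ∀ t, (fun ω ↦ X t ω - A t ω) =ᵐ[P] P[N' | 𝓕 t] := fun t ↦ by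
    refine (ae_eq_condExp_of_tendsto (𝓕.le t) (G := fun n ↦ 𝓕 (next n t)) (fun n ↦ 𝓕.le _)
      (fun n ↦ 𝓕.mono (le_next t n)) hN'i (hMad t) ?_).2
    filter_upwards [hnext, hAlim] with ω h1 h2
    refine ((h1 t).sub (h2 t)).congr fun n ↦ ?_
    simp only [ha]
    ring
  refine ⟨fun t ω ↦ X t ω - A t ω, A, ⟨hMad, fun s t hst ↦ ?_⟩, fun t ↦ ?_, ?_, hA, fun t ω ↦ by ring⟩
  · exact (condExp_congr_ae (hMeq t)).trans
      ((condExp_condExp_of_le (𝓕.mono hst) (𝓕.le t)).trans (hMeq s).symm)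
  · exact (hN'.condExp one_le_two).ae_eq (hMeq t).symm
  · filter_upwards [hXc, hA.cadlag] with ω h1 h2
    exact h1.sub h2

end LimitDecomposition

/-! ### Operations on finite variation processes. -/

section FiniteVariationProcess

variable {Ω : Type*} {mΩ : MeasurableSpace Ω} {P : Measure Ω} {T : ℝ} [hT : Fact (0 ≤ T)]
  {𝓕 : Filtration (Set.Icc (0 : ℝ) T) mΩ} {A B : Set.Icc (0 : ℝ) T → Ω → ℝ}

lemma IsFiniteVariationProcess.add (hA : IsFiniteVariationProcess A 𝓕 P)
    (hB : IsFiniteVariationProcess B 𝓕 P) :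
    IsFiniteVariationProcess (fun t ω ↦ A t ω + B t ω) 𝓕 P where
  adapted t := (hA.adapted t).add (hB.adapted t)
  cadlag := by filter_upwards [hA.cadlag, hB.cadlag] with ω h1 h2 using h1.add h2
  finiteVariation := by
    filter_upwards [hA.finiteVariation, hB.finiteVariation] with ω h1 h2
      using boundedVariationOn_add h1 h2

lemma IsFiniteVariationProcess.mul (hA : IsFiniteVariationProcess A 𝓕 P)
    (hB : IsFiniteVariationProcess B 𝓕 P) :
    IsFiniteVariationProcess (fun t ω ↦ A t ω * B t ω) 𝓕 P where
  adapted t := (hA.adapted t).mul (hB.adapted t)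
  cadlag := by filter_upwards [hA.cadlag, hB.cadlag] with ω h1 h2 using h1.mul h2
  finiteVariation := by
    filter_upwards [hA.finiteVariation, hB.finiteVariation, hA.cadlag, hB.cadlag]
      with ω h1 h2 h3 h4
    exact h1.mul h2

lemma IsFiniteVariationProcess.comp (hA : IsFiniteVariationProcess A 𝓕 P) {g : ℝ → ℝ} {K : NNReal}
    (hg : LipschitzWith K g) : IsFiniteVariationProcess (fun t ω ↦ g (A t ω)) 𝓕 P where
  adapted t := hg.continuous.comp_stronglyMeasurable (hA.adapted t)
  cadlag := hA.cadlag.mono fun _ h ↦ h.comp hg.continuous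
  finiteVariation := hA.finiteVariation.mono fun _ h ↦ hg.comp_boundedVariationOn h

end FiniteVariationProcess

/-! ### Products of martingales and finite variation processes. -/

section Multiplication

variable {Ω : Type*} {mΩ : MeasurableSpace Ω} {P : Measure Ω} [IsProbabilityMeasure P]
  {T : ℝ} [hT : Fact (0 ≤ T)] {𝓕 : Filtration (Set.Icc (0 : ℝ) T) mΩ}

lemma isMartingaleDiff_grid {M : Set.Icc (0 : ℝ) T → Ω → ℝ} (hM : Martingale M 𝓕 P)
    (hM2 : ∀ t, MemLp (M t) 2 P) (n : ℕ) :
    IsMartingaleDiff (gridFiltration 𝓕 n) P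
      (fun i ω ↦ M (grid T n (i + 1)) ω - M (grid T n i) ω) where
  stronglyMeasurable i := (hM.1 (grid T n (i + 1))).sub
    ((hM.1 (grid T n i)).mono (𝓕.mono (grid_mono n (Nat.le_succ i))))
  memLp i := (hM2 _).sub (hM2 _)
  condExp_eq_zero i := by
    have h1 : P[M (grid T n (i + 1)) - M (grid T n i) | 𝓕 (grid T n i)] =ᵐ[P]
        P[M (grid T n (i + 1)) | 𝓕 (grid T n i)] - P[M (grid T n i) | 𝓕 (grid T n i)] :=
      condExp_sub (hM.integrable _) (hM.integrable _) _
    have h2 := hM.2 _ _ (grid_mono (T := T) n (Nat.le_succ i))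
    have h3 := hM.2 _ _ (le_refl (grid T n i))
    filter_upwards [h1, h2, h3] with ω h1 h2 h3
    change P[M (grid T n (i + 1)) - M (grid T n i) | 𝓕 (grid T n i)] ω = 0
    rw [h1, Pi.sub_apply, h2, h3, sub_self]

/-- The product of a square integrable martingale and a bounded process of finite variation is
the sum of a martingale and a process of finite variation. -/
theorem exists_decomposition_mul (h𝓕 : UsualConditions 𝓕 P) {V M : Set.Icc (0 : ℝ) T → Ω → ℝ}
    (hV : IsFiniteVariationProcess V 𝓕 P) {c : ℝ} (hVc : ∀ t ω, |V t ω| ≤ c)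
    (hM : Martingale M 𝓕 P) (hM2 : ∀ t, MemLp (M t) 2 P) (hMc : IsCadlagProcess M P) :
    ∃ M' A : Set.Icc (0 : ℝ) T → Ω → ℝ, Martingale M' 𝓕 P ∧ (∀ t, MemLp (M' t) 2 P) ∧
      IsCadlagProcess M' P ∧ IsFiniteVariationProcess A 𝓕 P ∧
      ∀ t ω, V t ω * M t ω = M' t ω + A t ω := by
  set D : ℕ → ℕ → Ω → ℝ := fun n i ω ↦ M (grid T n (i + 1)) ω - M (grid T n i) ω with hD
  set h : ℕ → ℕ → Ω → ℝ := fun n i ↦ V (grid T n i) with hh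
  have hd : ∀ n, IsMartingaleDiff (gridFiltration 𝓕 n) P (D n) := isMartingaleDiff_grid hM hM2
  have hhm : ∀ n i, StronglyMeasurable[gridFiltration 𝓕 n i] (h n i) := fun n i ↦
    hV.adapted (grid T n i)
  have hhd := fun n ↦ (hd n).mul (hhm n) fun i ω ↦ hVc _ ω
  set U : ℕ → ℕ → Ω → ℝ := fun n ↦ partialSum (fun i ω ↦ h n i ω * D n i ω) with hU
  have hX0 : MemLp (fun ω ↦ V ⊥ ω * M ⊥ ω) 2 P :=
    memLp_mul_of_bound ((hV.adapted ⊥).mono (𝓕.le _)).aestronglyMeasurable (hVc ⊥) (hM2 ⊥)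
  have hX0m : StronglyMeasurable[𝓕 ⊥] (fun ω ↦ V ⊥ ω * M ⊥ ω) := (hV.adapted ⊥).mul (hM.1 ⊥)
  set N : ℕ → Ω → ℝ := fun n ω ↦ V ⊥ ω * M ⊥ ω + U n (2 ^ n) ω with hN
  have hN2 : ∀ n, MemLp (N n) 2 P := fun n ↦ hX0.add ((hhd n).memLp_partialSum _)
  have hcond : ∀ᵐ ω ∂P, ∀ n, ∀ j ≤ 2 ^ n,
      P[N n | 𝓕 (grid T n j)] ω = V ⊥ ω * M ⊥ ω + U n j ω := by
    refine ae_all_iff.2 fun n ↦ (ae_ball_iff (Set.to_countable {j | j ≤ 2 ^ n})).2 fun j hj ↦ ?_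
    have h1 : P[N n | 𝓕 (grid T n j)] =ᵐ[P]
        P[fun ω ↦ V ⊥ ω * M ⊥ ω | 𝓕 (grid T n j)] + P[U n (2 ^ n) | 𝓕 (grid T n j)] :=
      condExp_add (hX0.integrable one_le_two) ((hhd n).martingale.integrable _) _
    have h2 : P[fun ω ↦ V ⊥ ω * M ⊥ ω | 𝓕 (grid T n j)] = fun ω ↦ V ⊥ ω * M ⊥ ω :=
      condExp_of_stronglyMeasurable (𝓕.le _) (hX0m.mono (𝓕.mono bot_le))
        (hX0.integrable one_le_two)
    have h3 : P[U n (2 ^ n) | 𝓕 (grid T n j)] =ᵐ[P] U n j :=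
      (hhd n).martingale.condExp_ae_eq hj
    filter_upwards [h1, h3] with ω h4 h5
    rw [h4, Pi.add_apply, h2, h5]
  have hsum : ∀ n, partialSum (D n) (2 ^ n) = fun ω ↦ M ⊤ ω - M ⊥ ω := fun n ↦ by
    ext ω
    rw [partialSum, Finset.sum_range_sub (fun i ↦ M (grid T n i) ω), grid_top le_rfl, grid_zero]
  -- The increments of `M` along any grid sum to `M ⊤ - M ⊥`, so the bound for the transforms is
  -- independent of `n`.
  have hC : ∀ n, ∫ ω, N n ω ^ 2 ∂P ≤ 2 * ∫ ω, (V ⊥ ω * M ⊥ ω) ^ 2 ∂P +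
      2 * (c ^ 2 * ∫ ω, (M ⊤ ω - M ⊥ ω) ^ 2 ∂P) := fun n ↦ by
    have h1 := hX0.integrable_sq
    have h2 := ((hhd n).memLp_partialSum (2 ^ n)).integrable_sq
    have h3 := (hd n).integral_sq_partialSum_mul_le (hhm n) (fun i ω ↦ hVc _ ω) (2 ^ n)
    rw [hsum n] at h3
    calc ∫ ω, N n ω ^ 2 ∂P ≤ ∫ ω, 2 * (V ⊥ ω * M ⊥ ω) ^ 2 + 2 * U n (2 ^ n) ω ^ 2 ∂P :=
          integral_mono (hN2 n).integrable_sq ((h1.const_mul 2).add (h2.const_mul 2))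
            fun ω ↦ sq_add_le _ _
      _ = 2 * ∫ ω, (V ⊥ ω * M ⊥ ω) ^ 2 ∂P + 2 * ∫ ω, U n (2 ^ n) ω ^ 2 ∂P := by
          rw [integral_add (h1.const_mul 2) (h2.const_mul 2), integral_const_mul,
            integral_const_mul]
      _ ≤ _ := by gcongr
  have hVM : IsCadlagProcess (fun t ω ↦ V t ω * M t ω) P := by
    filter_upwards [hV.cadlag, hMc] with ω h1 h2 using h1.mul h2
  refine exists_decomposition_of_tendsto h𝓕 (Y := fun _ t ω ↦ V t ω * M t ω)
    (Y' := fun t ω ↦ V t ω * M t ω) (X := fun t ω ↦ V t ω * M t ω)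
    (fun t ↦ (hV.adapted t).mul (hM.1 t)) hVM (fun q _ ↦ (hV.adapted q).mul (hM.1 q)) hN2 hC
    (ae_of_all _ fun ω q _ ↦ tendsto_const_nhds) (hVM.mono fun ω h t ↦ h.tendsto_next t) ?_
  filter_upwards [hcond, hMc, hV.finiteVariation] with ω h1 h2 h3
  obtain ⟨K, hK⟩ := h2.exists_bound
  have hK0 : 0 ≤ K := (abs_nonneg _).trans (hK ⊥)
  refine ⟨K * (eVariationOn (fun t ↦ V t ω) Set.univ).toReal, fun n ↦ ?_⟩
  -- Summation by parts: removing the transform `Σ V ΔM` from `VM` leaves the increments `M ΔV`,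
  -- with `M` taken at the right end.
  calc gridVar (fun t ↦ V t ω * M t ω - P[N n | 𝓕 t] ω) n
      = ∑ j ∈ Finset.range (2 ^ n),
          |M (grid T n (j + 1)) ω| * |V (grid T n (j + 1)) ω - V (grid T n j) ω| := by
        refine Finset.sum_congr rfl fun j hj ↦ ?_
        have hj' := Finset.mem_range.1 hj
        dsimp only
        rw [h1 n j hj'.le, h1 n (j + 1) hj', ← abs_mul]
        simp only [hU, partialSum_succ, hh, hD]
        congr 1
        ring
    _ ≤ K * gridVar (fun t ↦ V t ω) n := by
        rw [gridVar, Finset.mul_sum]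
        gcongr
        exact hK _
    _ ≤ _ := by
        gcongr
        exact (ENNReal.ofReal_le_iff_le_toReal h3).1 (gridVar_le_eVariationOn _ n)

end Multiplication

/-! ### Decomposition outside a small event. -/

section ApproximateDecomposition

variable {Ω : Type*} {mΩ : MeasurableSpace Ω} {P : Measure Ω} [IsProbabilityMeasure P]
  {T : ℝ} [hT : Fact (0 ≤ T)] {𝓕 : Filtration (Set.Icc (0 : ℝ) T) mΩ}
  {S : Set.Icc (0 : ℝ) T → Ω → ℝ}

/-- Treating all dyadic times as one function on `Ω × ℕ` produces common weights for all of them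
without a diagonal argument. -/
lemma exists_isTailWeights_tendsto_indicator {r : ℕ → Set.Icc (0 : ℝ) T → Set Ω}
    (hr : ∀ n t, MeasurableSet (r n t)) :
    ∃ (w : ℕ → ℕ →₀ ℝ) (R : Set.Icc (0 : ℝ) T → Ω → ℝ), IsTailWeights w ∧
      ∀ᵐ ω ∂P, ∀ q ∈ dyadics T, Tendsto
        (fun n ↦ ∑ k ∈ (w n).support, w n k * (r k q).indicator (fun _ ↦ (1 : ℝ)) ω)
        atTop (𝓝 (R q ω)) := by
  obtain ⟨e, he⟩ := countable_dyadics.exists_eq_range ⟨⊤, top_mem_dyadics (T := T)⟩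
  -- A probability measure on `ℕ` charging every point: the functions stay bounded in L², and almost
  -- everywhere on the product means almost surely at every index.
  let ν : Measure ℕ := (Measure.count : Measure ℕ).toFinite
  let f : ℕ → Ω × ℕ → ℝ := fun k p ↦ (r k (e p.2)).indicator (fun _ ↦ (1 : ℝ)) p.1
  have hf : ∀ k, Measurable (f k) := fun k ↦
    measurable_from_prod_countable_left fun i ↦ measurable_const.indicator (hr k (e i))
  have hf1 : ∀ k p, |f k p| ≤ 1 := fun k p ↦ by
    by_cases h : p.1 ∈ r k (e p.2) <;> simp [f, h]
  have hf2 : ∀ k, MemLp (f k) 2 (P.prod ν) := fun k ↦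
    MemLp.of_bound (hf k).aestronglyMeasurable 1 (ae_of_all _ (hf1 k))
  obtain ⟨w, g, hw, hg, hwg⟩ := exists_isTailWeights_eLpNorm_le hf2 (C := 1) fun k ↦ by
    refine (integral_mono (hf2 k).integrable_sq (integrable_const 1) fun p ↦ ?_).trans (by simp)
    exact (sq_le_one_iff_abs_le_one _).2 (hf1 k p)
  have hae := ae_tendsto_zero_of_eLpNorm_one_le (fun n ↦
    ((Finset.aestronglyMeasurable_fun_sum _ fun k _ ↦
      ((hf2 k).1.const_mul (w n k))).sub hg.1)) hwg
  choose i hi using fun q : ↥(dyadics T) ↦ (he ▸ q.2 : (q : Set.Icc (0 : ℝ) T) ∈ Set.range e)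
  classical
  refine ⟨w, fun q ω ↦ if h : q ∈ dyadics T then g (ω, i ⟨q, h⟩) else 0, hw, ?_⟩
  filter_upwards [Measure.ae_ae_of_ae_prod hae] with ω hω q hq
  rw [ae_toFinite, Measure.ae_count_iff] at hω
  rw [dif_pos hq]
  have h1 := (hω (i ⟨q, hq⟩)).add_const (g (ω, i ⟨q, hq⟩))
  rw [zero_add] at h1
  refine h1.congr fun n ↦ ?_
  simp only [Pi.sub_apply, sub_add_cancel, f, hi]

/-- Fatou's lemma bounds the expectation of the positive part of `1 - R` by `ε`; Markov's inequality
at level 1/2 costs the factor 2. -/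
lemma measure_lt_half_le {r : ℕ → Set Ω} (hr : ∀ n, MeasurableSet (r n)) {ε : ℝ≥0∞}
    (hε : ∀ n, P (r n)ᶜ ≤ ε) {w : ℕ → ℕ →₀ ℝ} (hw : IsTailWeights w) {R : Ω → ℝ}
    (hlim : ∀ᵐ ω ∂P, Tendsto
      (fun n ↦ ∑ k ∈ (w n).support, w n k * (r k).indicator (fun _ ↦ (1 : ℝ)) ω)
      atTop (𝓝 (R ω))) : P {ω | R ω < 1 / 2} ≤ 2 * ε := by
  let f : ℕ → Ω → ℝ≥0∞ := fun n ω ↦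
    ∑ k ∈ (w n).support, ENNReal.ofReal (w n k) * (r k)ᶜ.indicator 1 ω
  have hf : ∀ n, Measurable (f n) := fun n ↦
    Finset.measurable_fun_sum _ fun k _ ↦ (measurable_one.indicator (hr k).compl).const_mul _
  have hfε : ∀ n, ∫⁻ ω, f n ω ∂P ≤ ε := fun n ↦ by
    rw [lintegral_finsetSum _ fun k _ ↦ (measurable_one.indicator (hr k).compl).const_mul _]
    calc ∑ k ∈ (w n).support, ∫⁻ ω, ENNReal.ofReal (w n k) * (r k)ᶜ.indicator 1 ω ∂P
        ≤ ∑ k ∈ (w n).support, ENNReal.ofReal (w n k) * ε := by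
          refine Finset.sum_le_sum fun k _ ↦ ?_
          rw [lintegral_const_mul _ (measurable_one.indicator (hr k).compl),
            lintegral_indicator_one (hr k).compl]
          gcongr
          exact hε k
      _ = ε := by
          rw [← Finset.sum_mul, ← ENNReal.ofReal_sum_of_nonneg fun k _ ↦ hw.nonneg n k,
            hw.sum_one n, ENNReal.ofReal_one, one_mul]
  have hfeq : ∀ n ω, f n ω = ENNReal.ofReal
      (1 - ∑ k ∈ (w n).support, w n k * (r k).indicator (fun _ ↦ (1 : ℝ)) ω) := fun n ω ↦ by
    have h1 : (1 : ℝ) - ∑ k ∈ (w n).support, w n k * (r k).indicator (fun _ ↦ (1 : ℝ)) ω =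
        ∑ k ∈ (w n).support, (w n k - w n k * (r k).indicator (fun _ ↦ (1 : ℝ)) ω) := by
      rw [Finset.sum_sub_distrib, hw.sum_one n]
    rw [h1, ENNReal.ofReal_sum_of_nonneg]
    · refine Finset.sum_congr rfl fun k _ ↦ ?_
      by_cases h : ω ∈ r k <;> simp [h]
    · intro k _
      have := hw.nonneg n k
      by_cases h : ω ∈ r k <;> simp [h, this]
  have hlim' : ∀ᵐ ω ∂P, Filter.liminf (fun n ↦ f n ω) atTop = ENNReal.ofReal (1 - R ω) := by
    filter_upwards [hlim] with ω hω
    simp only [hfeq]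
    exact (ENNReal.tendsto_ofReal (tendsto_const_nhds.sub hω)).liminf_eq
  have h1 : ∫⁻ ω, Filter.liminf (fun n ↦ f n ω) atTop ∂P ≤ ε :=
    (lintegral_liminf_le hf).trans (Filter.liminf_le_of_le (by isBoundedDefault) fun b hb ↦ by
      obtain ⟨n, hn⟩ := hb.exists
      exact hn.trans (hfε n))
  have h2 := mul_meas_ge_le_lintegral (μ := P) (Measurable.liminf hf) (ENNReal.ofReal (1 / 2))
  have h3 : P {ω | R ω < 1 / 2} ≤
      P {ω | ENNReal.ofReal (1 / 2) ≤ Filter.liminf (fun n ↦ f n ω) atTop} := by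
    refine measure_mono_ae ?_
    filter_upwards [hlim'] with ω h4 (h5 : R ω < 1 / 2)
    change _ ≤ _
    rw [h4]
    exact ENNReal.ofReal_le_ofReal (by linarith)
  have h6 : (2 : ℝ≥0∞) * ENNReal.ofReal (1 / 2) = 1 := by
    rw [one_div, ENNReal.ofReal_inv_of_pos two_pos, ENNReal.ofReal_ofNat]
    exact ENNReal.mul_inv_cancel (by simp) (by simp)
  calc P {ω | R ω < 1 / 2} ≤ P {ω | ENNReal.ofReal (1 / 2) ≤
        Filter.liminf (fun n ↦ f n ω) atTop} := h3
    _ = 2 * (ENNReal.ofReal (1 / 2) * P {ω | ENNReal.ofReal (1 / 2) ≤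
        Filter.liminf (fun n ↦ f n ω) atTop}) := by rw [← mul_assoc, h6, one_mul]
    _ ≤ 2 * ε := by gcongr; exact h2.trans h1

lemma lipschitzWith_inv_max_half : LipschitzWith 4 (fun x : ℝ ↦ (max x (1 / 2))⁻¹) := by
  refine LipschitzWith.of_dist_le_mul fun x y ↦ ?_
  have hx : (1 / 2 : ℝ) ≤ max x (1 / 2) := le_max_right _ _
  have hy : (1 / 2 : ℝ) ≤ max y (1 / 2) := le_max_right _ _
  have h1 : |max y (1 / 2) - max x (1 / 2)| ≤ |x - y| := by
    rw [abs_sub_comm]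
    exact abs_max_sub_max_le_abs _ _ _
  rw [Real.dist_eq, Real.dist_eq, inv_sub_inv (by positivity) (by positivity), abs_div,
    div_le_iff₀ (by positivity), abs_of_pos (by positivity : 0 < max x (1 / 2) * max y (1 / 2))]
  have h2 : (1 / 2 : ℝ) * (1 / 2) ≤ max x (1 / 2) * max y (1 / 2) :=
    mul_le_mul hx hy (by norm_num) (by positivity)
  have h3 := mul_le_mul_of_nonneg_left h2 (abs_nonneg (x - y))
  push_cast
  nlinarith

/-- Outside an event of arbitrarily small probability, a process satisfying the no free lunch
condition is the sum of a martingale and a process of finite variation. -/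
theorem exists_approximate_decomposition (hpos : 0 < T) (h𝓕 : UsualConditions 𝓕 P)
    (hS : StronglyAdapted 𝓕 S) (hc : IsCadlagProcess S P) (hN : NoFreeLunch 𝓕 P S)
    {ε : ℝ≥0∞} (hε : 0 < ε) :
    ∃ M A : Set.Icc (0 : ℝ) T → Ω → ℝ, Martingale M 𝓕 P ∧ IsCadlagProcess M P ∧
      IsFiniteVariationProcess A 𝓕 P ∧ P {ω | ¬ ∀ t, S t ω = M t ω + A t ω} ≤ ε := by
  -- Half of `ε`, because `measure_lt_half_le` doubles it.
  obtain ⟨C, hC⟩ := exists_discrete_decomposition hpos hS hc hN (ENNReal.half_pos hε.ne')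
  choose r N hr hra hrε hN2 hNC hvar using hC
  obtain ⟨w, R, hw, hR⟩ := exists_isTailWeights_tendsto_indicator (P := P) (r := r)
    fun n t ↦ 𝓕.le t _ (hr n t)
  have hind : ∀ k t ω, (r k t).indicator (fun _ ↦ (1 : ℝ)) ω ∈ Set.Icc (0 : ℝ) 1 := fun k t ω ↦ by
    by_cases h : ω ∈ r k t <;> simp [h]
  have hRm : ∀ q ∈ dyadics T, StronglyMeasurable[𝓕 q] (R q) := fun q hq ↦
    h𝓕.stronglyMeasurable_of_tendsto (X := fun n ω ↦
      ∑ k ∈ (w n).support, w n k * (r k q).indicator (fun _ ↦ (1 : ℝ)) ω)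
      (fun n ↦ Finset.stronglyMeasurable_fun_sum _ fun k _ ↦
        (stronglyMeasurable_const.indicator (hr k q)).const_mul _) (hR.mono fun ω h ↦ h q hq)
  have hRI : ∀ᵐ ω ∂P, ∀ q ∈ dyadics T, R q ω ∈ Set.Icc (0 : ℝ) 1 := by
    filter_upwards [hR] with ω h q hq
    exact isClosed_Icc.mem_of_tendsto (h q hq)
      (Eventually.of_forall fun n ↦ hw.sum_mem (convex_Icc 0 1) fun k _ ↦ hind k q ω)
  have hRa : ∀ᵐ ω ∂P, ∀ q ∈ dyadics T, ∀ p ∈ dyadics T, q ≤ p → R p ω ≤ R q ω := by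
    filter_upwards [hR] with ω h q hq p hp hqp
    refine le_of_tendsto_of_tendsto' (h p hp) (h q hq) fun n ↦ Finset.sum_le_sum fun k _ ↦ ?_
    refine mul_le_mul_of_nonneg_left ?_ (hw.nonneg n k)
    exact Set.indicator_le_indicator_of_subset (hra k hqp) (fun _ ↦ zero_le_one) ω
  -- `R` is decreasing with values in `[0, 1]`, so its grid variation telescopes and is at most 1.
  obtain ⟨R', hR', hR'lim⟩ := exists_finiteVariation_regularization h𝓕 hRm <| by
    filter_upwards [hRI, hRa] with ω h1 h2
    refine ⟨1, fun n ↦ ?_⟩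
    have h3 : gridVar (fun t ↦ R t ω) n =
        ∑ j ∈ Finset.range (2 ^ n), (R (grid T n j) ω - R (grid T n (j + 1)) ω) := by
      refine Finset.sum_congr rfl fun j _ ↦ ?_
      rw [abs_sub_comm, abs_of_nonneg (sub_nonneg.2 (h2 _ (grid_mem_dyadics _ _) _
        (grid_mem_dyadics _ _) (grid_mono n (Nat.le_succ j))))]
    rw [h3, Finset.sum_range_sub' (fun j ↦ R (grid T n j) ω)]
    linarith [(h1 _ (grid_mem_dyadics n 0)).2, (h1 _ (grid_mem_dyadics n (2 ^ n))).1]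
  have hX : IsCadlagProcess (fun t ω ↦ R' t ω * S t ω) P := by
    filter_upwards [hR'.cadlag, hc] with ω h1 h2 using h1.mul h2
  have hNi : ∀ n, Integrable (N n) P := fun n ↦ (hN2 n).integrable one_le_two
  obtain ⟨M, A, hM, hM2, hMc, hA, hMA⟩ := exists_decomposition_of_tendsto h𝓕
    (Y := fun n t ω ↦ (∑ k ∈ (w n).support, w n k * (r k t).indicator (fun _ ↦ (1 : ℝ)) ω) * S t ω)
    (Y' := fun t ω ↦ R t ω * S t ω) (X := fun t ω ↦ R' t ω * S t ω)
    (N := fun n ω ↦ ∑ k ∈ (w n).support, w n k * N k ω)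
    (fun t ↦ (hR'.adapted t).mul (hS t)) hX (fun q hq ↦ (hRm q hq).mul (hS q))
    (memLp_weighted_sum hN2) (hw.integral_sq_sum_le hN2 hNC)
    (hR.mono fun ω h q hq ↦ (h q hq).mul_const _)
    (by filter_upwards [hR'lim, hc] with ω h1 h2 t using (h1 t).mul (h2.tendsto_next t)) <| by
      have h1 : ∀ᵐ ω ∂P, ∀ q ∈ dyadics T, ∀ n,
          P[fun ω ↦ ∑ k ∈ (w n).support, w n k * N k ω | 𝓕 q] ω =
            ∑ k ∈ (w n).support, w n k * P[N k | 𝓕 q] ω :=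
        (ae_ball_iff countable_dyadics).2 fun q _ ↦
          ae_all_iff.2 fun n ↦ condExp_weighted_sum hNi (𝓕 q) n
      filter_upwards [h1, ae_all_iff.2 hvar] with ω h1 h2
      refine ⟨C, fun n ↦ ?_⟩
      rw [gridVar_congr (b := fun t ↦ ∑ k ∈ (w n).support,
        w n k * ((r k t).indicator (S t) ω - P[N k | 𝓕 t] ω)) fun q hq ↦ ?_]
      · exact hw.gridVar_sum_le fun k hk ↦ (gridVar_mono _ hk).trans (h2 k)
      · rw [h1 q hq n, Finset.sum_mul, ← Finset.sum_sub_distrib]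
        refine Finset.sum_congr rfl fun k _ ↦ ?_
        by_cases h : ω ∈ r k q <;> simp [h, mul_sub]
  -- Dividing by `R'` truncated at 1/2 keeps finite variation and gives a process bounded by 2.
  -- Where `R' ≥ 1/2` this recovers `S` from `R' * S`.
  have hV := hR'.comp lipschitzWith_inv_max_half
  obtain ⟨M', A', hM', -, hMc', hA', hMA'⟩ := exists_decomposition_mul h𝓕 hV (c := 2)
    (fun t ω ↦ by
      have h : (1 / 2 : ℝ) ≤ max (R' t ω) (1 / 2) := le_max_right _ _
      rw [abs_of_pos (by positivity)]
      exact (inv_anti₀ (by norm_num) h).trans (by norm_num)) hM hM2 hMc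
  refine ⟨M', _, hM', hMc', hA'.add (hV.mul hA), ?_⟩
  have h1 := measure_lt_half_le (fun n ↦ 𝓕.le _ _ (hr n ⊤)) hrε hw
    (hR.mono fun ω h ↦ h ⊤ top_mem_dyadics)
  rw [ENNReal.mul_div_cancel (by simp) (by simp)] at h1
  refine le_trans (measure_mono_ae ?_) h1
  filter_upwards [hRa, hR'lim] with ω h2 h3 h4
  by_contra! h5
  refine h4 fun t ↦ ?_
  have h5' : ¬ R ⊤ ω < 1 / 2 := h5
  -- By monotonicity, the terminal value of `R` bounds the whole path of `R'` from below.
  have h6 : 1 / 2 ≤ R' t ω := (not_lt.1 h5').trans (ge_of_tendsto (h3 t)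
    (Eventually.of_forall fun n ↦ h2 _ (next_mem_dyadics _ _) _ top_mem_dyadics le_top))
  have h7 : R' t ω ≠ 0 := by positivity
  rw [← add_assoc, ← hMA' t ω, ← mul_add, ← hMA t ω, max_eq_left h6]
  field_simp

end ApproximateDecomposition

/-! ### Optional sampling for càdlàg martingales. -/

section OptionalSampling

variable {Ω : Type*} {mΩ : MeasurableSpace Ω} {P : Measure Ω} {T : ℝ} [hT : Fact (0 ≤ T)]
  {𝓕 : Filtration (Set.Icc (0 : ℝ) T) mΩ} {τ : Ω → Set.Icc (0 : ℝ) T}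
  {X M : Set.Icc (0 : ℝ) T → Ω → ℝ}

lemma next_le_grid_iff {n j : ℕ} (hj : j ≤ 2 ^ n) {s : Set.Icc (0 : ℝ) T} (hs : s < ⊤) :
    next n s ≤ grid T n j ↔ s < grid T n j := by
  refine ⟨fun h ↦ (lt_next hs n).trans_le h, fun h ↦ grid_mono n ?_⟩
  have hT := T_pos_of_lt h
  have h1 : (s : ℝ) < grid T n j := h
  rw [coe_grid hj, lt_div_iff₀ (by positivity), mul_comm T, ← div_lt_iff₀ hT] at h1
  exact (Nat.floor_lt (by have := s.2.1; positivity)).2 h1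

lemma measurableSet_coe_le (hτ : IsStoppingTime 𝓕 (fun ω ↦ (τ ω : WithTop (Set.Icc (0 : ℝ) T))))
    (t : Set.Icc (0 : ℝ) T) : MeasurableSet[𝓕 t] {ω | τ ω ≤ t} := by
  simpa using hτ.measurableSet_le t

lemma measurableSet_coe_lt (hτ : IsStoppingTime 𝓕 (fun ω ↦ (τ ω : WithTop (Set.Icc (0 : ℝ) T))))
    (t : Set.Icc (0 : ℝ) T) : MeasurableSet[𝓕 t] {ω | τ ω < t} := by
  simpa using hτ.measurableSet_lt t

lemma measurableSet_coe_eq (hτ : IsStoppingTime 𝓕 (fun ω ↦ (τ ω : WithTop (Set.Icc (0 : ℝ) T))))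
    (t : Set.Icc (0 : ℝ) T) : MeasurableSet[𝓕 t] {ω | τ ω = t} := by
  simpa using hτ.measurableSet_eq t

lemma isStoppingTime_coe_iff :
    IsStoppingTime 𝓕 (fun ω ↦ (τ ω : WithTop (Set.Icc (0 : ℝ) T))) ↔
      ∀ t, MeasurableSet[𝓕 t] {ω | τ ω ≤ t} := by
  simp [IsStoppingTime]

lemma isStoppingTime_coe_min
    (hτ : IsStoppingTime 𝓕 (fun ω ↦ (τ ω : WithTop (Set.Icc (0 : ℝ) T)))) (t : Set.Icc (0 : ℝ) T) :
    IsStoppingTime 𝓕 (fun ω ↦ ((min (τ ω) t : Set.Icc (0 : ℝ) T) : WithTop _)) := by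
  simpa using hτ.min_const t

/-- The dyadic approximation from above of a stopping time is a stopping time. -/
lemma isStoppingTime_next (hτ : IsStoppingTime 𝓕 (fun ω ↦ (τ ω : WithTop (Set.Icc (0 : ℝ) T))))
    (n : ℕ) :
    IsStoppingTime 𝓕 (fun ω ↦ (next n (τ ω) : WithTop (Set.Icc (0 : ℝ) T))) := by
  refine isStoppingTime_coe_iff.2 fun t ↦ ?_
  rcases lt_or_eq_of_le (le_top : t ≤ ⊤) with ht | rfl
  · have h : {ω | next n (τ ω) ≤ t} =
        ⋃ j : ℕ, ⋃ (_ : j ≤ 2 ^ n ∧ grid T n j ≤ t), {ω | τ ω < grid T n j} := by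
      ext ω
      simp only [Set.mem_ofPred_eq, Set.mem_iUnion, exists_prop]
      constructor
      · intro h1
        have h2 : τ ω < ⊤ := (le_next _ n).trans_lt (h1.trans_lt ht)
        have h3 : ⌊(τ ω : ℝ) * 2 ^ n / T⌋₊ + 1 ≤ 2 ^ n := floor_lt_of_lt_top h2 n
        exact ⟨_, ⟨h3, h1⟩, lt_next h2 n⟩
      · rintro ⟨j, ⟨hj, h1⟩, h2⟩
        exact ((next_le_grid_iff hj (h2.trans_le le_top)).2 h2).trans h1
    rw [h]
    exact MeasurableSet.iUnion fun j ↦ MeasurableSet.iUnion fun hj ↦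
      𝓕.mono hj.2 _ (measurableSet_coe_lt hτ _)
  · simp

lemma stronglyMeasurable_sample_of_countable (hX : StronglyAdapted 𝓕 X)
    (hτ : IsStoppingTime 𝓕 (fun ω ↦ (τ ω : WithTop (Set.Icc (0 : ℝ) T))))
    (hc : (Set.range τ).Countable) (t : Set.Icc (0 : ℝ) T) :
    StronglyMeasurable[𝓕 t] (fun ω ↦ X (min (τ ω) t) ω) := by
  suffices h : Measurable[𝓕 t] (fun ω ↦ X (min (τ ω) t) ω) from h.stronglyMeasurable
  intro B hB
  have h : (fun ω ↦ X (min (τ ω) t) ω) ⁻¹' B =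
      (⋃ q ∈ Set.range τ, {ω | τ ω = q ∧ q ≤ t} ∩ X q ⁻¹' B) ∪ ({ω | τ ω ≤ t}ᶜ ∩ X t ⁻¹' B) := by
    ext ω
    simp only [Set.mem_preimage, Set.mem_union, Set.mem_iUnion, Set.mem_inter_iff,
      Set.mem_ofPred_eq, Set.mem_compl_iff, exists_prop]
    rcases le_or_gt (τ ω) t with h | h
    · simp only [min_eq_left h, h, not_true_eq_false, false_and, or_false]
      constructor
      · exact fun h1 ↦ ⟨τ ω, ⟨ω, rfl⟩, ⟨rfl, h⟩, h1⟩
      · rintro ⟨q, -, ⟨rfl, -⟩, h1⟩; exact h1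
    · simp only [min_eq_right h.le, not_le.2 h, not_false_eq_true, true_and]
      constructor
      · exact Or.inr
      · rintro (⟨q, -, ⟨rfl, h2⟩, h1⟩ | h1)
        · exact absurd h2 (not_le.2 h)
        · exact h1
  rw [h]
  refine (MeasurableSet.biUnion hc fun q _ ↦ ?_).union
    ((measurableSet_coe_le hτ t).compl.inter ((hX t).measurable hB))
  by_cases hq : q ≤ t
  · simp only [hq, and_true]
    exact 𝓕.mono hq _ ((measurableSet_coe_eq hτ q).inter ((hX q).measurable hB))
  · simp [hq]

lemma countable_range_next (n : ℕ) : (Set.range fun ω ↦ next n (τ ω)).Countable :=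
  countable_dyadics.mono (by rintro _ ⟨ω, rfl⟩; exact next_mem_dyadics _ _)

lemma IsCadlag.tendsto_min_next {x : Set.Icc (0 : ℝ) T → ℝ} (hx : IsCadlag x)
    (s t : Set.Icc (0 : ℝ) T) :
    Tendsto (fun n ↦ x (min (next n s) t)) atTop (𝓝 (x (min s t))) := by
  refine Tendsto.comp (hx (min s t)).1 (tendsto_nhdsWithin_iff.2 ⟨?_, ?_⟩)
  · exact ((tendsto_next_ge s).mono_right nhdsWithin_le_nhds).min tendsto_const_nhds
  · exact Eventually.of_forall fun n ↦ min_le_min_right t (le_next s n)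

/-- The dyadic approximations of `τ` from above have countable range, and right-continuity of the
paths carries measurability to the limit. -/
lemma UsualConditions.stronglyMeasurable_sample (h𝓕 : UsualConditions 𝓕 P)
    (hX : StronglyAdapted 𝓕 X) (hXc : IsCadlagProcess X P)
    (hτ : IsStoppingTime 𝓕 (fun ω ↦ (τ ω : WithTop (Set.Icc (0 : ℝ) T))))
    (t : Set.Icc (0 : ℝ) T) :
    StronglyMeasurable[𝓕 t] (fun ω ↦ X (min (τ ω) t) ω) :=
  h𝓕.stronglyMeasurable_of_tendsto (X := fun n ω ↦ X (min (next n (τ ω)) t) ω)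
    (fun n ↦ stronglyMeasurable_sample_of_countable hX (isStoppingTime_next hτ n)
      (countable_range_next n) t)
    (hXc.mono fun ω h ↦ h.tendsto_min_next (τ ω) t)

lemma measurableSet_stoppingTime_iff
    (hτ : IsStoppingTime 𝓕 (fun ω ↦ (τ ω : WithTop (Set.Icc (0 : ℝ) T)))) {s : Set Ω} :
    MeasurableSet[hτ.measurableSpace] s ↔ ∀ t, MeasurableSet[𝓕 t] (s ∩ {ω | τ ω ≤ t}) := by
  rw [hτ.measurableSet]
  simp only [WithTop.coe_le_coe, and_iff_right_iff_imp]
  intro h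
  have h1 := h ⊤
  simp only [le_top, Set.ofPred_true, Set.inter_univ] at h1
  exact le_iSup (fun t ↦ 𝓕 t) ⊤ _ h1

lemma UsualConditions.stronglyMeasurable_stopped (h𝓕 : UsualConditions 𝓕 P)
    (hX : StronglyAdapted 𝓕 X) (hXc : IsCadlagProcess X P)
    (hτ : IsStoppingTime 𝓕 (fun ω ↦ (τ ω : WithTop (Set.Icc (0 : ℝ) T)))) :
    StronglyMeasurable[hτ.measurableSpace] (fun ω ↦ X (τ ω) ω) := by
  suffices h : Measurable[hτ.measurableSpace] (fun ω ↦ X (τ ω) ω) from h.stronglyMeasurable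
  intro B hB
  refine (measurableSet_stoppingTime_iff hτ).2 fun t ↦ ?_
  have h : (fun ω ↦ X (τ ω) ω) ⁻¹' B ∩ {ω | τ ω ≤ t} =
      (fun ω ↦ X (min (τ ω) t) ω) ⁻¹' B ∩ {ω | τ ω ≤ t} := by
    ext ω
    simp only [Set.mem_inter_iff, Set.mem_preimage, Set.mem_ofPred_eq]
    refine and_congr_left fun h ↦ ?_
    rw [min_eq_left h]
  rw [h]
  exact ((h𝓕.stronglyMeasurable_sample hX hXc hτ t).measurable hB).inter
    (measurableSet_coe_le hτ t)

variable [IsProbabilityMeasure P]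

/-- Optional sampling for càdlàg martingales on a compact interval. -/
theorem UsualConditions.sample_ae_eq_condExp (h𝓕 : UsualConditions 𝓕 P)
    (hM : Martingale M 𝓕 P) (hMc : IsCadlagProcess M P)
    (hτ : IsStoppingTime 𝓕 (fun ω ↦ (τ ω : WithTop (Set.Icc (0 : ℝ) T)))) :
    Integrable (fun ω ↦ M (τ ω) ω) P ∧
      (fun ω ↦ M (τ ω) ω) =ᵐ[P] P[M ⊤ | hτ.measurableSpace] := by
  -- Optional sampling holds at the countably valued times `next n τ`, which decrease to `τ`; the
  -- limit is taken along their σ-algebras.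
  refine ae_eq_condExp_of_tendsto hτ.measurableSpace_le
    (G := fun n ↦ (isStoppingTime_next hτ n).measurableSpace)
    (fun n ↦ (isStoppingTime_next hτ n).measurableSpace_le)
    (fun n ↦ hτ.measurableSpace_mono (isStoppingTime_next hτ n)
      fun ω ↦ WithTop.coe_le_coe.2 (le_next _ n)) (hM.integrable ⊤)
    (h𝓕.stronglyMeasurable_stopped hM.1 hMc hτ) ?_
  have h1 : ∀ n, (fun ω ↦ M (next n (τ ω)) ω) =ᵐ[P]
      P[M ⊤ | (isStoppingTime_next hτ n).measurableSpace] := fun n ↦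
    hM.stoppedValue_ae_eq_condExp_of_le_const_of_countable_range (isStoppingTime_next hτ n)
      (n := ⊤) (fun ω ↦ WithTop.coe_le_coe.2 le_top) <| by
        refine ((countable_range_next (τ := τ) n).image
          (fun s ↦ (s : WithTop (Set.Icc (0 : ℝ) T)))).mono ?_
        rintro _ ⟨ω, rfl⟩
        exact ⟨_, ⟨ω, rfl⟩, rfl⟩
  filter_upwards [ae_all_iff.2 h1, hMc] with ω h2 h3
  exact (h3.tendsto_next (τ ω)).congr h2

/-- A stopped càdlàg martingale is a martingale. -/
theorem UsualConditions.martingale_stopped (h𝓕 : UsualConditions 𝓕 P)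
    (hM : Martingale M 𝓕 P) (hMc : IsCadlagProcess M P)
    (hτ : IsStoppingTime 𝓕 (fun ω ↦ (τ ω : WithTop (Set.Icc (0 : ℝ) T)))) :
    Martingale (fun t ω ↦ M (min (τ ω) t) ω) 𝓕 P := by
  have hS := fun t ↦ h𝓕.sample_ae_eq_condExp hM hMc (isStoppingTime_coe_min hτ t)
  refine ⟨h𝓕.stronglyMeasurable_sample hM.1 hMc hτ, fun s t hst ↦ ?_⟩
  refine (ae_eq_condExp_of_forall_setIntegral_eq (𝓕.le s) (hS t).1
    (fun B _ _ ↦ (hS s).1.integrableOn) (fun B hB _ ↦ ?_)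
    (h𝓕.stronglyMeasurable_sample hM.1 hMc hτ s).aestronglyMeasurable).symm
  -- On `τ ≤ s` the two stopped values coincide. The part of `B` off this event belongs to the
  -- σ-algebra of `min τ t`, so both values integrate there like `M ⊤`.
  have hD := measurableSet_coe_le hτ s
  rw [← integral_inter_add_sdiff (𝓕.le _ _ hD) (hS s).1.integrableOn,
    ← integral_inter_add_sdiff (𝓕.le _ _ hD) (hS t).1.integrableOn]
  congr 1
  · refine setIntegral_congr_fun (𝓕.le _ _ (hB.inter hD)) fun ω hω ↦ ?_
    have h1 : τ ω ≤ s := hω.2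
    simp only [min_eq_left h1, min_eq_left (h1.trans hst)]
  · have hBD : MeasurableSet[𝓕 s] (B \ {ω | τ ω ≤ s}) := hB.diff hD
    have h1 : MeasurableSet[(isStoppingTime_coe_min hτ t).measurableSpace]
        (B \ {ω | τ ω ≤ s}) := by
      refine (measurableSet_stoppingTime_iff _).2 fun u ↦ ?_
      rcases lt_or_ge u s with hu | hu
      · have : B \ {ω | τ ω ≤ s} ∩ {ω | min (τ ω) t ≤ u} = ∅ := by
          ext ω
          simp only [Set.mem_inter_iff, Set.mem_sdiff, Set.mem_ofPred_eq, not_le,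
            Set.mem_empty_iff_false, iff_false, not_and, and_imp, lt_min_iff]
          exact fun _ h ↦ ⟨hu.trans h, hu.trans_le hst⟩
        rw [this]
        exact @MeasurableSet.empty _ (𝓕 u)
      · exact (𝓕.mono hu _ hBD).inter (measurableSet_coe_le (isStoppingTime_coe_min hτ t) u)
    calc ∫ ω in B \ {ω | τ ω ≤ s}, M (min (τ ω) s) ω ∂P
        = ∫ ω in B \ {ω | τ ω ≤ s}, M s ω ∂P := by
          refine setIntegral_congr_fun (𝓕.le _ _ hBD) fun ω hω ↦ ?_
          have h2 : s < τ ω := not_le.1 hω.2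
          simp only [min_eq_right h2.le]
      _ = ∫ ω in B \ {ω | τ ω ≤ s}, M ⊤ ω ∂P :=
          hM.setIntegral_eq le_top hBD
      _ = ∫ ω in B \ {ω | τ ω ≤ s},
            P[M ⊤ | (isStoppingTime_coe_min hτ t).measurableSpace] ω ∂P :=
          (setIntegral_condExp _ (hM.integrable _) h1).symm
      _ = ∫ ω in B \ {ω | τ ω ≤ s}, M (min (τ ω) t) ω ∂P :=
          integral_congr_ae (ae_restrict_of_ae (hS t).2.symm)

end OptionalSampling

/-! ### First times along the dyadics. -/

section Debut

variable {Ω : Type*} {mΩ : MeasurableSpace Ω} {P : Measure Ω} {T : ℝ} [hT : Fact (0 ≤ T)]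
  {𝓕 : Filtration (Set.Icc (0 : ℝ) T) mΩ} {B : Set.Icc (0 : ℝ) T → Set Ω}

/-- The first time at which the family of events `B` occurs along the dyadics, or `T` if it does
not occur. -/
def debut (B : Set.Icc (0 : ℝ) T → Set Ω) (ω : Ω) : Set.Icc (0 : ℝ) T :=
  sInf {q | q ∈ dyadics T ∧ ω ∈ B q}

open scoped Classical in
/-- The first time at which the family of events `B` occurs along the dyadics, or `∞` if it does
not occur. -/
def debutTop (B : Set.Icc (0 : ℝ) T → Set Ω) (ω : Ω) : WithTop (Set.Icc (0 : ℝ) T) :=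
  if ∃ q ∈ dyadics T, ω ∈ B q then (debut B ω : WithTop (Set.Icc (0 : ℝ) T)) else ⊤

lemma debut_lt_iff {ω : Ω} {t : Set.Icc (0 : ℝ) T} :
    debut B ω < t ↔ ∃ q ∈ dyadics T, ω ∈ B q ∧ q < t := by
  refine sInf_lt_iff.trans ?_
  simp only [Set.mem_ofPred_eq, and_assoc]

lemma debut_eq_top {ω : Ω} (h : ∀ q ∈ dyadics T, ω ∉ B q) : debut B ω = ⊤ := by
  by_contra hne
  obtain ⟨q, hq, hq', -⟩ := debut_lt_iff.1 (lt_top_iff_ne_top.2 hne)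
  exact h q hq hq'

lemma debut_mono {B' : Set.Icc (0 : ℝ) T → Set Ω} (h : ∀ q, B' q ⊆ B q) (ω : Ω) :
    debut B ω ≤ debut B' ω :=
  sInf_le_sInf fun _ hq ↦ ⟨hq.1, h _ hq.2⟩

lemma debutTop_mono {B' : Set.Icc (0 : ℝ) T → Set Ω} (h : ∀ q, B' q ⊆ B q) (ω : Ω) :
    debutTop B ω ≤ debutTop B' ω := by
  by_cases h1 : ∃ q ∈ dyadics T, ω ∈ B' q
  · have h2 : ∃ q ∈ dyadics T, ω ∈ B q := by
      obtain ⟨q, hq, hq'⟩ := h1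
      exact ⟨q, hq, h q hq'⟩
    rw [debutTop, debutTop, if_pos h1, if_pos h2]
    exact WithTop.coe_le_coe.2 (debut_mono h ω)
  · rw [debutTop, debutTop, if_neg h1]
    exact le_top

lemma debutTop_eq_top {ω : Ω} (h : ∀ q ∈ dyadics T, ω ∉ B q) : debutTop B ω = ⊤ := by
  rw [debutTop, if_neg]
  rintro ⟨q, hq, hq'⟩
  exact h q hq hq'

/-- Stopping at `T` and at `∞` have the same effect. The finite version suits optional sampling,
while localization needs a sequence that reaches `∞`. -/
lemma stoppedProcess_debutTop (X : Set.Icc (0 : ℝ) T → Ω → ℝ) (t : Set.Icc (0 : ℝ) T) (ω : Ω) :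
    stoppedProcess X (debutTop B) t ω = X (min (debut B ω) t) ω := by
  rw [stoppedProcess]
  by_cases h : ∃ q ∈ dyadics T, ω ∈ B q
  · rw [debutTop, if_pos h, ← WithTop.coe_min, min_comm]
    rfl
  · rw [debutTop, if_neg h, debut_eq_top fun q hq hq' ↦ h ⟨q, hq, hq'⟩]
    simp

lemma measurableSet_debut_lt (hB : ∀ q ∈ dyadics T, MeasurableSet[𝓕 q] (B q))
    (t : Set.Icc (0 : ℝ) T) : MeasurableSet[𝓕 t] {ω | debut B ω < t} := by
  have h : {ω | debut B ω < t} = ⋃ q ∈ {q | q ∈ dyadics T ∧ q < t}, B q := by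
    ext ω
    simp only [Set.mem_ofPred_eq, debut_lt_iff, Set.mem_iUnion, exists_prop, and_assoc]
    exact exists_congr fun q ↦ and_congr_right fun _ ↦ and_comm
  rw [h]
  exact MeasurableSet.biUnion (countable_dyadics.mono fun q hq ↦ hq.1) fun q hq ↦
    𝓕.mono hq.2.le _ (hB q hq.1)

/-- Strict inequalities are countable unions over dyadics, and the non-strict one follows by
right-continuity of the filtration. No general début theorem is required. -/
lemma UsualConditions.measurableSet_debut_le (h𝓕 : UsualConditions 𝓕 P)
    (hB : ∀ q ∈ dyadics T, MeasurableSet[𝓕 q] (B q)) {t : Set.Icc (0 : ℝ) T} (ht : t < ⊤) :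
    MeasurableSet[𝓕 t] {ω | debut B ω ≤ t} := by
  refine h𝓕.measurableSet_of_forall_gt ht fun j hj ↦ ?_
  have h : {ω | debut B ω ≤ t} = ⋂ n, {ω | debut B ω < min j (next n t)} := by
    ext ω
    simp only [Set.mem_ofPred_eq, Set.mem_iInter, lt_min_iff]
    refine ⟨fun h n ↦ ⟨h.trans_lt hj, h.trans_lt (lt_next ht n)⟩, fun h ↦ ?_⟩
    exact ge_of_tendsto ((tendsto_next_ge t).mono_right nhdsWithin_le_nhds)
      (Eventually.of_forall fun n ↦ (h n).2.le)
  rw [h]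
  exact MeasurableSet.iInter fun n ↦ 𝓕.mono (min_le_left _ _) _ (measurableSet_debut_lt hB _)

lemma UsualConditions.isStoppingTime_debut (h𝓕 : UsualConditions 𝓕 P)
    (hB : ∀ q ∈ dyadics T, MeasurableSet[𝓕 q] (B q)) :
    IsStoppingTime 𝓕 (fun ω ↦ (debut B ω : WithTop (Set.Icc (0 : ℝ) T))) := by
  refine isStoppingTime_coe_iff.2 fun t ↦ ?_
  rcases lt_or_eq_of_le (le_top : t ≤ ⊤) with ht | rfl
  · exact h𝓕.measurableSet_debut_le hB ht
  · simp

lemma UsualConditions.isStoppingTime_debutTop (h𝓕 : UsualConditions 𝓕 P)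
    (hB : ∀ q ∈ dyadics T, MeasurableSet[𝓕 q] (B q)) : IsStoppingTime 𝓕 (debutTop B) := by
  intro t
  rcases lt_or_eq_of_le (le_top : t ≤ ⊤) with ht | rfl
  · have h : {ω | debutTop B ω ≤ t} = {ω | debut B ω ≤ t} := by
      ext ω
      by_cases h : ∃ q ∈ dyadics T, ω ∈ B q
      · simp [debutTop, if_pos h]
      · simp [debutTop, if_neg h, debut_eq_top fun q hq hq' ↦ h ⟨q, hq, hq'⟩, ht.ne]
    rw [h]
    exact h𝓕.measurableSet_debut_le hB ht
  · have h : {ω | debutTop B ω ≤ ((⊤ : Set.Icc (0 : ℝ) T) : WithTop _)} =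
        ⋃ q ∈ dyadics T, B q := by
      ext ω
      simp only [Set.mem_ofPred_eq, Set.mem_iUnion, exists_prop]
      by_cases h : ∃ q ∈ dyadics T, ω ∈ B q
      · simp [debutTop, h]
      · simp [debutTop, h]
    rw [h]
    exact MeasurableSet.biUnion countable_dyadics fun q hq ↦ 𝓕.mono le_top _ (hB q hq)

end Debut

/-! ### Pasting approximate decompositions. -/

section Gluing

variable {T : ℝ} [hT : Fact (0 ≤ T)]

lemma IsCadlag.stopped {x : Set.Icc (0 : ℝ) T → ℝ} (hx : IsCadlag x) (s : Set.Icc (0 : ℝ) T) :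
    IsCadlag (fun t ↦ x (min s t)) := by
  intro t
  constructor
  · refine Tendsto.comp (hx (min s t)).1 (tendsto_nhdsWithin_iff.2 ⟨?_, ?_⟩)
    · exact (tendsto_const_nhds.min tendsto_id).mono_left nhdsWithin_le_nhds
    · filter_upwards [self_mem_nhdsWithin] with u hu using min_le_min_left s hu
  · rcases lt_or_ge s t with h | h
    · refine ⟨x s, tendsto_const_nhds.congr' ?_⟩
      filter_upwards [Ioo_mem_nhdsLT h] with u hu
      rw [min_eq_left hu.1.le]
    · obtain ⟨l, hl⟩ := (hx t).2
      refine ⟨l, hl.congr' ?_⟩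
      filter_upwards [self_mem_nhdsWithin] with u hu
      rw [min_eq_right ((le_of_lt hu).trans h)]

/-- The stopped path is `h` plus the indicator of `[s, T]` times `g s - h`. Stopping a path that has
finite variation strictly before `s` adds only its jump at `s`. -/
lemma boundedVariationOn_stopped {g h : Set.Icc (0 : ℝ) T → ℝ}
    (hh : BoundedVariationOn h Set.univ) {s : Set.Icc (0 : ℝ) T} (hgh : ∀ t < s, g t = h t) :
    BoundedVariationOn (fun t ↦ g (min s t)) Set.univ := by
  classical
  have h1 : BoundedVariationOn (fun t : Set.Icc (0 : ℝ) T ↦ if s ≤ t then (1 : ℝ) else 0)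
      Set.univ := by
    refine monotone_boundedVariationOn_univ fun a b hab ↦ ?_
    by_cases ha : s ≤ a
    · simp [ha, ha.trans hab]
    · simp only [ha, if_false]
      split_ifs <;> norm_num
  have h2 := boundedVariationOn_add hh
    (h1.mul (boundedVariationOn_sub (boundedVariationOn_const (g s)) hh))
  refine (congrArg (fun f ↦ BoundedVariationOn f Set.univ) (funext fun t ↦ ?_)).mp h2
  rcases le_or_gt s t with hst | hst
  · simp [hst]
  · simp [not_le.2 hst, min_eq_right hst.le, hgh t hst]

variable {Ω : Type*} {mΩ : MeasurableSpace Ω} {P : Measure Ω} [IsProbabilityMeasure P]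
  {𝓕 : Filtration (Set.Icc (0 : ℝ) T) mΩ} {S : Set.Icc (0 : ℝ) T → Ω → ℝ}

lemma UsualConditions.martingale_congr (h𝓕 : UsualConditions 𝓕 P)
    {X Y : Set.Icc (0 : ℝ) T → Ω → ℝ} (hX : Martingale X 𝓕 P) (hXY : ∀ t, X t =ᵐ[P] Y t) :
    Martingale Y 𝓕 P :=
  ⟨fun t ↦ h𝓕.stronglyMeasurable_congr (hX.1 t) (hXY t), fun s t hst ↦
    (condExp_congr_ae (hXY t)).symm.trans ((hX.2 s t hst).trans (hXY s))⟩

lemma martingale_indicator {X : Set.Icc (0 : ℝ) T → Ω → ℝ} (hX : Martingale X 𝓕 P) {s : Set Ω}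
    (hs : MeasurableSet[𝓕 ⊥] s) : Martingale (fun t ↦ s.indicator (X t)) 𝓕 P := by
  refine ⟨fun t ↦ (hX.1 t).indicator (𝓕.mono bot_le _ hs), fun t u htu ↦ ?_⟩
  refine (condExp_indicator (hX.integrable u) (𝓕.mono bot_le _ hs)).trans ?_
  filter_upwards [hX.2 t u htu] with ω hω
  by_cases h : ω ∈ s <;> simp [h, hω]

lemma martingale_fun_sum {ι : Type*} (s : Finset ι) {X : ι → Set.Icc (0 : ℝ) T → Ω → ℝ}
    (hX : ∀ i ∈ s, Martingale (X i) 𝓕 P) : Martingale (fun t ω ↦ ∑ i ∈ s, X i t ω) 𝓕 P := by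
  classical
  induction s using Finset.induction_on with
  | empty =>
    simp only [Finset.sum_empty]
    exact martingale_zero ℝ 𝓕 P
  | insert a s ha ih =>
    simp_rw [Finset.sum_insert ha]
    exact (hX a (Finset.mem_insert_self a s)).add
      (ih fun i hi ↦ hX i (Finset.mem_insert_of_mem hi))

/-- The local martingales obtained by pasting the martingales `M n` along the times `s n`. -/
def paste (M : ℕ → Set.Icc (0 : ℝ) T → Ω → ℝ) (s : ℕ → Ω → Set.Icc (0 : ℝ) T) (n : ℕ)
    (t : Set.Icc (0 : ℝ) T) (ω : Ω) : ℝ :=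
  M n (min (s n ω) t) ω -
    ∑ m ∈ Finset.range n, (M (m + 1) (min (s m ω) t) ω - M m (min (s m ω) t) ω)

/-- Up to time `s n`, the last correction term exactly turns `M (n + 1)` back into `M n`. The pasted
martingales are thus consistent and define one process. -/
lemma paste_stopped (M : ℕ → Set.Icc (0 : ℝ) T → Ω → ℝ) {s : ℕ → Ω → Set.Icc (0 : ℝ) T} {ω : Ω}
    (hs : Monotone fun n ↦ s n ω) {m n : ℕ} (hmn : m ≤ n) (t : Set.Icc (0 : ℝ) T) :
    paste M s n (min (s m ω) t) ω = paste M s m t ω := by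
  have h : ∀ k l, k ≤ l → ∀ u, min (s k ω) (min (s l ω) u) = min (s k ω) u := fun k l hkl u ↦ by
    rw [← min_assoc, min_eq_left (hs hkl)]
  induction n, hmn using Nat.le_induction generalizing t with
  | base =>
    rw [paste, paste, h m m le_rfl]
    congr 1
    refine Finset.sum_congr rfl fun k hk ↦ ?_
    rw [h k m (Finset.mem_range.1 hk).le]
  | succ n hmn ih =>
    have h1 : ∀ u, paste M s (n + 1) (min (s n ω) u) ω = paste M s n u ω := fun u ↦ by
      have h2 : min (s (n + 1) ω) (min (s n ω) u) = min (s n ω) u :=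
        min_eq_right ((min_le_left _ _).trans (hs (Nat.le_succ n)))
      rw [paste, paste, Finset.sum_range_succ, h n n le_rfl, h2]
      have h3 : ∀ k ∈ Finset.range n, M (k + 1) (min (s k ω) (min (s n ω) u)) ω -
          M k (min (s k ω) (min (s n ω) u)) ω =
          M (k + 1) (min (s k ω) u) ω - M k (min (s k ω) u) ω := fun k hk ↦ by
        rw [h k n (Finset.mem_range.1 hk).le]
      rw [Finset.sum_congr rfl h3]
      ring
    rw [← ih t, ← h1 (min (s m ω) t)]
    congr 1
    rw [← min_assoc, min_eq_right (hs hmn)]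

/-- A process which coincides with sums of martingales and processes of finite variation outside
events of arbitrarily small probability is a semimartingale. -/
theorem isSemimartingale_of_approximate_decomposition (h𝓕 : UsualConditions 𝓕 P)
    (hS : StronglyAdapted 𝓕 S) (hc : IsCadlagProcess S P)
    (h : ∀ ε : ℝ≥0∞, 0 < ε → ∃ M A : Set.Icc (0 : ℝ) T → Ω → ℝ, Martingale M 𝓕 P ∧
      IsCadlagProcess M P ∧ IsFiniteVariationProcess A 𝓕 P ∧
      P {ω | ¬ ∀ t, S t ω = M t ω + A t ω} ≤ ε) :
    IsSemimartingale S 𝓕 P := by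
  -- Summable probabilities for Borel–Cantelli: almost surely all but finitely many decompositions
  -- are exact on the whole path.
  choose M A hM hMc hA hMA using fun n : ℕ ↦ h ((2 : ℝ≥0∞)⁻¹ ^ n) (ENNReal.pow_pos (by simp) n)
  -- Failure of any decomposition with index at least `n`: the times `s n` then increase, and all
  -- later decompositions are valid before `s n`.
  set B : ℕ → Set.Icc (0 : ℝ) T → Set Ω := fun n q ↦
    ⋃ k : ℕ, ⋃ (_ : n ≤ k), {ω | S q ω - (M k q ω + A k q ω) = 0}ᶜ with hB
  have hBm : ∀ n, ∀ q ∈ dyadics T, MeasurableSet[𝓕 q] (B n q) := fun n q _ ↦ by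
    refine MeasurableSet.iUnion fun k ↦ MeasurableSet.iUnion fun _ ↦ MeasurableSet.compl ?_
    have h1 : StronglyMeasurable[𝓕 q] (fun ω ↦ S q ω - (M k q ω + A k q ω)) :=
      (hS q).sub (((hM k).1 q).add ((hA k).adapted q))
    exact h1.measurable (measurableSet_singleton 0)
  have hBanti : ∀ {n m}, n ≤ m → ∀ q, B m q ⊆ B n q := fun hnm q ↦
    Set.iUnion_subset fun k ↦ Set.iUnion_subset fun hk ↦
      Set.subset_iUnion₂_of_subset k (hnm.trans hk) subset_rfl
  set s : ℕ → Ω → Set.Icc (0 : ℝ) T := fun n ↦ debut (B n) with hs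
  have hsm : ∀ ω, Monotone fun n ↦ s n ω := fun ω n m hnm ↦ debut_mono (hBanti hnm) ω
  have hsst : ∀ n, IsStoppingTime 𝓕 (fun ω ↦ (s n ω : WithTop (Set.Icc (0 : ℝ) T))) := fun n ↦
    h𝓕.isStoppingTime_debut (hBm n)
  have hgood : ∀ᵐ ω ∂P, ∃ n₀, ∀ k ≥ n₀, ∀ t, S t ω = M k t ω + A k t ω := by
    have h1 := ae_eventually_notMem (μ := P)
      (s := fun n ↦ {ω | ¬ ∀ t, S t ω = M n t ω + A n t ω})
      (ne_top_of_le_ne_top (by rw [ENNReal.tsum_geometric]; simp) (ENNReal.tsum_le_tsum hMA))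
    filter_upwards [h1] with ω hω
    obtain ⟨n₀, hn₀⟩ := eventually_atTop.1 hω
    exact ⟨n₀, fun k hk ↦ not_not.1 (hn₀ k hk)⟩
  have hempty : ∀ {ω n₀}, (∀ k ≥ n₀, ∀ t, S t ω = M k t ω + A k t ω) → ∀ n ≥ n₀,
      ∀ q ∈ dyadics T, ω ∉ B n q := fun {ω n₀} h1 n hn q _ h2 ↦ by
    simp only [hB, Set.mem_iUnion, Set.mem_compl_iff, Set.mem_ofPred_eq] at h2
    obtain ⟨k, hk, h3⟩ := h2
    exact h3 (by rw [h1 k (hn.trans hk) q, sub_self])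
  set L := paste M s with hL
  have hLM : ∀ n, Martingale (L n) 𝓕 P := fun n ↦
    (h𝓕.martingale_stopped (hM n) (hMc n) (hsst n)).sub
      (martingale_fun_sum _ fun m _ ↦
        (h𝓕.martingale_stopped (hM (m + 1)) (hMc (m + 1)) (hsst m)).sub
          (h𝓕.martingale_stopped (hM m) (hMc m) (hsst m)))
  set N : Set.Icc (0 : ℝ) T → Ω → ℝ := fun t ω ↦ limUnder atTop (fun n ↦ L n t ω) with hN
  have hLconst : ∀ {ω n₀}, (∀ k ≥ n₀, ∀ t, S t ω = M k t ω + A k t ω) →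
      ∀ n ≥ n₀, ∀ t, L n t ω = L n₀ t ω := fun {ω n₀} h1 n hn t ↦ by
    have h2 := paste_stopped M (hsm ω) hn t
    rwa [show s n₀ ω = ⊤ from debut_eq_top (hempty h1 n₀ le_rfl), min_eq_right le_top] at h2
  have hLlim : ∀ {ω n₀}, (∀ k ≥ n₀, ∀ t, S t ω = M k t ω + A k t ω) →
      ∀ t, Tendsto (fun n ↦ L n t ω) atTop (𝓝 (L n₀ t ω)) := fun {ω n₀} h1 t ↦
    tendsto_const_nhds.congr' (eventually_atTop.2 ⟨n₀, fun n hn ↦ (hLconst h1 n hn t).symm⟩)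
  have hNL : ∀ {ω n₀}, (∀ k ≥ n₀, ∀ t, S t ω = M k t ω + A k t ω) →
      ∀ t, N t ω = L n₀ t ω := fun h1 t ↦ (hLlim h1 t).limUnder_eq
  have hNad : StronglyAdapted 𝓕 N := fun t ↦
    h𝓕.stronglyMeasurable_of_tendsto (fun n ↦ (hLM n).1 t) <| by
      filter_upwards [hgood] with ω ⟨n₀, h1⟩
      rw [hNL h1]
      exact hLlim h1 t
  have hMc' : ∀ᵐ ω ∂P, ∀ k, IsCadlag (fun t ↦ M k t ω) := ae_all_iff.2 hMc
  have hNc : IsCadlagProcess N P := by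
    filter_upwards [hgood, hMc'] with ω ⟨n₀, h1⟩ h2
    have h3 : (fun t ↦ N t ω) = fun t ↦ L n₀ t ω := funext fun t ↦ hNL h1 t
    rw [h3]
    exact ((h2 n₀).stopped _).sub (isCadlag_sum _ fun m _ ↦
      ((h2 (m + 1)).stopped _).sub ((h2 m).stopped _))
  refine ⟨N, fun t ω ↦ S t ω - N t ω, ⟨hNad, hNc, fun n ↦ debutTop (B n), ⟨⟨fun n ↦
    h𝓕.isStoppingTime_debutTop (hBm n), ?_⟩, ?_⟩, fun n ↦ ?_⟩, ⟨fun t ↦ (hS t).sub (hNad t), ?_, ?_⟩,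
    ae_of_all _ fun ω t ↦ by ring⟩
  · filter_upwards [hgood] with ω ⟨n₀, h1⟩
    exact tendsto_const_nhds.congr' (eventually_atTop.2
      ⟨n₀, fun n hn ↦ (debutTop_eq_top (hempty h1 n hn)).symm⟩)
  · exact ae_of_all _ fun ω n m hnm ↦ debutTop_mono (hBanti hnm) ω
  · have h1 : MeasurableSet[𝓕 ⊥] {ω | ⊥ < debutTop (B n) ω} := by
      have h2 := (h𝓕.isStoppingTime_debutTop (hBm n)).measurableSet_gt ⊥
      exact h2
    refine h𝓕.martingale_congr (martingale_indicator (hLM n) h1) fun t ↦ ?_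
    filter_upwards [hgood] with ω ⟨n₀, h2⟩
    have h3 : N (min (s n ω) t) ω = L n t ω := by
      have h4 : ∀ k ≥ max n n₀, ∀ t, S t ω = M k t ω + A k t ω := fun k hk ↦
        h2 k ((le_max_right _ _).trans hk)
      rw [hNL h4]
      exact paste_stopped M (hsm ω) (le_max_left _ _) t
    rw [stoppedProcess_debutTop]
    by_cases h5 : ⊥ < debutTop (B n) ω
    · rw [Set.indicator_of_mem (s := {ω | ⊥ < debutTop (B n) ω}) h5,
        Set.indicator_of_mem (s := {ω | ⊥ < debutTop (B n) ω}) h5]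
      exact h3.symm
    · rw [Set.indicator_of_notMem (s := {ω | ⊥ < debutTop (B n) ω}) h5,
        Set.indicator_of_notMem (s := {ω | ⊥ < debutTop (B n) ω}) h5]
  · filter_upwards [hc, hNc] with ω h1 h2 using h1.sub h2
  · have hAc : ∀ᵐ ω ∂P, ∀ k, IsCadlag (fun t ↦ A k t ω) := ae_all_iff.2 fun k ↦ (hA k).cadlag
    have hAv : ∀ᵐ ω ∂P, ∀ k, BoundedVariationOn (fun t ↦ A k t ω) Set.univ :=
      ae_all_iff.2 fun k ↦ (hA k).finiteVariation
    filter_upwards [hgood, hc, hMc', hAc, hAv] with ω ⟨n₀, h1⟩ h2 h3 h4 h5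
    -- There is no failure at dyadic times before `s m`; right-continuity extends this to all
    -- earlier times.
    have h6 : ∀ m, ∀ k ≥ m, ∀ t < s m ω, S t ω - (M k t ω + A k t ω) = 0 := fun m k hk t ht ↦ by
      have h7 := (h2.sub ((h3 k).add (h4 k))).tendsto_next t
      refine tendsto_nhds_unique h7 (tendsto_const_nhds.congr' ?_)
      have h8 := ((tendsto_next_ge t).mono_right nhdsWithin_le_nhds).eventually
        (eventually_lt_nhds ht)
      filter_upwards [h8] with n hn
      by_contra h9
      refine absurd hn (not_lt.2 (sInf_le ⟨next_mem_dyadics n t, ?_⟩))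
      simp only [hB, Set.mem_iUnion, Set.mem_compl_iff, Set.mem_ofPred_eq]
      exact ⟨k, hk, fun h10 ↦ h9 h10.symm⟩
    have h7 : (fun t ↦ S t ω - N t ω) = fun t ↦ A n₀ t ω + ∑ m ∈ Finset.range n₀,
        (M (m + 1) (min (s m ω) t) ω - M m (min (s m ω) t) ω) := by
      ext t
      rw [hNL h1, h1 n₀ le_rfl, hL, paste,
        show s n₀ ω = ⊤ from debut_eq_top (hempty h1 n₀ le_rfl), min_eq_right le_top]
      ring
    rw [h7]
    refine boundedVariationOn_add (h5 n₀) (boundedVariationOn_sum _ fun m _ ↦ ?_)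
    -- Before `s m` both decompositions hold, so `M (m + 1) - M m = A m - A (m + 1)` has finite
    -- variation there. This makes the pasting corrections harmless.
    refine boundedVariationOn_stopped (g := fun t ↦ M (m + 1) t ω - M m t ω)
      (boundedVariationOn_sub (h5 m) (h5 (m + 1))) fun t ht ↦ ?_
    linarith [h6 m m le_rfl t ht, h6 m (m + 1) (Nat.le_succ m) t ht]

end Gluing

/-! ### Gains of martingale transforms with small losses. -/

section GainBound

variable {Ω : Type*} {mΩ : MeasurableSpace Ω} {P : Measure Ω} [IsProbabilityMeasure P]
  {G : Filtration ℕ mΩ} {X h : ℕ → Ω → ℝ}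

lemma integral_mul_martingale_increment (hX : Martingale X G P) {i : ℕ} {g : Ω → ℝ}
    (hg : StronglyMeasurable[G i] g) {C : ℝ} (hb : ∀ᵐ ω ∂P, |g ω| ≤ C) :
    Integrable (fun ω ↦ g ω * (X (i + 1) ω - X i ω)) P ∧
      ∫ ω, g ω * (X (i + 1) ω - X i ω) ∂P = 0 := by
  have hD : Integrable (fun ω ↦ X (i + 1) ω - X i ω) P := (hX.integrable _).sub (hX.integrable _)
  have h1 : Integrable (fun ω ↦ g ω * (X (i + 1) ω - X i ω)) P :=
    hD.bdd_mul (hg.mono (G.le i)).aestronglyMeasurable hb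
  refine ⟨h1, ?_⟩
  have h2 := condExp_mul_of_stronglyMeasurable_left (μ := P) hg
    (g := fun ω ↦ X (i + 1) ω - X i ω) h1 hD
  have h3 : P[fun ω ↦ X (i + 1) ω - X i ω | G i] =ᵐ[P] P[X (i + 1) | G i] - P[X i | G i] :=
    condExp_sub (hX.integrable _) (hX.integrable _) _
  change ∫ ω, (g * fun ω ↦ X (i + 1) ω - X i ω) ω ∂P = 0
  rw [← integral_condExp (G.le i) (f := g * fun ω ↦ X (i + 1) ω - X i ω),
    integral_congr_ae (g := fun _ ↦ (0 : ℝ)), integral_zero]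
  filter_upwards [h2, h3, hX.2 i (i + 1) (Nat.le_succ i), hX.2 i i le_rfl] with ω h2 h3 h4 h5
  rw [h2, Pi.mul_apply, h3, Pi.sub_apply, h4, h5, sub_self, mul_zero]

/-- A martingale transform which loses little rarely gains much. -/
theorem measure_gain_le (hX : Martingale X G P) (hh : ∀ i, StronglyMeasurable[G i] (h i))
    (hb : ∀ i, ∃ C, ∀ᵐ ω ∂P, |h i ω| ≤ C) {c δ K η : ℝ} (hc : 0 ≤ c) (hδ : 0 ≤ δ) (hK : 0 ≤ K)
    (hη : 0 < η) (n : ℕ)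
    (hcX : ∀ᵐ ω ∂P, ∀ i < n, |h i ω * (X (i + 1) ω - X i ω)| ≤ c * |X (i + 1) ω - X i ω|) :
    P {ω | η ≤ partialSum (fun i ω ↦ h i ω * (X (i + 1) ω - X i ω)) n ω ∧ ∀ j ≤ n,
        -δ ≤ partialSum (fun i ω ↦ h i ω * (X (i + 1) ω - X i ω)) j ω ∧ |X j ω| ≤ K}
      ≤ ENNReal.ofReal ((δ + c * (K + ∫ ω, |X n ω| ∂P)) / η) := by
  classical
  set x := partialSum (fun i ω ↦ h i ω * (X (i + 1) ω - X i ω)) with hx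
  have hxm : ∀ j, StronglyMeasurable[G j] (x j) := fun j ↦
    Finset.stronglyMeasurable_fun_sum _ fun i hi ↦ by
      have hi' : i < j := Finset.mem_range.1 hi
      exact ((hh i).mono (G.mono hi'.le)).mul
        (((hX.1 (i + 1)).mono (G.mono hi')).sub ((hX.1 i).mono (G.mono hi'.le)))
  -- The transform `y` is stopped on leaving these sets; it has mean zero and equals `x` on the
  -- event to be estimated.
  let alive : ℕ → Set Ω := fun j ↦ {ω | ∀ i ≤ j, -δ ≤ x i ω ∧ |X i ω| ≤ K}
  have halive : ∀ j, MeasurableSet[G j] (alive j) := fun j ↦ by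
    have h1 : alive j = ⋂ i, ⋂ (_ : i ≤ j), {ω | -δ ≤ x i ω} ∩ {ω | |X i ω| ≤ K} := by
      ext ω; simp [alive]
    rw [h1]
    refine MeasurableSet.iInter fun i ↦ MeasurableSet.iInter fun hi ↦ ?_
    have h2 := (hxm i).mono (G.mono hi)
    have h3 := ((hX.1 i).mono (G.mono hi)).norm
    exact (h2.measurable measurableSet_Ici).inter (h3.measurable measurableSet_Iic)
  have hanti : ∀ j, alive (j + 1) ⊆ alive j := fun j ω hω i hi ↦ hω i (hi.trans (Nat.le_succ j))
  let y : ℕ → Ω → ℝ := partialSum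
    (fun i ω ↦ (alive i).indicator (h i) ω * (X (i + 1) ω - X i ω))
  -- `R` records `|X|` at the exit, where the last step can overshoot the loss bound `δ` by at most
  -- `c * (K + R)`.
  let R : ℕ → Ω → ℝ := partialSum (fun i ↦ (alive i \ alive (i + 1)).indicator fun ω ↦ |X (i + 1) ω|)
  have hterm : ∀ i, Integrable (fun ω ↦ (alive i).indicator (h i) ω * (X (i + 1) ω - X i ω)) P ∧
      ∫ ω, (alive i).indicator (h i) ω * (X (i + 1) ω - X i ω) ∂P = 0 := fun i ↦ by
    obtain ⟨C, hC⟩ := hb i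
    refine integral_mul_martingale_increment hX ((hh i).indicator (halive i)) (C := C) ?_
    filter_upwards [hC] with ω hω
    exact (norm_indicator_le_norm_self (h i) ω).trans hω
  have hyi : Integrable (y n) P := integrable_finsetSum _ fun i _ ↦ (hterm i).1
  have hy0 : ∫ ω, y n ω ∂P = 0 := by
    simp only [y, partialSum]
    rw [integral_finsetSum _ fun i _ ↦ (hterm i).1]
    exact Finset.sum_eq_zero fun i _ ↦ (hterm i).2
  have hDm : ∀ i, MeasurableSet[G (i + 1)] (alive i \ alive (i + 1)) := fun i ↦
    (G.mono (Nat.le_succ i) _ (halive i)).diff (halive (i + 1))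
  have hDi : ∀ i j, Integrable ((alive i \ alive (i + 1)).indicator fun ω ↦ |X j ω|) P := fun i j ↦
    ((hX.integrable j).abs).indicator (G.le _ _ (hDm i))
  have hRi : Integrable (R n) P := integrable_finsetSum _ fun i _ ↦ hDi i (i + 1)
  have hRle : ∫ ω, R n ω ∂P ≤ ∫ ω, |X n ω| ∂P := by
    calc ∫ ω, R n ω ∂P
        = ∑ i ∈ Finset.range n, ∫ ω, (alive i \ alive (i + 1)).indicator
            (fun ω ↦ |X (i + 1) ω|) ω ∂P := integral_finsetSum _ fun i _ ↦ hDi i (i + 1)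
      _ ≤ ∑ i ∈ Finset.range n, ∫ ω, (alive i \ alive (i + 1)).indicator
            (fun ω ↦ |X n ω|) ω ∂P := by
          -- On each of the disjoint exit events, `|X (i + 1)|` integrates to at most `|X n|` by the
          -- submartingale property.
          refine Finset.sum_le_sum fun i hi ↦ ?_
          rw [integral_indicator (G.le _ _ (hDm i)), integral_indicator (G.le _ _ (hDm i))]
          refine le_trans (le_of_eq ?_) (setIntegral_abs_condExp_le (hDm i) (X n))
          refine setIntegral_congr_ae (G.le _ _ (hDm i)) ?_
          filter_upwards [hX.2 (i + 1) n (Finset.mem_range.1 hi)] with ω hω _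
          rw [hω]
      _ = ∫ ω, ∑ i ∈ Finset.range n, (alive i \ alive (i + 1)).indicator
            (fun ω ↦ |X n ω|) ω ∂P := (integral_finsetSum _ fun i _ ↦ hDi i n).symm
      _ ≤ ∫ ω, |X n ω| ∂P := by
          refine integral_mono (integrable_finsetSum _ fun i _ ↦ hDi i n) (hX.integrable n).abs
            fun ω ↦ ?_
          have h1 : ∀ i, (alive i \ alive (i + 1)).indicator (fun ω ↦ |X n ω|) ω =
              (alive i).indicator (fun ω ↦ |X n ω|) ω -
                (alive (i + 1)).indicator (fun ω ↦ |X n ω|) ω := fun i ↦ by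
            rw [Set.indicator_sdiff (hanti i), Pi.sub_apply]
          simp only [h1]
          rw [Finset.sum_range_sub' fun i ↦ (alive i).indicator (fun ω ↦ |X n ω|) ω]
          have h2 : (alive 0).indicator (fun ω ↦ |X n ω|) ω ≤ |X n ω| :=
            Set.indicator_le_self' (fun _ _ ↦ abs_nonneg _) ω
          have h3 : 0 ≤ (alive n).indicator (fun ω ↦ |X n ω|) ω :=
            Set.indicator_nonneg (fun _ _ ↦ abs_nonneg _) ω
          linarith
  have hR0 : ∀ j ω, 0 ≤ R j ω := fun j ω ↦
    Finset.sum_nonneg fun i _ ↦ Set.indicator_nonneg (fun _ _ ↦ abs_nonneg _) ω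
  have hpath : ∀ᵐ ω ∂P, ∀ j ≤ n, (ω ∈ alive j → y j ω = x j ω) ∧
      (ω ∉ alive j → -δ - c * (K + R j ω) ≤ y j ω) := by
    filter_upwards [hcX] with ω hω j
    induction j with
    | zero =>
      intro _
      have := hR0 0 ω
      refine ⟨fun _ ↦ by simp [y, hx, partialSum], fun _ ↦ ?_⟩
      have h1 : y 0 ω = 0 := by simp [y, partialSum]
      rw [h1]
      have : 0 ≤ c * (K + R 0 ω) := by positivity
      linarith
    | succ j ih =>
      intro hj
      obtain ⟨h1, h2⟩ := ih (Nat.le_of_succ_le hj)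
      have hys : y (j + 1) ω = y j ω + (alive j).indicator (h j) ω * (X (j + 1) ω - X j ω) :=
        partialSum_succ _ _ _
      have hRs : R (j + 1) ω = R j ω + (alive j \ alive (j + 1)).indicator
        (fun ω ↦ |X (j + 1) ω|) ω := partialSum_succ _ _ _
      have hxs : x (j + 1) ω = x j ω + h j ω * (X (j + 1) ω - X j ω) := partialSum_succ _ _ _
      refine ⟨fun h3 ↦ ?_, fun h3 ↦ ?_⟩
      · rw [hys, h1 (hanti j h3), hxs, Set.indicator_of_mem (hanti j h3)]
      · by_cases h4 : ω ∈ alive j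
        · have h5 : ω ∈ alive j \ alive (j + 1) := ⟨h4, h3⟩
          rw [hys, h1 h4, hRs, Set.indicator_of_mem h4, Set.indicator_of_mem h5]
          have h6 := (abs_le.1 (hω j hj)).1
          have h7 := h4 j le_rfl
          have h8 : |X (j + 1) ω - X j ω| ≤ |X (j + 1) ω| + K :=
            (abs_sub _ _).trans (add_le_add_right h7.2 _)
          have h9 := mul_le_mul_of_nonneg_left h8 hc
          have h10 := mul_nonneg hc (hR0 j ω)
          nlinarith [h7.1]
        · have h5 : ω ∉ alive j \ alive (j + 1) := fun h ↦ h4 h.1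
          rw [hys, hRs, Set.indicator_of_notMem h4, Set.indicator_of_notMem h5, zero_mul, add_zero,
            add_zero]
          exact h2 h4
  -- Adding the worst possible loss makes the variable nonnegative, ready for Markov's inequality.
  set f : Ω → ℝ := fun ω ↦ y n ω + (δ + c * (K + R n ω)) with hf
  have hfi : Integrable f P :=
    hyi.add ((integrable_const δ).add (((integrable_const K).add hRi).const_mul c))
  have hf0 : 0 ≤ᵐ[P] f := by
    filter_upwards [hpath] with ω hω
    obtain ⟨h1, h2⟩ := hω n le_rfl
    change 0 ≤ y n ω + (δ + c * (K + R n ω))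
    by_cases h3 : ω ∈ alive n
    · rw [h1 h3]
      have h4 := (h3 n le_rfl).1
      have h5 : 0 ≤ c * (K + R n ω) := mul_nonneg hc (add_nonneg hK (hR0 n ω))
      linarith
    · linarith [h2 h3]
  have hfint : ∫ ω, f ω ∂P ≤ δ + c * (K + ∫ ω, |X n ω| ∂P) := by
    have h1 : ∫ ω, f ω ∂P = ∫ ω, y n ω ∂P + ∫ ω, δ + c * (K + R n ω) ∂P :=
      integral_add hyi ((integrable_const δ).add (((integrable_const K).add hRi).const_mul c))
    have h2 : ∫ ω, δ + c * (K + R n ω) ∂P = δ + c * (K + ∫ ω, R n ω ∂P) := by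
      have h3 : Integrable (fun ω ↦ c * (K + R n ω)) P :=
        ((integrable_const K).add hRi).const_mul c
      rw [integral_add (integrable_const δ) h3, integral_const_mul,
        integral_add (integrable_const K) hRi]
      simp
    rw [h1, hy0, zero_add, h2]
    gcongr
  have hmark := mul_meas_ge_le_integral_of_nonneg hf0 hfi η
  have hsub : P {ω | η ≤ x n ω ∧ ∀ j ≤ n, -δ ≤ x j ω ∧ |X j ω| ≤ K} ≤ P {ω | η ≤ f ω} := by
    refine measure_mono_ae ?_
    filter_upwards [hpath] with ω hω h1
    change η ≤ y n ω + (δ + c * (K + R n ω))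
    have h2 := (hω n le_rfl).1 h1.2
    have h3 : 0 ≤ c * (K + R n ω) := mul_nonneg hc (add_nonneg hK (hR0 n ω))
    have h4 : η ≤ x n ω := h1.1
    linarith
  refine hsub.trans ?_
  rw [← ofReal_measureReal]
  refine ENNReal.ofReal_le_ofReal ?_
  rw [le_div_iff₀ hη, mul_comm]
  exact hmark.trans hfint

end GainBound

/-! ### Simple integrands as discrete transforms. -/

namespace SimpleIntegrand

variable {Ω : Type*} {mΩ : MeasurableSpace Ω} {T : ℝ} [hT : Fact (0 ≤ T)]
  {𝓕 : Filtration (Set.Icc (0 : ℝ) T) mΩ} {P : Measure Ω}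

/-- The trading times of a simple integrand, indexed by the natural numbers. -/
def time (H : SimpleIntegrand 𝓕 P) (j : ℕ) : Ω → Set.Icc (0 : ℝ) T :=
  H.τ ⟨min j H.n, Nat.lt_succ_of_le (min_le_right _ _)⟩

/-- The values of a simple integrand, indexed by the natural numbers. -/
def coef (H : SimpleIntegrand 𝓕 P) (j : ℕ) (ω : Ω) : ℝ :=
  if h : j < H.n then H.f ⟨j, h⟩ ω else 0

lemma time_mono (H : SimpleIntegrand 𝓕 P) (ω : Ω) : Monotone fun j ↦ H.time j ω := fun i j hij ↦
  H.mono ω (Fin.mk_le_mk.2 (by gcongr))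

lemma time_n (H : SimpleIntegrand 𝓕 P) (ω : Ω) : H.time H.n ω = ⊤ := by
  rw [← H.τ_last ω, time]
  congr
  exact min_self _

lemma isStoppingTime_time (H : SimpleIntegrand 𝓕 P) (j : ℕ) :
    IsStoppingTime 𝓕 (fun ω ↦ (H.time j ω : WithTop (Set.Icc (0 : ℝ) T))) :=
  H.isStoppingTime _

/-- The filtration sampled at the trading times of a simple integrand. -/
def sampled (H : SimpleIntegrand 𝓕 P) : Filtration ℕ mΩ where
  seq j := (H.isStoppingTime_time j).measurableSpace
  mono' i j hij := (H.isStoppingTime_time i).measurableSpace_mono (H.isStoppingTime_time j)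
    fun ω ↦ WithTop.coe_le_coe.2 (H.time_mono ω hij)
  le' j := (H.isStoppingTime_time j).measurableSpace_le

lemma stronglyMeasurable_coef (H : SimpleIntegrand 𝓕 P) (j : ℕ) :
    StronglyMeasurable[H.sampled j] (H.coef j) := by
  by_cases h : j < H.n
  · have h1 : (⟨min j H.n, Nat.lt_succ_of_le (min_le_right _ _)⟩ : Fin (H.n + 1)) =
        (⟨j, h⟩ : Fin H.n).castSucc := Fin.ext (min_eq_left h.le)
    have h2 : H.sampled j = (H.isStoppingTime (⟨j, h⟩ : Fin H.n).castSucc).measurableSpace := by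
      change (H.isStoppingTime _).measurableSpace = _
      simp only [h1]
    have h3 : H.coef j = H.f ⟨j, h⟩ := by ext ω; simp [coef, h]
    rw [h2, h3]
    exact (H.measurable_f ⟨j, h⟩).stronglyMeasurable
  · have h3 : H.coef j = fun _ ↦ 0 := by ext ω; simp [coef, h]
    rw [h3]
    exact stronglyMeasurable_const

lemma ae_abs_coef_le (H : SimpleIntegrand 𝓕 P) (j : ℕ) : ∃ C, ∀ᵐ ω ∂P, |H.coef j ω| ≤ C := by
  by_cases h : j < H.n
  · refine ⟨(eLpNorm (H.f ⟨j, h⟩) ∞ P).toReal, ?_⟩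
    have h1 := (H.memLp_f ⟨j, h⟩).2
    rw [eLpNorm_exponent_top] at h1
    filter_upwards [ae_le_eLpNormEssSup (f := H.f ⟨j, h⟩) (μ := P)] with ω hω
    simp only [coef, h, dif_pos, eLpNorm_exponent_top]
    rw [← Real.norm_eq_abs, ← toReal_enorm]
    exact ENNReal.toReal_mono h1.ne hω
  · exact ⟨0, ae_of_all _ fun ω ↦ by simp [coef, h]⟩

lemma time_of_lt (H : SimpleIntegrand 𝓕 P) (j : Fin H.n) :
    H.time j = H.τ j.castSucc ∧ H.time (j + 1) = H.τ j.succ := by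
  exact ⟨congrArg H.τ (Fin.ext (min_eq_left j.2.le)), congrArg H.τ (Fin.ext (min_eq_left j.2))⟩

/-- A coefficient may exceed the norm only where its trading interval is empty, and there the
increment is zero. -/
lemma ae_abs_coef_mul_le (H : SimpleIntegrand 𝓕 P) (hH : H.supNorm ≠ ∞) :
    ∀ᵐ ω ∂P, ∀ (j : ℕ) (x : Set.Icc (0 : ℝ) T → ℝ) (t : Set.Icc (0 : ℝ) T),
      |H.coef j ω * (x (min (H.time (j + 1) ω) t) - x (min (H.time j ω) t))| ≤
        H.supNorm.toReal * |x (min (H.time (j + 1) ω) t) - x (min (H.time j ω) t)| := by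
  filter_upwards [H.ae_abs_f_le hH] with ω hω j x t
  rw [abs_mul]
  by_cases h : j < H.n
  · obtain ⟨h1, h2⟩ := H.time_of_lt ⟨j, h⟩
    simp only at h1 h2
    rcases (H.time_mono ω (Nat.le_succ j)).eq_or_lt with h3 | h3
    · have h4 : H.time (j + 1) ω = H.time j ω := h3.symm
      rw [h4]
      simp
    · refine mul_le_mul_of_nonneg_right ?_ (abs_nonneg _)
      rw [coef, dif_pos h]
      refine hω ⟨j, h⟩ ?_
      rw [← h1, ← h2]
      exact h3
  · rw [coef, dif_neg h, abs_zero, zero_mul]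
    positivity

lemma integral_eq_sum_range (H : SimpleIntegrand 𝓕 P) (S : Set.Icc (0 : ℝ) T → Ω → ℝ)
    (t : Set.Icc (0 : ℝ) T) (ω : Ω) :
    H.integral S t ω = ∑ j ∈ Finset.range H.n,
      H.coef j ω * (S (min (H.time (j + 1) ω) t) ω - S (min (H.time j ω) t) ω) := by
  rw [Finset.sum_range, integral]
  refine Finset.sum_congr rfl fun j _ ↦ ?_
  obtain ⟨h1, h2⟩ := H.time_of_lt j
  rw [h1, h2, coef, dif_pos j.2]

lemma integral_time (H : SimpleIntegrand 𝓕 P) (S : Set.Icc (0 : ℝ) T → Ω → ℝ) {k : ℕ}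
    (hk : k ≤ H.n) (ω : Ω) :
    H.integral S (H.time k ω) ω = partialSum
      (fun j ω ↦ H.coef j ω * (S (H.time (j + 1) ω) ω - S (H.time j ω) ω)) k ω := by
  rw [integral_eq_sum_range, partialSum, ← Finset.sum_range_add_sum_Ico _ hk]
  have h1 : ∑ j ∈ Finset.Ico k H.n, H.coef j ω *
      (S (min (H.time (j + 1) ω) (H.time k ω)) ω - S (min (H.time j ω) (H.time k ω)) ω) = 0 := by
    refine Finset.sum_eq_zero fun j hj ↦ ?_
    have hj' := (Finset.mem_Ico.1 hj).1
    rw [min_eq_right (H.time_mono ω hj'), min_eq_right (H.time_mono ω (hj'.trans (Nat.le_succ j))),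
      sub_self, mul_zero]
  rw [h1, add_zero]
  refine Finset.sum_congr rfl fun j hj ↦ ?_
  have hj' := Finset.mem_range.1 hj
  rw [min_eq_left (H.time_mono ω hj'), min_eq_left (H.time_mono ω hj'.le)]

lemma ae_abs_integral_le (H : SimpleIntegrand 𝓕 P) (hH : H.supNorm ≠ ∞)
    (A : Set.Icc (0 : ℝ) T → Ω → ℝ) :
    ∀ᵐ ω ∂P, BoundedVariationOn (fun t ↦ A t ω) Set.univ → ∀ t, |H.integral A t ω| ≤
      H.supNorm.toReal * (eVariationOn (fun t ↦ A t ω) Set.univ).toReal := by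
  filter_upwards [H.ae_abs_coef_mul_le hH] with ω hω hA t
  rw [integral_eq_sum_range]
  refine (Finset.abs_sum_le_sum_abs _ _).trans
    ((Finset.sum_le_sum fun j _ ↦ hω j (fun t ↦ A t ω) t).trans ?_)
  rw [← Finset.mul_sum]
  refine mul_le_mul_of_nonneg_left ?_ ENNReal.toReal_nonneg
  have h1 : Monotone fun j ↦ min (H.time j ω) t := fun i j hij ↦
    min_le_min_right t (H.time_mono ω hij)
  refine (ENNReal.ofReal_le_iff_le_toReal hA).1 (le_trans (le_of_eq ?_)
    (eVariationOn.sum_le (f := fun t ↦ A t ω) (n := H.n) h1 fun i ↦ Set.mem_univ _))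
  rw [ENNReal.ofReal_sum_of_nonneg fun _ _ ↦ abs_nonneg _]
  exact Finset.sum_congr rfl fun j _ ↦ by rw [edist_dist, Real.dist_eq]

/-- A real supremum over an unbounded range would default to `0`; boundedness of càdlàg paths makes
it a genuine bound for the losses. -/
lemma bddAbove_integral_negPart (H : SimpleIntegrand 𝓕 P) {S : Set.Icc (0 : ℝ) T → Ω → ℝ} {ω : Ω}
    (hS : IsCadlag fun t ↦ S t ω) : BddAbove (Set.range fun t ↦ (H.integral S t ω)⁻) := by
  obtain ⟨C, hC⟩ := hS.exists_bound
  refine ⟨∑ j : Fin H.n, |H.f j ω| * (C + C), ?_⟩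
  rintro _ ⟨t, rfl⟩
  calc (H.integral S t ω)⁻ ≤ |H.integral S t ω| := max_le (neg_le_abs _) (abs_nonneg _)
    _ ≤ ∑ j : Fin H.n, |H.f j ω| * (C + C) := by
      refine (Finset.abs_sum_le_sum_abs _ _).trans (Finset.sum_le_sum fun j _ ↦ ?_)
      rw [abs_mul]
      gcongr
      exact (abs_sub _ _).trans (add_le_add (hC _) (hC _))

end SimpleIntegrand

/-! ### Semimartingales satisfy condition 1. -/

section NoFreeLunch

variable {Ω : Type*} {mΩ : MeasurableSpace Ω} {P : Measure Ω} [IsProbabilityMeasure P]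
  {T : ℝ} [hT : Fact (0 ≤ T)] {𝓕 : Filtration (Set.Icc (0 : ℝ) T) mΩ}
  {S M : Set.Icc (0 : ℝ) T → Ω → ℝ}

/-- The index set has a greatest element `T`, so `∞` is the only point above it and is isolated. -/
lemma eventually_eq_top_of_tendsto {u : ℕ → WithTop (Set.Icc (0 : ℝ) T)}
    (h : Tendsto u atTop (𝓝 ⊤)) : ∀ᶠ k in atTop, u k = ⊤ := by
  filter_upwards [h.eventually (eventually_gt_nhds
    (WithTop.coe_lt_top (⊤ : Set.Icc (0 : ℝ) T)))] with k hk
  by_contra h1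
  obtain ⟨t, ht⟩ := WithTop.ne_top_iff_exists.1 h1
  rw [← ht, WithTop.coe_lt_coe] at hk
  exact not_top_lt hk

/-- A local martingale coincides with a càdlàg martingale outside an event of arbitrarily small
probability. -/
lemma IsLocalMartingale.exists_martingale (hM : IsLocalMartingale M 𝓕 P) {ε : ℝ≥0∞} (hε : 0 < ε) :
    ∃ N : Set.Icc (0 : ℝ) T → Ω → ℝ, Martingale N 𝓕 P ∧ IsCadlagProcess N P ∧
      P {ω | ¬ ∀ t, M t ω = N t ω} ≤ ε := by
  obtain ⟨τ, hτ, hN⟩ := hM.locally_martingale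
  have h1 : ∀ᵐ ω ∂P, ∀ᶠ k in atTop, τ k ω = ⊤ :=
    hτ.tendsto_top.mono fun ω h ↦ eventually_eq_top_of_tendsto h
  have h2 : Tendsto (fun k ↦ P {ω | τ k ω = ⊤}ᶜ) atTop (𝓝 (P ∅)) :=
    tendsto_measure_of_ae_tendsto_indicator_of_isFiniteMeasure atTop MeasurableSet.empty
      (fun k ↦ (hτ.isStoppingTime k).measurableSet_eq_top.compl)
      (h1.mono fun ω h ↦ h.mono fun k hk ↦ by simp [hk])
  rw [measure_empty] at h2
  obtain ⟨k, hk⟩ := (h2.eventually (eventually_le_nhds hε)).exists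
  refine ⟨_, hN k, ?_, le_trans (measure_mono ?_) hk⟩
  · filter_upwards [hM.cadlag] with ω hω
    by_cases h3 : ⊥ < τ k ω
    · simp only [stoppedProcess, Set.indicator_of_mem (s := {ω | ⊥ < τ k ω}) h3]
      induction hs : τ k ω with
      | top => simpa using hω
      | coe s =>
        refine (congrArg IsCadlag (funext fun t ↦ ?_)).mp (hω.stopped s)
        rw [min_comm s t]
        rfl
    · simp only [stoppedProcess, Set.indicator_of_notMem (s := {ω | ⊥ < τ k ω}) h3]
      exact isCadlag_const 0
  · intro ω hω h4
    refine (show ¬ ∀ t, M t ω = _ from hω) fun t ↦ ?_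
    have h4 : τ k ω = ⊤ := h4
    have h5 : ω ∈ {ω | ⊥ < τ k ω} := by
      change ⊥ < τ k ω
      rw [h4]
      exact WithTop.coe_lt_top ⊥
    simp [stoppedProcess, h4]

lemma integral_congr_of_forall (H : SimpleIntegrand 𝓕 P) {X Y : Set.Icc (0 : ℝ) T → Ω → ℝ} {ω : Ω}
    (h : ∀ t, S t ω = X t ω + Y t ω) (t : Set.Icc (0 : ℝ) T) :
    H.integral S t ω = H.integral X t ω + H.integral Y t ω := by
  simp only [SimpleIntegrand.integral, h, ← Finset.sum_add_distrib]
  exact Finset.sum_congr rfl fun j _ ↦ by ring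

/-- By optional sampling, `N` at the trading times is a discrete martingale, and at those times the
integral is its transform; `measure_gain_le` applies. -/
lemma measure_gain_integral_le (h𝓕 : UsualConditions 𝓕 P) {N : Set.Icc (0 : ℝ) T → Ω → ℝ}
    (hN : Martingale N 𝓕 P) (hNc : IsCadlagProcess N P) (H : SimpleIntegrand 𝓕 P)
    (hH : H.supNorm ≠ ∞) {δ K η : ℝ} (hδ : 0 ≤ δ) (hK : 0 ≤ K) (hη : 0 < η) :
    P {ω | η ≤ H.integral N ⊤ ω ∧ ∀ t, -δ ≤ H.integral N t ω ∧ |N t ω| ≤ K} ≤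
      ENNReal.ofReal ((δ + H.supNorm.toReal * (K + ∫ ω, |N ⊤ ω| ∂P)) / η) := by
  have hs := fun j ↦ h𝓕.sample_ae_eq_condExp hN hNc (H.isStoppingTime_time j)
  have hX : Martingale (fun j ω ↦ N (H.time j ω) ω) H.sampled P := by
    refine ⟨fun j ↦ h𝓕.stronglyMeasurable_stopped hN.1 hNc (H.isStoppingTime_time j),
      fun i j hij ↦ ?_⟩
    exact (condExp_congr_ae (hs j).2).trans ((condExp_condExp_of_le (H.sampled.mono hij)
      (H.sampled.le j)).trans (hs i).2.symm)
  have h1 := measure_gain_le hX H.stronglyMeasurable_coef H.ae_abs_coef_le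
    (ENNReal.toReal_nonneg (a := H.supNorm)) hδ hK hη H.n (by
      filter_upwards [H.ae_abs_coef_mul_le hH] with ω hω i _
      simpa using hω i (fun t ↦ N t ω) ⊤)
  simp only [H.time_n] at h1
  refine le_trans (measure_mono ?_) h1
  rintro ω ⟨hω, hω'⟩
  refine ⟨?_, fun j hj ↦ ?_⟩
  · have h2 := H.integral_time N le_rfl ω
    rw [H.time_n] at h2
    rw [← h2]
    exact hω
  · rw [← H.integral_time N hj ω]
    exact hω' _

/-- Semimartingales satisfy the no free lunch condition. -/
theorem IsSemimartingale.noFreeLunch (h𝓕 : UsualConditions 𝓕 P)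
    (hc : IsCadlagProcess S P) (h : IsSemimartingale S 𝓕 P) : NoFreeLunch 𝓕 P S := by
  obtain ⟨M, A, hM, hA, hMA⟩ := h
  intro H hH hneg
  obtain ⟨Z, hZm, hZ0, hZ⟩ := exists_measurable_variation_bound
    (fun t ↦ ((hA.adapted t).mono (𝓕.le t)).measurable) hA.cadlag hA.finiteVariation
  rw [tendstoInMeasure_zero_iff] at hneg ⊢
  intro η hη
  rw [ENNReal.tendsto_nhds_zero]
  intro ε hε
  -- Five exceptional events: `M` differs from `N`, the variation of `A` exceeds `C`, `|N|` exceeds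
  -- `K`, the loss reaches `δ`, and `N` produces a large gain.
  have hε5 : 0 < ε / 5 := ENNReal.div_pos hε.ne' (by simp)
  obtain ⟨e, he0, he⟩ := ENNReal.lt_iff_exists_nnreal_btwn.1 hε5
  have he0' : 0 < (e : ℝ) := by exact_mod_cast he0
  obtain ⟨N, hN, hNc, hMN⟩ := hM.exists_martingale hε5
  obtain ⟨Z', hZ'm, hZ'0, hZ'⟩ :=
    exists_measurable_bound (fun t ↦ ((hN.1 t).mono (𝓕.le t)).measurable) hNc
  obtain ⟨C, hC0, hC⟩ := tight_of_measurable (P := P) (I := Unit) hZm.aemeasurable _ hε5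
  obtain ⟨K, hK0, hK⟩ := tight_of_measurable (P := P) (I := Unit) hZ'm.aemeasurable _ hε5
  set m := ∫ ω, |N ⊤ ω| ∂P with hm
  have hm0 : 0 ≤ m := integral_nonneg fun _ ↦ abs_nonneg _
  -- With this `δ`, the bound for the gain probability tends to `e / 2` as the norms vanish, hence
  -- is eventually at most `e < ε / 5`.
  set δ : ℝ := e * η / 2 with hδ
  have hδ0 : 0 < δ := by positivity
  set c : ℕ → ℝ := fun n ↦ (H n).supNorm.toReal with hcdef
  have hc0 : Tendsto c atTop (𝓝 0) := by
    have := (ENNReal.tendsto_toReal ENNReal.zero_ne_top).comp hH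
    rwa [ENNReal.toReal_zero] at this
  have hratio : Tendsto (fun n ↦ (δ + c n * C + c n * (K + m)) / (η - c n * C)) atTop
      (𝓝 ((δ + 0 * C + 0 * (K + m)) / (η - 0 * C))) :=
    ((tendsto_const_nhds.add (hc0.mul_const C)).add (hc0.mul_const (K + m))).div
      (tendsto_const_nhds.sub (hc0.mul_const C)) (by simpa using hη.ne')
  have hlim : (δ + 0 * C + 0 * (K + m)) / (η - 0 * C) = e / 2 := by
    rw [hδ, zero_mul, zero_mul, add_zero, add_zero, sub_zero]
    field_simp
  rw [hlim] at hratio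
  have hη' : Tendsto (fun n ↦ η - c n * C) atTop (𝓝 (η - 0 * C)) :=
    tendsto_const_nhds.sub (hc0.mul_const C)
  rw [zero_mul, sub_zero] at hη'
  filter_upwards [hratio.eventually (eventually_le_nhds (half_lt_self he0')),
    hη'.eventually (eventually_gt_nhds hη), hH.eventually (eventually_lt_nhds ENNReal.zero_lt_top),
    (hneg δ hδ0).eventually (eventually_le_nhds hε5)] with n h1 h2 h3 h4
  have hcn : 0 ≤ c n := ENNReal.toReal_nonneg
  -- The integral against `A` is at most `c n * C`, which loosens the loss bound and lowers the gain
  -- threshold for `N`.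
  have hgain := measure_gain_integral_le h𝓕 hN hNc (H n) h3.ne (δ := δ + c n * C) (K := K)
    (η := η - c n * C) (by positivity) hK0 h2
  have hgain' := hgain.trans ((ENNReal.ofReal_le_ofReal h1).trans
    ((ENNReal.ofReal_coe_nnreal (p := e)).le.trans he.le))
  have hsub : P {ω | η ≤ |((H n).integral S ⊤ ω)⁺|} ≤
      P (((({ω | ¬ ∀ t, M t ω = N t ω} ∪ {ω | C < Z ω}) ∪ {ω | K < Z' ω}) ∪
        {ω | δ ≤ |⨆ t, ((H n).integral S t ω)⁻|}) ∪
        {ω | η - c n * C ≤ (H n).integral N ⊤ ω ∧ ∀ t,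
          -(δ + c n * C) ≤ (H n).integral N t ω ∧ |N t ω| ≤ K}) := by
    refine measure_mono_ae ?_
    filter_upwards [hMA, hZ, hZ', hA.finiteVariation, hc, (H n).ae_abs_integral_le h3.ne A]
      with ω g1 g2 g3 g4 g5 g6 (g7 : η ≤ |((H n).integral S ⊤ ω)⁺|)
    by_contra hcon
    have hcon' : ¬ ((((¬ (∀ t, M t ω = N t ω) ∨ C < Z ω) ∨ K < Z' ω) ∨
      δ ≤ |⨆ t, ((H n).integral S t ω)⁻|) ∨ (η - c n * C ≤ (H n).integral N ⊤ ω ∧ ∀ t,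
          -(δ + c n * C) ≤ (H n).integral N t ω ∧ |N t ω| ≤ K)) := hcon
    simp only [not_or, not_not, not_lt, not_le] at hcon'
    obtain ⟨⟨⟨⟨k1, k2⟩, k3⟩, k4⟩, k5⟩ := hcon'
    have hsum : ∀ t, (H n).integral S t ω = (H n).integral N t ω + (H n).integral A t ω :=
      integral_congr_of_forall (H n) fun t ↦ by rw [g1 t, k1 t]
    have hAle : ∀ t, |(H n).integral A t ω| ≤ c n * C := fun t ↦ by
      refine (g6 g4 t).trans (mul_le_mul_of_nonneg_left ?_ hcn)
      exact (ENNReal.toReal_le_of_le_ofReal (hZ0 ω) g2).trans k2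
    have hpos : η ≤ (H n).integral S ⊤ ω := by
      rw [abs_of_nonneg (posPart_nonneg _)] at g7
      rcases le_max_iff.1 g7 with h | h
      · exact h
      · exact absurd h (not_le.2 hη)
    have hlow : ∀ t, -δ ≤ (H n).integral S t ω := fun t ↦ by
      have l1 := le_ciSup ((H n).bddAbove_integral_negPart g5) t
      have l2 : -(H n).integral S t ω ≤ ((H n).integral S t ω)⁻ := le_max_left _ _
      linarith [(le_abs_self (⨆ t, ((H n).integral S t ω)⁻)).trans k4.le]
    refine k5 ⟨?_, fun t ↦ ⟨?_, (g3 t).trans k3⟩⟩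
    · linarith [hsum ⊤, (abs_le.1 (hAle ⊤)).2]
    · linarith [hsum t, hlow t, (abs_le.1 (hAle t)).2]
  calc P {ω | η ≤ |((H n).integral S ⊤ ω)⁺|}
      ≤ ε / 5 + ε / 5 + ε / 5 + ε / 5 + ε / 5 :=
        hsub.trans ((measure_union_le _ _).trans (add_le_add ((measure_union_le _ _).trans
          (add_le_add ((measure_union_le _ _).trans (add_le_add ((measure_union_le _ _).trans
            (add_le_add hMN (hC ()))) (hK ()))) h4)) hgain'))
    _ = 5 * (ε / 5) := by ring
    _ = ε := ENNReal.mul_div_cancel (by simp) (by simp)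

end NoFreeLunch

/-! ### The equivalence. -/

section Equivalence

variable {Ω : Type*} {mΩ : MeasurableSpace Ω} {P : Measure Ω} [IsProbabilityMeasure P]
  {T : ℝ} [hT : Fact (0 ≤ T)] {𝓕 : Filtration (Set.Icc (0 : ℝ) T) mΩ}
  {S : Set.Icc (0 : ℝ) T → Ω → ℝ}

/-- The interval is a single point, so every path has zero variation. The case is separate because
all grid points coincide, whereas the discrete decomposition recovers indices from them. -/
lemma isSemimartingale_of_eq_zero (hT0 : T = 0) (hS : StronglyAdapted 𝓕 S)
    (hc : IsCadlagProcess S P) : IsSemimartingale S 𝓕 P := by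
  refine ⟨fun _ _ ↦ 0, S, ⟨fun _ ↦ stronglyMeasurable_const, ae_of_all _ fun _ ↦ isCadlag_const 0,
    Locally.of_prop (martingale_zero ℝ 𝓕 P)⟩, ⟨hS, hc, ae_of_all _ fun ω ↦ ?_⟩,
    ae_of_all _ fun ω t ↦ (zero_add _).symm⟩
  have h1 : (Set.univ : Set (Set.Icc (0 : ℝ) T)).Subsingleton := fun s _ t _ ↦
    Subtype.ext (by linarith [s.2.1, s.2.2, t.2.1, t.2.2])
  rw [BoundedVariationOn, eVariationOn.subsingleton _ h1]
  exact ENNReal.zero_ne_top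

theorem NoFreeLunch.isSemimartingale (h𝓕 : UsualConditions 𝓕 P) (hS : StronglyAdapted 𝓕 S)
    (hc : IsCadlagProcess S P) (h : NoFreeLunch 𝓕 P S) : IsSemimartingale S 𝓕 P := by
  rcases (T_nonneg (T := T)).eq_or_lt with hT0 | hpos
  · exact isSemimartingale_of_eq_zero hT0.symm hS hc
  · exact isSemimartingale_of_approximate_decomposition h𝓕 hS hc fun ε hε ↦
      exists_approximate_decomposition hpos h𝓕 hS hc h hε

end Equivalence

end BichtelerDellacherie

end

theorem theorem1p6 {Ω : Type*} {mΩ : MeasurableSpace Ω} (P : Measure Ω) [IsProbabilityMeasure P]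
    (T : ℝ) [Fact (0 ≤ T)] (𝓕 : Filtration (Set.Icc (0 : ℝ) T) mΩ)
    (h𝓕 : BichtelerDellacherie.UsualConditions 𝓕 P)
    (S : Set.Icc (0 : ℝ) T → Ω → ℝ) (hS_adapted : StronglyAdapted 𝓕 S)
    (hS_cadlag : BichtelerDellacherie.IsCadlagProcess S P) :
    (∀ H : ℕ → BichtelerDellacherie.SimpleIntegrand 𝓕 P,
        Tendsto (fun n ↦ (H n).supNorm) atTop (𝓝 0) →
        TendstoInMeasure P (fun n ω ↦ ⨆ t, ((H n).integral S t ω)⁻) atTop (fun _ ↦ 0) →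
        TendstoInMeasure P (fun n ω ↦ ((H n).integral S ⊤ ω)⁺) atTop (fun _ ↦ 0)) ↔
      BichtelerDellacherie.IsSemimartingale S 𝓕 P := by
  exact ⟨fun h ↦ BichtelerDellacherie.NoFreeLunch.isSemimartingale h𝓕 hS_adapted hS_cadlag h,
    fun h ↦ BichtelerDellacherie.IsSemimartingale.noFreeLunch h𝓕 hS_cadlag h⟩
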